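/- Let $F=\mathbb F_q$ be a finite field. Let $\mathrm{AGL}_4(F)$ be the group of invertible $5\times5$ matrices over $F$ with first column $(1,0,0,0,0)^{T}$. A subgroup $R\le \mathrm{AGL}_4(F)$ is \emph{regular} if for every $v\in F^4$ it contains exactly one element with first row $(1,v)$. Two matrices $A,B\in \mathrm{Mat}_3(F)$ are \emph{projectively congruent} if $PAP^{T}=\lambda B$ for some $P\in\mathrm{GL}_3(F)$ and $\lambda\in F\setminus\{0\}$. Write $E_{i,j}$ for the matrix units. Define the following subgroups of $\mathrm{AGL}_4(F)$, where in each case $x_1,\dots,x_4$ run over $F$, and where $\alpha,\beta\in F$ and $D\in\mathrm{Mat}_3(F)$: $$S_{(5)}=\begin{pmatrix}1&x_1&x_2&x_3&x_4\\0&1&x_1&x_2&x_3\\0&0&1&x_1&x_2\\0&0&0&1&x_1\\0&0&0&0&1\end{pmatrix},\quad S_{(4,1)}=\begin{pmatrix}1&x_1&x_2&x_3&x_4\\0&1&x_1&x_2&0\\0&0&1&x_1&0\\0&0&0&1&0\\0&0&0&0&1\end{pmatrix},\quad S_{(3,2)}^{\sharp}=\begin{pmatrix}1&x_1&x_2&x_3&x_4\\0&1&x_1&0&x_2\\0&0&1&0&x_1\\0&0&0&1&x_3\\0&0&0&0&1\end{pmatrix},$$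 $$U_1(\alpha,\beta)=\begin{pmatrix}1&x_1&x_2&x_3&x_4\\0&1&0&x_1&x_2\\0&0&1&\beta x_2&x_1+\alpha x_2\\0&0&0&1&0\\0&0&0&0&1\end{pmatrix},\quad R_D=\begin{pmatrix}1&X&x_4\\0&I_3&DX^{T}\\0&0&1\end{pmatrix}\ \text{ with } X=(x_1,x_2,x_3).$$ Then there are exactly $11$ conjugacy classes of abelian regular subgroups of $\mathrm{AGL}_4(F)$. Equivalently, there are exactly $11$ isomorphism classes of commutative nilpotent associative $F$-algebras of dimension $4$, and the correspondence is as follows: for each abelian regular subgroup $R$, the set of matrices $R-I_5=\{r-I_5:r\in R\}$ is a commutative nilpotent $F$-algebra of dimension $4$; every commutative nilpotent associative $F$-algebra of dimension $4$ is isomorphic to some such $R-I_5$; and two abelian regular subgroups $R,S$ are conjugate in $\mathrm{AGL}_4(F)$ if and only if the algebras $R-I_5$ and $S-I_5$ are isomorphic. Moreover: (a) If $q$ is odd, there is $\xi\in F$ with $x^2-\xi$ irreducible over $F$, and for every such $\xi$ the set $$\Pi_S(F)=\{0,\ E_{1,1},\ E_{1,1}+E_{2,2},\ E_{1,1}+\xi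 E_{2,2},\ I_3\}$$ is a complete set of pairwise inequivalent representatives of the projective congruence classes of symmetric matrices in $\mathrm{Mat}_3(F)$, and the $11$ subgroups $$S_{(5)},\ S_{(4,1)},\ S_{(3,2)}^{\sharp},\ U_1(0,0),\ U_1(0,1),\ U_1(0,\xi),\ R_D\ (D\in\Pi_S(F))$$ are abelian regular and represent each conjugacy class of abelian regular subgroups of $\mathrm{AGL}_4(F)$ exactly once. (b) If $q$ is even, there is $\xi\in F$ with $x^2+x+\xi$ irreducible over $F$, and for every such $\xi$ the set $$\Pi_S(F)=\{0,\ E_{1,1},\ E_{1,1}+E_{2,2},\ E_{2,3}+E_{3,2},\ I_3\}$$ is a complete set of pairwise inequivalent representatives of the projective congruence classes of symmetric matrices in $\mathrm{Mat}_3(F)$, and the $11$ subgroups $$S_{(5)},\ S_{(4,1)},\ S_{(3,2)}^{\sharp},\ U_1(0,0),\ U_1(1,0),\ U_1(1,\xi),\ R_D\ (D\in\Pi_S(F))$$ are abelian regular and represent each conjugacy class of abelian regular subgroups of $\mathrm{AGL}_4(F)$ exactly once. -/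

import Mathlib

open Matrix Polynomial

section AffineGroup

variable {F : Type*} [Field F] {n : ℕ}

/-- The affine group `AGL_n(F)`: the subgroup of `GL_{n+1}(F)` of all invertible matrices whose
first column is `(1, 0, …, 0)ᵀ`. -/
def AGL (n : ℕ) (F : Type*) [Field F] : Subgroup (GL (Fin (n + 1)) F) where
  carrier := {g | g.val *ᵥ Pi.single 0 1 = Pi.single 0 1}
  one_mem' := by
    change (1 : Matrix (Fin (n + 1)) (Fin (n + 1)) F) *ᵥ _ = _
    rw [Matrix.one_mulVec]
  mul_mem' := by
    intro a b ha hb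
    change a.val *ᵥ _ = _ at ha
    change b.val *ᵥ _ = _ at hb
    change (a * b).val *ᵥ _ = _
    rw [Units.val_mul, ← Matrix.mulVec_mulVec, hb, ha]
  inv_mem' := by
    intro a ha
    change a.val *ᵥ _ = _ at ha
    have h : (a⁻¹).val *ᵥ (a.val *ᵥ Pi.single 0 1)
        = (Pi.single 0 1 : Fin (n + 1) → F) := by
      rw [Matrix.mulVec_mulVec, ← Units.val_mul, inv_mul_cancel, Units.val_one, Matrix.one_mulVec]
    rwa [ha] at h

/-- Membership in `AGL_n(F)`, read off the first column. -/
theorem mem_AGL_iff (g : GL (Fin (n + 1)) F) :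
    g ∈ AGL n F ↔ ∀ i, g.val i 0 = if i = 0 then 1 else 0 := by
  change g.val *ᵥ Pi.single 0 1 = Pi.single 0 1 ↔ _
  rw [Matrix.mulVec_single_one, funext_iff]
  simp [Matrix.col, Pi.single_apply]

/-- The underlying matrix of an affine transformation. -/
def AGL.toMat (g : AGL n F) : Matrix (Fin (n + 1)) (Fin (n + 1)) F := g.val.val

/-- `R ≤ AGL_n(F)` is regular: for every `v ∈ Fⁿ` there is a unique element of `R` with first
row `(1, v)`. -/
def IsRegularSubgroup (R : Subgroup (AGL n F)) : Prop :=
  ∀ v : Fin n → F, ∃! r : AGL n F, r ∈ R ∧ AGL.toMat r 0 = Fin.cons 1 v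

/-- Abelian regular subgroups of `AGL_n(F)`. -/
def IsAbelianRegular (R : Subgroup (AGL n F)) : Prop :=
  IsRegularSubgroup R ∧ ∀ a ∈ R, ∀ b ∈ R, a * b = b * a

/-- Conjugacy of subgroups in `AGL_n(F)`. -/
def AreConjSubgroups (R S : Subgroup (AGL n F)) : Prop :=
  ∃ g : AGL n F, R.map (MulAut.conj g).toMonoidHom = S

/-- Conjugacy as an equivalence relation on the abelian regular subgroups of `AGL_n(F)`. -/
def abelianRegularSetoid (n : ℕ) (F : Type*) [Field F] :
    Setoid {R : Subgroup (AGL n F) // IsAbelianRegular R} where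
  r R S := AreConjSubgroups R.1 S.1
  iseqv :=
    { refl := fun R => ⟨1, by ext x; simp [Subgroup.mem_map]⟩
      symm := by
        rintro ⟨R, _⟩ ⟨S, _⟩ ⟨g, hg⟩
        refine ⟨g⁻¹, ?_⟩
        dsimp only at hg ⊢
        rw [← hg, Subgroup.map_map]
        ext x
        simp [Subgroup.mem_map, mul_assoc]
      trans := by
        rintro ⟨R, _⟩ ⟨S, _⟩ ⟨T, _⟩ ⟨g, hg⟩ ⟨h, hh⟩
        refine ⟨h * g, ?_⟩
        dsimp only at hg hh ⊢
        rw [← hh, ← hg, Subgroup.map_map]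
        ext x
        simp [Subgroup.mem_map, mul_assoc] }

/-- The set of conjugacy classes of abelian regular subgroups of `AGL_n(F)`. -/
abbrev AbelianRegularClasses (n : ℕ) (F : Type*) [Field F] :=
  Quotient (abelianRegularSetoid n F)

/-- The family `R` is a complete and irredundant list of representatives of the conjugacy classes
of abelian regular subgroups of `AGL_n(F)`. -/
def IsAbelianRegularTransversal {ι : Type*} (R : ι → Subgroup (AGL n F)) : Prop :=
  (∀ i, IsAbelianRegular (R i)) ∧
    ∀ S : Subgroup (AGL n F), IsAbelianRegular S → ∃! i, AreConjSubgroups S (R i)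

/-- The conditions on `N : Fⁿ → Mat_{n+1}(F)` under which `{I + N x : x ∈ Fⁿ}` is closed under
multiplication and inversion. -/
structure IsSubgroupParam (N : (Fin n → F) → Matrix (Fin (n + 1)) (Fin (n + 1)) F) : Prop where
  row : ∀ x, N x 0 = Fin.cons 0 x
  add : ∀ x y, N (x + y) = N x + N y
  mul : ∀ x y, ∃ z, N x * N y = N z

theorem IsSubgroupParam.zero {N : (Fin n → F) → Matrix (Fin (n + 1)) (Fin (n + 1)) F}
    (h : IsSubgroupParam N) : N 0 = 0 := by
  simpa using h.add 0 0

/-- The subgroup `{I + N x : x ∈ Fⁿ}` of `AGL_n(F)`. -/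
def paramSubgroup (N : (Fin n → F) → Matrix (Fin (n + 1)) (Fin (n + 1)) F)
    (h : IsSubgroupParam N) : Subgroup (AGL n F) where
  carrier := {g | ∃ x, AGL.toMat g = 1 + N x}
  one_mem' := ⟨0, by simp [AGL.toMat, h.zero]⟩
  mul_mem' := by
    rintro a b ⟨x, hx⟩ ⟨y, hy⟩
    obtain ⟨z, hz⟩ := h.mul x y
    refine ⟨x + y + z, ?_⟩
    have hab : AGL.toMat (a * b) = AGL.toMat a * AGL.toMat b := rfl
    rw [hab, hx, hy, h.add, h.add, ← hz]
    noncomm_ring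
  inv_mem' := by
    rintro a ⟨x, hx⟩
    have hmem := (mem_AGL_iff (a⁻¹).val).1 (a⁻¹).2 0
    set y : Fin n → F := fun j => AGL.toMat a⁻¹ 0 j.succ with hy
    have hrow : AGL.toMat a⁻¹ 0 = (1 + N y) 0 := by
      funext j
      rw [Matrix.add_apply, h.row]
      refine Fin.cases ?_ (fun k => ?_) j
      · simpa [AGL.toMat] using hmem
      · simp [hy, (Fin.succ_ne_zero k).symm]
    have hinv : AGL.toMat a⁻¹ * AGL.toMat a = 1 := by
      change (a⁻¹).val.val * a.val.val = 1
      rw [← Units.val_mul, ← Subgroup.coe_mul, inv_mul_cancel]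
      rfl
    obtain ⟨w, hw⟩ := h.mul y x
    have hprod : (1 + N y) * AGL.toMat a = 1 + N (y + x + w) := by
      rw [hx, h.add, h.add, ← hw]
      noncomm_ring
    have hz : y + x + w = 0 := by
      have h1 : ((1 + N y) * AGL.toMat a) 0 = (1 : Matrix (Fin (n + 1)) (Fin (n + 1)) F) 0 := by
        have h0 : ((1 + N y) * AGL.toMat a) 0 = (AGL.toMat a⁻¹ * AGL.toMat a) 0 := by
          funext j
          rw [Matrix.mul_apply, Matrix.mul_apply]
          exact Finset.sum_congr rfl fun k _ => by rw [hrow]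
        rw [h0, hinv]
      rw [hprod] at h1
      funext k
      have h2 := congrFun h1 k.succ
      rw [Matrix.add_apply, h.row] at h2
      simpa using h2
    rw [hz, h.zero, add_zero] at hprod
    refine ⟨y, ?_⟩
    calc AGL.toMat a⁻¹ = 1 * AGL.toMat a⁻¹ := (one_mul _).symm
      _ = (1 + N y) * AGL.toMat a * AGL.toMat a⁻¹ := by rw [hprod]
      _ = (1 + N y) := by
        rw [mul_assoc, mul_eq_one_comm.1 hinv, mul_one]

end AffineGroup

section Representatives

variable {F : Type*} [Field F]

/-- `S_{(5)}`. -/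
def subgroupS5 (F : Type*) [Field F] : Subgroup (AGL 4 F) :=
  paramSubgroup (fun x => !![0, x 0, x 1, x 2, x 3;
                             0,   0, x 0, x 1, x 2;
                             0,   0,   0, x 0, x 1;
                             0,   0,   0,   0, x 0;
                             0,   0,   0,   0,   0])
    { row := fun x => by funext j; fin_cases j <;> rfl
      add := fun x y => by ext i j; fin_cases i <;> fin_cases j <;> simp
      mul := fun x y => ⟨![0, x 0 * y 0, x 0 * y 1 + x 1 * y 0,
          x 0 * y 2 + x 1 * y 1 + x 2 * y 0], by
        ext i j; fin_cases i <;> fin_cases j <;> simp [Matrix.mul_apply, Fin.sum_univ_succ] <;> ring⟩ }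

/-- `S_{(4,1)}`. -/
def subgroupS41 (F : Type*) [Field F] : Subgroup (AGL 4 F) :=
  paramSubgroup (fun x => !![0, x 0, x 1, x 2, x 3;
                             0,   0, x 0, x 1,   0;
                             0,   0,   0, x 0,   0;
                             0,   0,   0,   0,   0;
                             0,   0,   0,   0,   0])
    { row := fun x => by funext j; fin_cases j <;> rfl
      add := fun x y => by ext i j; fin_cases i <;> fin_cases j <;> simp
      mul := fun x y => ⟨![0, x 0 * y 0, x 0 * y 1 + x 1 * y 0, 0], by
        ext i j; fin_cases i <;> fin_cases j <;> simp [Matrix.mul_apply, Fin.sum_univ_succ]⟩ }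

/-- `S_{(3,2)}^♯`. -/
def subgroupS32sharp (F : Type*) [Field F] : Subgroup (AGL 4 F) :=
  paramSubgroup (fun x => !![0, x 0, x 1, x 2, x 3;
                             0,   0, x 0,   0, x 1;
                             0,   0,   0,   0, x 0;
                             0,   0,   0,   0, x 2;
                             0,   0,   0,   0,   0])
    { row := fun x => by funext j; fin_cases j <;> rfl
      add := fun x y => by ext i j; fin_cases i <;> fin_cases j <;> simp
      mul := fun x y => ⟨![0, x 0 * y 0, 0, x 0 * y 1 + x 1 * y 0 + x 2 * y 2], by
        ext i j; fin_cases i <;> fin_cases j <;> simp [Matrix.mul_apply, Fin.sum_univ_succ] <;> ring⟩ }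

/-- `U_1(α, β)`. -/
def subgroupU1 (α β : F) : Subgroup (AGL 4 F) :=
  paramSubgroup (fun x => !![0, x 0, x 1,       x 2,           x 3;
                             0,   0,   0,       x 0,           x 1;
                             0,   0,   0,   β * x 1, x 0 + α * x 1;
                             0,   0,   0,         0,             0;
                             0,   0,   0,         0,             0])
    { row := fun x => by funext j; fin_cases j <;> rfl
      add := fun x y => by ext i j; fin_cases i <;> fin_cases j <;> simp <;> ring
      mul := fun x y => ⟨![0, 0, x 0 * y 0 + x 1 * (β * y 1),
          x 0 * y 1 + x 1 * (y 0 + α * y 1)], by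
        ext i j; fin_cases i <;> fin_cases j <;> simp [Matrix.mul_apply, Fin.sum_univ_succ]⟩ }

/-- `R_D`, for an arbitrary `D ∈ Mat_3(F)`: the entries of rows `1, 2, 3` in the last column
are those of `D Xᵀ` with `X = (x 0, x 1, x 2)`. -/
def subgroupR (D : Matrix (Fin 3) (Fin 3) F) : Subgroup (AGL 4 F) :=
  paramSubgroup (fun x => !![0, x 0, x 1, x 2,                                         x 3;
                             0,   0,   0,   0, D 0 0 * x 0 + D 0 1 * x 1 + D 0 2 * x 2;
                             0,   0,   0,   0, D 1 0 * x 0 + D 1 1 * x 1 + D 1 2 * x 2;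
                             0,   0,   0,   0, D 2 0 * x 0 + D 2 1 * x 1 + D 2 2 * x 2;
                             0,   0,   0,   0,                                           0])
    { row := fun x => by funext j; fin_cases j <;> rfl
      add := fun x y => by ext i j; fin_cases i <;> fin_cases j <;> simp <;> ring
      mul := fun x y => ⟨![0, 0, 0,
          x 0 * (D 0 0 * y 0 + D 0 1 * y 1 + D 0 2 * y 2)
            + x 1 * (D 1 0 * y 0 + D 1 1 * y 1 + D 1 2 * y 2)
            + x 2 * (D 2 0 * y 0 + D 2 1 * y 1 + D 2 2 * y 2)], by
        ext i j; fin_cases i <;> fin_cases j <;> simp [Matrix.mul_apply, Fin.sum_univ_succ] <;> ring⟩ }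

/-- Projective congruence: `P A Pᵀ = λ B` with `P` invertible and `λ ≠ 0`. -/
def ProjCongruent {n : ℕ} (A B : Matrix (Fin n) (Fin n) F) : Prop :=
  ∃ (P : GL (Fin n) F) (c : F), c ≠ 0 ∧ P.val * A * P.valᵀ = c • B

/-- The family `D` is a complete and irredundant list of representatives of the projective
congruence classes of symmetric `n × n` matrices. -/
def IsSymmProjTransversal {ι : Type*} {n : ℕ} (D : ι → Matrix (Fin n) (Fin n) F) : Prop :=
  (∀ i, (D i).IsSymm) ∧
    ∀ A : Matrix (Fin n) (Fin n) F, A.IsSymm → ∃! i, ProjCongruent A (D i)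

/-- The list `0, E₁₁, E₁₁ + E₂₂, E₁₁ + ξ E₂₂, I₃`. -/
def piSOdd (ξ : F) : Fin 5 → Matrix (Fin 3) (Fin 3) F :=
  ![!![0, 0, 0; 0, 0, 0; 0, 0, 0],
    !![1, 0, 0; 0, 0, 0; 0, 0, 0],
    !![1, 0, 0; 0, 1, 0; 0, 0, 0],
    !![1, 0, 0; 0, ξ, 0; 0, 0, 0],
    !![1, 0, 0; 0, 1, 0; 0, 0, 1]]

/-- The list `0, E₁₁, E₁₁ + E₂₂, E₂₃ + E₃₂, I₃`. -/
def piSEven (F : Type*) [Field F] : Fin 5 → Matrix (Fin 3) (Fin 3) F :=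
  ![!![0, 0, 0; 0, 0, 0; 0, 0, 0],
    !![1, 0, 0; 0, 0, 0; 0, 0, 0],
    !![1, 0, 0; 0, 1, 0; 0, 0, 0],
    !![0, 0, 0; 0, 0, 1; 0, 1, 0],
    !![1, 0, 0; 0, 1, 0; 0, 0, 1]]

/-- The representatives in odd characteristic: six subgroups, followed by the five subgroups
`R_D` with `D` in the list `piSOdd ξ`. -/
def repsOdd (ξ : F) : Fin 11 → Subgroup (AGL 4 F) :=
  Fin.append (m := 6) (n := 5)
    ![subgroupS5 F, subgroupS41 F, subgroupS32sharp F,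
      subgroupU1 0 0, subgroupU1 0 1, subgroupU1 0 ξ]
    (fun k => subgroupR (piSOdd ξ k))

/-- The representatives in characteristic two: six subgroups, followed by the five subgroups
`R_D` with `D` in the list `piSEven F`. -/
def repsEven (ξ : F) : Fin 11 → Subgroup (AGL 4 F) :=
  Fin.append (m := 6) (n := 5)
    ![subgroupS5 F, subgroupS41 F, subgroupS32sharp F,
      subgroupU1 0 0, subgroupU1 1 0, subgroupU1 1 ξ]
    (fun k => subgroupR (piSEven F k))

end Representatives

section NilpotentAlgebras

universe u

/-- `nilPow F A k` is the power `A^{k+1}` of a (not necessarily unital) associative algebra: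
the span of all products of `k + 1` elements of `A`. -/
def nilPow (F A : Type*) [Field F] [NonUnitalRing A] [Module F A] : ℕ → Submodule F A
  | 0 => ⊤
  | k + 1 => Submodule.span F {x | ∃ a ∈ nilPow F A k, ∃ b : A, x = a * b}

/-- A commutative nilpotent associative `F`-algebra of dimension `n`. -/
structure CommNilpotentAlgebra (n : ℕ) (F : Type u) [Field F] where
  carrier : Type u
  [ring : NonUnitalCommRing carrier]
  [module : Module F carrier]
  [smulAssoc : IsScalarTower F carrier carrier]
  [smulComm : SMulCommClass F carrier carrier]
  [finiteDimensional : FiniteDimensional F carrier]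
  finrank_eq : Module.finrank F carrier = n
  nilpotent : ∃ k, nilPow F carrier k = ⊥

attribute [instance] CommNilpotentAlgebra.ring CommNilpotentAlgebra.module
  CommNilpotentAlgebra.smulAssoc CommNilpotentAlgebra.smulComm
  CommNilpotentAlgebra.finiteDimensional

variable {F : Type u} [Field F] {n : ℕ}

/-- Isomorphism of algebras. -/
def AlgIsomorphic (A B : CommNilpotentAlgebra n F) : Prop :=
  ∃ f : A.carrier →ₙₐ[F] B.carrier, Function.Bijective f

/-- Isomorphism as an equivalence relation. -/
def commNilpotentSetoid (n : ℕ) (F : Type u) [Field F] : Setoid (CommNilpotentAlgebra n F) where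
  r := AlgIsomorphic
  iseqv :=
    { refl := fun A => ⟨NonUnitalAlgHom.id F A.carrier, Function.bijective_id⟩
      symm := by
        rintro A B ⟨f, hf⟩
        let e := Equiv.ofBijective f hf
        exact ⟨NonUnitalAlgHom.inverse f e.symm e.left_inv e.right_inv, e.symm.bijective⟩
      trans := by
        rintro A B C ⟨f, hf⟩ ⟨g, hg⟩
        exact ⟨g.comp f, hg.comp hf⟩ }

/-- The isomorphism classes of commutative nilpotent associative `F`-algebras of dimension `n`. -/
abbrev CommNilpotentClasses (n : ℕ) (F : Type u) [Field F] :=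
  Quotient (commNilpotentSetoid n F)

/-- The algebra `A` is isomorphic to the algebra of matrices `R - I = {r - I : r ∈ R}`. -/
def IsAlgebraOf (A : CommNilpotentAlgebra n F) (R : Subgroup (AGL n F)) : Prop :=
  ∃ f : A.carrier →ₙₐ[F] Matrix (Fin (n + 1)) (Fin (n + 1)) F,
    Function.Injective f ∧ Set.range f = {m | ∃ r ∈ R, m = AGL.toMat r - 1}

end NilpotentAlgebras

/-! ### The regular representation of a commutative algebra on its unitization. -/

section RegularRepresentation

variable {F : Type*} [Field F] {n : ℕ} {A : Type*} [NonUnitalCommRing A] [Module F A]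

/-! Abelian regular subgroups are commutative nilpotent algebras in coordinates. Given such an
algebra `A` with a linear coordinate system `e`, the group `1 + A` inside the unitization acts on it
by multiplication, and its matrices form an abelian regular subgroup; this relation is `Realizes`.
Conversely, let `R` be abelian regular. Matrices in its span commute with `R`, and as the first rows
of `R` are all vectors `(1, v)`, such a matrix is determined by its own first row. Hence `R - I` is
the linear subspace of the span cut out by the vanishing of the corner entry, and so an algebra.
Inverses in `R` make each of its elements quasi-regular, so it lies in the Jacobson radical of an
Artinian ring and is nilpotent. Changing coordinates conjugates the subgroup and conjugation induces
an isomorphism, whence `areConjSubgroups_iff`.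

It remains to classify algebras of dimension 4, by the dimension of `A²` (`algebra_cases`, valid
over any field). If it is 3, one element generates and the group is `S_{(5)}`. If it is 2 and `A³ ≠
0`, generators can be chosen with `x y = 0` and `y²` equal to `0` or `x³`, giving `S_{(4,1)}` and
`S_{(3,2)}^♯`. If it is 2 and `A³ = 0`, the three products of two generators satisfy one quadratic
relation, giving `U_1(α, β)`. If it is at most 1, the product is a symmetric bilinear form with
values in a line, giving `R_D`.

Finiteness of the field enters only in normalising the quadratic relation (double root, split,
irreducible) and the symmetric form. In odd characteristic this uses that squares have index two
among units and that nondegenerate binary forms represent 1; in characteristic two, that every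
element is a square and that the image of `t² + t` has index two.

Irredundance comes from `algebraType`, an isomorphism invariant with different values on the first
six groups and the value 6 on all `R_D`, and from `Realizes.projCongruent`, which recovers `D` from
the algebra up to projective congruence. Projective classes of `D` are separated by rank, a
discriminant modulo squares, and, in characteristic two, by being alternating. -/

/-- The matrix, acting on row vectors, of multiplication by `a` on the unitization of `A`, in the
coordinates given by `1` and `e`. -/
def regMat (e : A ≃ₗ[F] (Fin n → F)) (a : A) : Matrix (Fin (n + 1)) (Fin (n + 1)) F :=
  Matrix.of (Fin.cons (Fin.cons 0 (e a))
    (fun i => Fin.cons 0 (e (e.symm (Pi.single i 1) * a))))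

theorem regMat_zero_row (e : A ≃ₗ[F] (Fin n → F)) (a : A) :
    regMat e a 0 = Fin.cons 0 (e a) := rfl

theorem regMat_succ_row (e : A ≃ₗ[F] (Fin n → F)) (a : A) (i : Fin n) :
    regMat e a i.succ = Fin.cons 0 (e (e.symm (Pi.single i 1) * a)) := rfl

theorem regMat_injective (e : A ≃ₗ[F] (Fin n → F)) : Function.Injective (regMat e) := by
  intro a b h
  have h0 := congrFun h 0
  rw [regMat_zero_row, regMat_zero_row] at h0
  exact e.injective (Fin.cons_right_injective _ h0)

theorem regMat_col_zero (e : A ≃ₗ[F] (Fin n → F)) (a : A) (i : Fin (n + 1)) :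
    regMat e a i 0 = 0 := by
  refine Fin.cases ?_ (fun k => ?_) i <;> rfl

theorem regMat_add (e : A ≃ₗ[F] (Fin n → F)) (a b : A) :
    regMat e (a + b) = regMat e a + regMat e b := by
  ext i j
  refine Fin.cases ?_ (fun k => ?_) i <;> refine Fin.cases ?_ (fun l => ?_) j <;>
    simp [regMat, mul_add]

theorem regMat_smul [SMulCommClass F A A] (e : A ≃ₗ[F] (Fin n → F)) (c : F) (a : A) :
    regMat e (c • a) = c • regMat e a := by
  ext i j
  refine Fin.cases ?_ (fun k => ?_) i <;> refine Fin.cases ?_ (fun l => ?_) j <;>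
    simp [regMat, mul_smul_comm]

variable [IsScalarTower F A A]

/-- Expand `b` in the basis that `e` sends to the unit vectors. Multiplicativity of `regMat` and the
later intertwining relation both follow from this row by row. -/
theorem cons_vecMul_regMat (e : A ≃ₗ[F] (Fin n → F)) (a b : A) :
    (Fin.cons 0 (e b) : Fin (n + 1) → F) ᵥ* regMat e a = Fin.cons 0 (e (b * a)) := by
  have hb : b = ∑ i, e b i • e.symm (Pi.single i 1) := by
    apply e.injective
    ext j
    simp [Finset.sum_apply, Pi.single_apply]
  ext j
  rw [Matrix.vecMul, dotProduct, Fin.sum_univ_succ]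
  conv_rhs => rw [hb]
  refine Fin.cases ?_ (fun k => ?_) j
  · simp [regMat_col_zero]
  · simp [regMat_succ_row, Finset.sum_mul, smul_mul_assoc, Finset.sum_apply]

theorem regMat_mul (e : A ≃ₗ[F] (Fin n → F)) (a b : A) :
    regMat e (a * b) = regMat e a * regMat e b := by
  funext i
  rw [Matrix.mul_apply_eq_vecMul]
  refine Fin.cases ?_ (fun k => ?_) i
  · rw [regMat_zero_row, regMat_zero_row, cons_vecMul_regMat]
  · rw [regMat_succ_row, regMat_succ_row, cons_vecMul_regMat, mul_assoc]

/-- The regular representation as a homomorphism of algebras. -/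
def regHom [SMulCommClass F A A] (e : A ≃ₗ[F] (Fin n → F)) : A →ₙₐ[F] Matrix (Fin (n + 1)) (Fin (n + 1)) F where
  toFun := regMat e
  map_smul' := regMat_smul e
  map_zero' := by simpa using regMat_smul e 0 0
  map_add' := regMat_add e
  map_mul' := regMat_mul e

/-- `R` consists of the elements `1 + a` of the unitization of `A`, in the coordinates `e`. -/
def Realizes (e : A ≃ₗ[F] (Fin n → F)) (R : Subgroup (AGL n F)) : Prop :=
  ∀ g : AGL n F, g ∈ R ↔ ∃ a, AGL.toMat g = 1 + regMat e a

end RegularRepresentation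

/-! ### Elements of the affine group as matrices. -/

section AffineMatrices

variable {F : Type*} [Field F] {n : ℕ}

theorem AGL.toMat_injective : Function.Injective (AGL.toMat : AGL n F → _) :=
  fun _ _ h => Subtype.ext (Units.ext h)

theorem AGL.toMat_mul (g h : AGL n F) : AGL.toMat (g * h) = AGL.toMat g * AGL.toMat h := rfl

theorem AGL.toMat_one : AGL.toMat (1 : AGL n F) = 1 := rfl

theorem AGL.toMat_col_zero (g : AGL n F) (i : Fin (n + 1)) :
    AGL.toMat g i 0 = if i = 0 then 1 else 0 := (mem_AGL_iff g.1).1 g.2 i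

theorem AGL.exists_toMat_eq {M : Matrix (Fin (n + 1)) (Fin (n + 1)) F} (hM : IsUnit M)
    (h0 : ∀ i, M i 0 = if i = 0 then 1 else 0) : ∃ g : AGL n F, AGL.toMat g = M := by
  obtain ⟨u, rfl⟩ := hM
  exact ⟨⟨u, (mem_AGL_iff u).2 h0⟩, rfl⟩

theorem AGL.exists_toMat_eq_one_add {M : Matrix (Fin (n + 1)) (Fin (n + 1)) F}
    (hM : IsUnit (1 + M)) (h0 : ∀ i, M i 0 = 0) : ∃ g : AGL n F, AGL.toMat g = 1 + M :=
  AGL.exists_toMat_eq hM fun i => by rw [Matrix.add_apply, h0, add_zero, Matrix.one_apply]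

theorem AGL.toMat_zero_row (g : AGL n F) :
    AGL.toMat g 0 = Fin.cons 1 (fun j => AGL.toMat g 0 j.succ) := by
  funext j
  refine Fin.cases ?_ (fun k => rfl) j
  simpa using AGL.toMat_col_zero g 0

theorem one_add_zero_row {M : Matrix (Fin (n + 1)) (Fin (n + 1)) F} {x : Fin n → F}
    (h : M 0 = Fin.cons 0 x) : (1 + M) 0 = Fin.cons 1 x := by
  funext j
  rw [Matrix.add_apply, h]
  refine Fin.cases ?_ (fun k => ?_) j
  · simp
  · simp [(Fin.succ_ne_zero k).symm]

theorem IsRegularSubgroup.ext {R : Subgroup (AGL n F)} (hR : IsRegularSubgroup R) {r s : AGL n F}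
    (hr : r ∈ R) (hs : s ∈ R) (h : AGL.toMat r 0 = AGL.toMat s 0) : r = s :=
  (hR _).unique ⟨hr, AGL.toMat_zero_row r⟩ ⟨hs, h ▸ AGL.toMat_zero_row r⟩

theorem AreConjSubgroups.symm {R S : Subgroup (AGL n F)} (h : AreConjSubgroups R S) :
    AreConjSubgroups S R := by
  obtain ⟨g, rfl⟩ := h
  refine ⟨g⁻¹, ?_⟩
  rw [Subgroup.map_map]
  ext x
  simp [Subgroup.mem_map, mul_assoc]

end AffineMatrices

/-! ### Isomorphism of algebras versus conjugacy of subgroups. -/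

section Bridge

universe u

variable {F : Type u} [Field F] {n : ℕ}

/-- Any identification of `A` with `R - I` is a regular representation. By regularity the first row
is a linear bijection onto `Fⁿ`, and this serves as `e`. If the first row of `f b` is a unit vector,
the first row of `f (b * a)` is a row of `f a`, so all rows are determined by `e`. -/
theorem IsAlgebraOf.exists_realizes {A : CommNilpotentAlgebra n F} {R : Subgroup (AGL n F)}
    (h : IsAlgebraOf A R) (hR : IsRegularSubgroup R) :
    ∃ e : A.carrier ≃ₗ[F] (Fin n → F), Realizes e R := by
  obtain ⟨f, hf, hrange⟩ := h
  have hmem : ∀ a, ∃ r ∈ R, f a = AGL.toMat r - 1 := fun a => by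
    have : f a ∈ Set.range f := ⟨a, rfl⟩
    rwa [hrange] at this
  have hcol : ∀ a i, f a i 0 = 0 := fun a i => by
    obtain ⟨r, -, h⟩ := hmem a
    rw [h, Matrix.sub_apply, AGL.toMat_col_zero, Matrix.one_apply, sub_self]
  let ρ : A.carrier →ₗ[F] (Fin n → F) :=
    { toFun := fun a j => f a 0 j.succ
      map_add' := fun a b => by ext j; simp
      map_smul' := fun c a => by ext j; simp }
  have hrow : ∀ a, f a 0 = Fin.cons 0 (ρ a) := fun a => by
    funext j
    refine Fin.cases ?_ (fun k => rfl) j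
    simpa using hcol a 0
  have hbij : Function.Bijective ρ := by
    constructor
    · intro a b hab
      obtain ⟨r, hr, har⟩ := hmem a
      obtain ⟨s, hs, has⟩ := hmem b
      have : r = s := hR.ext hr hs (by
        rw [eq_sub_iff_add_eq'] at har has
        rw [← har, ← has, one_add_zero_row (hrow a), one_add_zero_row (hrow b), hab])
      exact hf (by rw [har, has, this])
    · intro v
      obtain ⟨r, ⟨hr, hv⟩, -⟩ := hR v
      have : AGL.toMat r - 1 ∈ Set.range f := by rw [hrange]; exact ⟨r, hr, rfl⟩
      obtain ⟨a, ha⟩ := this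
      refine ⟨a, funext fun j => ?_⟩
      change f a 0 j.succ = v j
      rw [ha, Matrix.sub_apply, hv]
      simp [(Fin.succ_ne_zero j).symm]
  let e := LinearEquiv.ofBijective ρ hbij
  have hfe : ∀ a, f a = regMat e a := by
    intro a
    funext i
    refine Fin.cases (hrow a) (fun k => ?_) i
    rw [regMat_succ_row]
    set b := e.symm (Pi.single k 1)
    have h1 : f (b * a) 0 = f a k.succ := by
      rw [map_mul, Matrix.mul_apply_eq_vecMul, hrow b]
      have : ρ b = Pi.single k 1 := e.apply_symm_apply _
      rw [this]
      funext j
      rw [Matrix.vecMul, dotProduct, Fin.sum_univ_succ]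
      simp [Pi.single_apply]
    rw [← h1, hrow]
    rfl
  refine ⟨e, fun g => ⟨fun hg => ?_, ?_⟩⟩
  · have : AGL.toMat g - 1 ∈ Set.range f := by rw [hrange]; exact ⟨g, hg, rfl⟩
    obtain ⟨a, ha⟩ := this
    exact ⟨a, by rw [← hfe, ha, add_sub_cancel]⟩
  · rintro ⟨a, ha⟩
    obtain ⟨r, hr, har⟩ := hmem a
    rw [← hfe, har, add_sub_cancel] at ha
    rwa [AGL.toMat_injective ha]

theorem regMat_isNilpotent (A : CommNilpotentAlgebra n F) (e : A.carrier ≃ₗ[F] (Fin n → F))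
    (a : A.carrier) : IsNilpotent (regMat e a) := by
  have key : ∀ k, ∃ c ∈ nilPow F A.carrier k, regMat e a ^ (k + 1) = regMat e c := by
    intro k
    induction k with
    | zero => exact ⟨a, Submodule.mem_top, by rw [zero_add, pow_one]⟩
    | succ k ih =>
      obtain ⟨c, hc, h⟩ := ih
      exact ⟨c * a, Submodule.subset_span ⟨c, hc, a, rfl⟩, by rw [pow_succ, h, regMat_mul]⟩
  obtain ⟨k, hk⟩ := A.nilpotent
  obtain ⟨c, hc, h⟩ := key k
  rw [hk, Submodule.mem_bot] at hc
  exact ⟨k + 1, by rw [h, hc]; exact map_zero (regHom e)⟩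

theorem exists_toMat_eq_regMat (A : CommNilpotentAlgebra n F)
    (e : A.carrier ≃ₗ[F] (Fin n → F)) (a : A.carrier) :
    ∃ g : AGL n F, AGL.toMat g = 1 + regMat e a :=
  AGL.exists_toMat_eq_one_add (regMat_isNilpotent A e a).isUnit_one_add (regMat_col_zero e a)

variable {A B : CommNilpotentAlgebra n F} {R S : Subgroup (AGL n F)}
  {e : A.carrier ≃ₗ[F] (Fin n → F)} {e' : B.carrier ≃ₗ[F] (Fin n → F)}

theorem Realizes.isAbelianRegular (h : Realizes e R) : IsAbelianRegular R := by
  refine ⟨fun v => ?_, fun r hr s hs => ?_⟩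
  · obtain ⟨g, hg⟩ := exists_toMat_eq_regMat A e (e.symm v)
    have hrow : AGL.toMat g 0 = Fin.cons 1 v := by
      rw [hg, one_add_zero_row (regMat_zero_row e _), e.apply_symm_apply]
    refine ⟨g, ⟨(h g).2 ⟨_, hg⟩, hrow⟩, ?_⟩
    rintro s ⟨hs, hv⟩
    obtain ⟨b, hb⟩ := (h s).1 hs
    rw [hb, one_add_zero_row (regMat_zero_row e _)] at hv
    apply AGL.toMat_injective
    rw [hb, hg, ← Fin.cons_right_injective _ hv, e.symm_apply_apply]
  · obtain ⟨a, ha⟩ := (h r).1 hr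
    obtain ⟨b, hb⟩ := (h s).1 hs
    apply AGL.toMat_injective
    have hab : regMat e a * regMat e b = regMat e b * regMat e a := by
      rw [← regMat_mul, ← regMat_mul, mul_comm]
    rw [AGL.toMat_mul, AGL.toMat_mul, ha, hb]
    simp only [mul_add, add_mul, mul_one, one_mul, hab]
    abel

theorem Realizes.isAlgebraOf (h : Realizes e R) : IsAlgebraOf A R := by
  refine ⟨regHom e, regMat_injective e, Set.ext fun m => ⟨?_, ?_⟩⟩
  · rintro ⟨a, rfl⟩
    obtain ⟨g, hg⟩ := exists_toMat_eq_regMat A e a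
    exact ⟨g, (h g).2 ⟨a, hg⟩, by rw [hg, add_sub_cancel_left]; rfl⟩
  · rintro ⟨r, hr, rfl⟩
    obtain ⟨a, ha⟩ := (h r).1 hr
    exact ⟨a, by rw [ha, add_sub_cancel_left]; rfl⟩

/-- Two coordinate systems on isomorphic algebras give conjugate subgroups. -/
theorem Realizes.areConj (hR : Realizes e R) (hS : Realizes e' S) (hAB : AlgIsomorphic A B) :
    AreConjSubgroups R S := by
  obtain ⟨φ, hφ⟩ := hAB
  let Φ : A.carrier ≃ₗ[F] B.carrier :=
    LinearEquiv.ofBijective { toFun := φ, map_add' := map_add φ, map_smul' := map_smul φ } hφ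
  have hΦ : ∀ a, Φ a = φ a := fun _ => rfl
  let G : (Fin n → F) ≃ₗ[F] (Fin n → F) := (e.symm.trans Φ).trans e'
  -- The block matrix `diag(1, T)`, with `T` acting on row vectors.
  let mk : ((Fin n → F) ≃ₗ[F] (Fin n → F)) → Matrix (Fin (n + 1)) (Fin (n + 1)) F := fun T =>
    Matrix.of (Fin.cons (Fin.cons 1 0) (fun i => Fin.cons 0 (T (Pi.single i 1))))
  have mk_vec : ∀ T c x, (Fin.cons c x : Fin (n + 1) → F) ᵥ* mk T = Fin.cons c (T x) := by
    intro T c x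
    have hx : x = ∑ i, x i • (Pi.single i 1 : Fin n → F) := by
      ext j
      simp [Finset.sum_apply, Pi.single_apply]
    ext j
    rw [Matrix.vecMul, dotProduct, Fin.sum_univ_succ]
    conv_rhs => rw [hx]
    refine Fin.cases ?_ (fun k => ?_) j
    · simp [mk]
    · simp [mk, Finset.sum_apply]
  have mk_mul : ∀ T : (Fin n → F) ≃ₗ[F] (Fin n → F), mk T * mk T.symm = 1 := by
    intro T
    funext i
    rw [Matrix.mul_apply_eq_vecMul]
    refine Fin.cases ?_ (fun k => ?_) i
    · change (Fin.cons 1 0 : Fin (n + 1) → F) ᵥ* _ = _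
      rw [mk_vec, map_zero]
      funext j
      refine Fin.cases ?_ (fun l => ?_) j
      · simp
      · simp [(Fin.succ_ne_zero l).symm]
    · change (Fin.cons 0 (T (Pi.single k 1)) : Fin (n + 1) → F) ᵥ* _ = _
      rw [mk_vec, T.symm_apply_apply]
      funext j
      refine Fin.cases ?_ (fun l => ?_) j
      · simp
      · simp [Matrix.one_apply, Pi.single_apply, eq_comm]
  have hcomm : ∀ a, regMat e a * mk G = mk G * regMat e' (φ a) := by
    intro a
    funext i
    rw [Matrix.mul_apply_eq_vecMul, Matrix.mul_apply_eq_vecMul]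
    refine Fin.cases ?_ (fun k => ?_) i
    · rw [regMat_zero_row, mk_vec]
      change _ = (Fin.cons 1 0 : Fin (n + 1) → F) ᵥ* _
      have : (Fin.cons 1 0 : Fin (n + 1) → F) = Pi.single 0 1 := by
        funext j
        refine Fin.cases ?_ (fun l => ?_) j <;> simp
      rw [this, Matrix.single_one_vecMul]
      change _ = regMat e' (φ a) 0
      rw [regMat_zero_row]
      simp [G, hΦ]
    · rw [regMat_succ_row, mk_vec]
      change _ = (Fin.cons 0 (G (Pi.single k 1)) : Fin (n + 1) → F) ᵥ* _
      have : G (Pi.single k 1) = e' (φ (e.symm (Pi.single k 1))) := rfl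
      rw [this, cons_vecMul_regMat, ← map_mul]
      simp [G, hΦ]
  obtain ⟨g, hg⟩ : ∃ g : AGL n F, AGL.toMat g = mk G := by
    refine AGL.exists_toMat_eq (IsUnit.of_mul_eq_one _ (mk_mul G)) fun i => ?_
    refine Fin.cases ?_ (fun k => ?_) i <;> simp [mk]
  -- The intertwining relation `hcomm` reads `r g = g s`, so it is `g⁻¹` that conjugates `r` to `s`.
  refine ⟨g⁻¹, Subgroup.ext fun s => ?_⟩
  rw [Subgroup.mem_map]
  constructor
  · rintro ⟨r, hr, rfl⟩
    obtain ⟨a, ha⟩ := (hR r).1 hr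
    refine (hS _).2 ⟨φ a, ?_⟩
    have h1 : r * g = g * ((MulAut.conj g⁻¹).toMonoidHom r) := by simp [mul_assoc]
    have h2 := congrArg AGL.toMat h1
    rw [AGL.toMat_mul, AGL.toMat_mul, ha, hg, add_mul, hcomm, one_mul] at h2
    have h3 := congrArg (AGL.toMat g⁻¹ * ·) h2
    have h4 : AGL.toMat g⁻¹ * mk G = 1 := by
      rw [← hg, ← AGL.toMat_mul, inv_mul_cancel, AGL.toMat_one]
    simp only [mul_add, ← mul_assoc, h4, one_mul] at h3
    exact h3.symm
  · intro hs
    obtain ⟨b, hb⟩ := (hS s).1 hs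
    obtain ⟨a, rfl⟩ := hφ.2 b
    refine ⟨g * s * g⁻¹, (hR _).2 ⟨a, ?_⟩, by simp [mul_assoc]⟩
    have h4 : mk G * AGL.toMat g⁻¹ = 1 := by
      rw [← hg, ← AGL.toMat_mul, mul_inv_cancel, AGL.toMat_one]
    rw [AGL.toMat_mul, AGL.toMat_mul, hg, hb, mul_add, ← hcomm, mul_one, add_mul, mul_assoc, h4,
      mul_one]

/-- Conjugation by `g` is an algebra automorphism of the matrices that carries `R - I` onto `S - I`;
the isomorphism is its transport through `f` and `f'`. -/
theorem IsAlgebraOf.algIsomorphic (hA : IsAlgebraOf A R) (hB : IsAlgebraOf B S)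
    (hRS : AreConjSubgroups R S) : AlgIsomorphic A B := by
  obtain ⟨f, hf, hfr⟩ := hA
  obtain ⟨f', hf', hfr'⟩ := hB
  obtain ⟨g, rfl⟩ := hRS
  have hinv : AGL.toMat g⁻¹ * AGL.toMat g = 1 := by
    rw [← AGL.toMat_mul, inv_mul_cancel, AGL.toMat_one]
  have hinv' : AGL.toMat g * AGL.toMat g⁻¹ = 1 := by
    rw [← AGL.toMat_mul, mul_inv_cancel, AGL.toMat_one]
  have hconj : ∀ r : AGL n F, AGL.toMat ((MulAut.conj g).toMonoidHom r) - 1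
      = AGL.toMat g * (AGL.toMat r - 1) * AGL.toMat g⁻¹ := by
    intro r
    rw [mul_sub, sub_mul, mul_one, hinv']
    rfl
  have hex : ∀ a, ∃ b, f' b = AGL.toMat g * f a * AGL.toMat g⁻¹ := by
    intro a
    have : f a ∈ Set.range f := ⟨a, rfl⟩
    rw [hfr] at this
    obtain ⟨r, hr, h⟩ := this
    have : AGL.toMat ((MulAut.conj g).toMonoidHom r) - 1 ∈ Set.range f' := by
      rw [hfr']
      exact ⟨_, Subgroup.mem_map_of_mem _ hr, rfl⟩
    obtain ⟨b, hb⟩ := this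
    exact ⟨b, by rw [hb, hconj, h]⟩
  choose φ hφ using hex
  refine ⟨{ toFun := φ
            map_smul' := fun c a => hf' ?_
            map_zero' := hf' ?_
            map_add' := fun a b => hf' ?_
            map_mul' := fun a b => hf' ?_ }, ?_, ?_⟩
  · rw [hφ, map_smul, MonoidHom.id_apply, map_smul, hφ]
    simp
  · rw [hφ, map_zero, map_zero]
    simp
  · rw [hφ, map_add, map_add, hφ, hφ]
    simp [mul_add, add_mul]
  · rw [hφ, map_mul, map_mul, hφ, hφ]
    calc _ = AGL.toMat g * f a * 1 * (f b * AGL.toMat g⁻¹) := by simp [mul_assoc]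
      _ = _ := by rw [← hinv]; simp [mul_assoc]
  · intro a b hab
    have h1 : φ a = φ b := hab
    have h2 := hφ a
    rw [h1, hφ] at h2
    have h3 := congrArg (fun m => AGL.toMat g⁻¹ * m * AGL.toMat g) h2
    simp only [mul_assoc, hinv, mul_one] at h3
    simp only [← mul_assoc, hinv, one_mul] at h3
    exact hf h3.symm
  · intro b
    have : f' b ∈ Set.range f' := ⟨b, rfl⟩
    rw [hfr'] at this
    obtain ⟨s, ⟨r, hr, rfl⟩, h⟩ := this
    have : AGL.toMat r - 1 ∈ Set.range f := by rw [hfr]; exact ⟨r, hr, rfl⟩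
    obtain ⟨a, ha⟩ := this
    exact ⟨a, hf' (by change f' (φ a) = _; rw [hφ, h, ha, hconj])⟩

end Bridge

/-! ### Quasi-regularity implies nilpotency. -/

section Nilpotency

variable {F A : Type*} [Field F] [NonUnitalCommRing A] [Module F A] [IsScalarTower F A A]
  [SMulCommClass F A A]

/-- A finite-dimensional commutative algebra in which all elements are quasi-regular is
nilpotent. -/
theorem exists_nilPow_eq_bot [FiniteDimensional F A] (h : ∀ a : A, ∃ b : A, a + b + a * b = 0) :
    ∃ k, nilPow F A k = ⊥ := by
  have : Module.Finite F (Unitization F A) := 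
    Module.Finite.equiv (Unitization.linearEquiv F F A).symm
  have : IsArtinianRing (Unitization F A) := IsArtinianRing.of_finite F _
  let J : Ideal (Unitization F A) := RingHom.ker (Unitization.fstHom F A)
  -- An element of the augmentation ideal has the form `inr a`; the inverse of `1 + inr a` is `1 +
  -- inr b` with `b` the quasi-inverse of `a`.
  have hJ : J ≤ (⊥ : Ideal (Unitization F A)).jacobson := by
    intro x hx
    rw [Ideal.mem_jacobson_bot]
    intro y
    obtain ⟨b, hb⟩ := h (x * y).snd
    have h0 : (x * y).fst = 0 := by
      have : x.fst = 0 := hx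
      rw [Unitization.fst_mul, this, zero_mul]
    refine IsUnit.of_mul_eq_one (1 + Unitization.inr b) ?_
    have hxy : x * y = Unitization.inr (x * y).snd := by
      ext <;> simp [h0]
    rw [hxy]
    have : (Unitization.inr ((x * y).snd + b + (x * y).snd * b) : Unitization F A) = 0 := by
      rw [hb, Unitization.inr_zero]
    rw [Unitization.inr_add, Unitization.inr_add, Unitization.inr_mul] at this
    linear_combination this
  -- The Jacobson radical of an Artinian ring is nilpotent, so a power of the augmentation ideal
  -- vanishes.
  obtain ⟨k, hk⟩ := IsArtinianRing.isNilpotent_jacobson_bot (R := Unitization F A)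
  have hmem : ∀ k, ∀ a ∈ nilPow F A k, (Unitization.inr a : Unitization F A) ∈ J ^ (k + 1) := by
    intro k
    induction k with
    | zero =>
      intro a _
      rw [zero_add, pow_one]
      exact Unitization.fst_inr F a
    | succ k ih =>
      intro a ha
      refine Submodule.span_induction ?_ ?_ ?_ ?_ ha
      · rintro _ ⟨c, hc, b, rfl⟩
        rw [Unitization.inr_mul, pow_succ]
        exact Ideal.mul_mem_mul (ih c hc) (Unitization.fst_inr F b)
      · rw [Unitization.inr_zero]
        exact zero_mem _
      · intro x y _ _ hx hy
        rw [Unitization.inr_add]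
        exact add_mem hx hy
      · intro c x _ hx
        rw [Unitization.inr_smul]
        have := Ideal.mul_mem_left (J ^ (k + 1 + 1)) (Unitization.inl c) hx
        rwa [Unitization.inl_mul_inr, Unitization.inr_smul] at this
  refine ⟨k, (Submodule.eq_bot_iff _).2 fun a ha => ?_⟩
  have h1 : (Unitization.inr a : Unitization F A) ∈
      (⊥ : Ideal (Unitization F A)).jacobson ^ k :=
    Ideal.pow_right_mono hJ k (Ideal.pow_le_pow_right (Nat.le_succ k) (hmem k a ha))
  rw [hk] at h1
  exact Unitization.inr_injective (R := F) (by simpa using h1)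

end Nilpotency

/-! ### The algebra of an abelian regular subgroup, and the correspondence. -/

section AlgebraOfSubgroup

universe u

variable {F : Type u} [Field F] {n : ℕ} {R : Subgroup (AGL n F)}

/-- An element of the span of an abelian regular subgroup is determined by its first row. -/
theorem IsAbelianRegular.eq_of_mem_span (hR : IsAbelianRegular R)
    {m m' : Matrix (Fin (n + 1)) (Fin (n + 1)) F}
    (hm : m ∈ Submodule.span F {x | ∃ r ∈ R, x = AGL.toMat r})
    (hm' : m' ∈ Submodule.span F {x | ∃ r ∈ R, x = AGL.toMat r}) (h : m 0 = m' 0) : m = m' := by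
  have hcomm : ∀ x ∈ Submodule.span F {x | ∃ r ∈ R, x = AGL.toMat r}, ∀ s ∈ R,
      x * AGL.toMat s = AGL.toMat s * x := by
    intro x hx s hs
    refine Submodule.span_induction ?_ ?_ ?_ ?_ hx
    · rintro _ ⟨r, hr, rfl⟩
      rw [← AGL.toMat_mul, hR.2 r hr s hs, AGL.toMat_mul]
    · simp
    · intro x y _ _ hx hy
      rw [add_mul, mul_add, hx, hy]
    · intro c x _ hx
      rw [smul_mul_assoc, hx, mul_smul_comm]
  have hd : m - m' ∈ Submodule.span F {x | ∃ r ∈ R, x = AGL.toMat r} := sub_mem hm hm'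
  rw [← sub_eq_zero]
  set d := m - m' with hddef
  have hd0 : d 0 = 0 := by
    funext j
    rw [hddef, Matrix.sub_apply, h, sub_self]
    rfl
  -- The first row of `s d = d s` is the first row of `d` times `s`, hence zero. Taking `s` with
  -- first row `(1, e_k)` then isolates each further row of `d`.
  have key : ∀ s ∈ R, AGL.toMat s 0 ᵥ* d = 0 := by
    intro s hs
    rw [← Matrix.mul_apply_eq_vecMul, ← hcomm d hd s hs, Matrix.mul_apply_eq_vecMul, hd0,
      Matrix.zero_vecMul]
  funext i
  refine Fin.cases hd0 (fun k => ?_) i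
  obtain ⟨s, ⟨hs, hsr⟩, -⟩ := hR.1 (Pi.single k 1)
  have h1 := key s hs
  rw [hsr] at h1
  funext j
  have h2 := congrFun h1 j
  rw [Matrix.vecMul, dotProduct, Fin.sum_univ_succ] at h2
  have h3 : d 0 j = 0 := congrFun hd0 j
  simpa [Pi.single_apply, h3] using h2

/-- Linearity of `R - I` is not visible from the group law; here it becomes a linear condition.
Given `m`, regularity supplies `r` such that `r - 1` has the first row of `m`, and equal first rows
within the span force equality. -/
theorem IsAbelianRegular.mem_sub_one_iff (hR : IsAbelianRegular R)
    {m : Matrix (Fin (n + 1)) (Fin (n + 1)) F} :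
    (∃ r ∈ R, m = AGL.toMat r - 1) ↔
      m ∈ Submodule.span F {x | ∃ r ∈ R, x = AGL.toMat r} ∧ m 0 0 = 0 := by
  have hone : (1 : Matrix (Fin (n + 1)) (Fin (n + 1)) F) ∈
      Submodule.span F {x | ∃ r ∈ R, x = AGL.toMat r} :=
    Submodule.subset_span ⟨1, one_mem R, rfl⟩
  constructor
  · rintro ⟨r, hr, rfl⟩
    refine ⟨sub_mem (Submodule.subset_span ⟨r, hr, rfl⟩) hone, ?_⟩
    rw [Matrix.sub_apply, AGL.toMat_col_zero]
    simp
  · rintro ⟨hm, h0⟩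
    obtain ⟨r, ⟨hr, hrow⟩, -⟩ := hR.1 (fun j => m 0 j.succ)
    refine ⟨r, hr, hR.eq_of_mem_span hm
      (sub_mem (Submodule.subset_span ⟨r, hr, rfl⟩) hone) ?_⟩
    funext j
    rw [Matrix.sub_apply, hrow]
    refine Fin.cases ?_ (fun k => ?_) j
    · simp [h0]
    · simp [(Fin.succ_ne_zero k).symm]

theorem IsAbelianRegular.mul_mem_span {m m' : Matrix (Fin (n + 1)) (Fin (n + 1)) F}
    (hm : m ∈ Submodule.span F {x | ∃ r ∈ R, x = AGL.toMat r})
    (hm' : m' ∈ Submodule.span F {x | ∃ r ∈ R, x = AGL.toMat r}) :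
    m * m' ∈ Submodule.span F {x | ∃ r ∈ R, x = AGL.toMat r} := by
  have h := Submodule.mul_mem_mul hm hm'
  rw [Submodule.span_mul_span] at h
  refine Submodule.span_mono ?_ h
  rintro _ ⟨_, ⟨r, hr, rfl⟩, _, ⟨s, hs, rfl⟩, rfl⟩
  exact ⟨r * s, mul_mem hr hs, rfl⟩

/-- The algebra `R - I` of an abelian regular subgroup `R`. -/
def IsAbelianRegular.subalgebra (hR : IsAbelianRegular R) :
    NonUnitalSubalgebra F (Matrix (Fin (n + 1)) (Fin (n + 1)) F) where
  carrier := {m | ∃ r ∈ R, m = AGL.toMat r - 1}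
  zero_mem' := ⟨1, one_mem R, by rw [AGL.toMat_one, sub_self]⟩
  add_mem' := by
    intro a b ha hb
    rw [Set.mem_ofPred_eq, hR.mem_sub_one_iff] at *
    exact ⟨add_mem ha.1 hb.1, by rw [Matrix.add_apply, ha.2, hb.2, add_zero]⟩
  smul_mem' := by
    intro c a ha
    rw [Set.mem_ofPred_eq, hR.mem_sub_one_iff] at *
    exact ⟨Submodule.smul_mem _ c ha.1, by rw [Matrix.smul_apply, ha.2, smul_zero]⟩
  mul_mem' := by
    intro a b ha hb
    have hcol : ∀ i, b i 0 = 0 := by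
      obtain ⟨s, -, rfl⟩ := hb
      intro i
      rw [Matrix.sub_apply, AGL.toMat_col_zero, Matrix.one_apply, sub_self]
    rw [Set.mem_ofPred_eq, hR.mem_sub_one_iff] at *
    refine ⟨IsAbelianRegular.mul_mem_span ha.1 hb.1, ?_⟩
    rw [Matrix.mul_apply]
    exact Finset.sum_eq_zero fun k _ => by rw [hcol, mul_zero]

theorem IsAbelianRegular.exists_isAlgebraOf (hR : IsAbelianRegular R) :
    ∃ A : CommNilpotentAlgebra n F, IsAlgebraOf A R := by
  let _ : NonUnitalCommRing hR.subalgebra :=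
    { (inferInstance : NonUnitalRing hR.subalgebra) with
      mul_comm := by
        rintro ⟨_, r, hr, rfl⟩ ⟨_, s, hs, rfl⟩
        apply Subtype.ext
        change (AGL.toMat r - 1) * (AGL.toMat s - 1) = (AGL.toMat s - 1) * (AGL.toMat r - 1)
        have hrs : AGL.toMat r * AGL.toMat s = AGL.toMat s * AGL.toMat r := by
          rw [← AGL.toMat_mul, hR.2 r hr s hs, AGL.toMat_mul]
        simp only [sub_mul, mul_sub, mul_one, one_mul, hrs]
        abel }
  let ρ : hR.subalgebra →ₗ[F] (Fin n → F) :=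
    { toFun := fun a j => a.1 0 j.succ
      map_add' := fun a b => by ext j; rfl
      map_smul' := fun c a => by ext j; rfl }
  have hρ : Function.Bijective ρ := by
    constructor
    · rintro ⟨a, ha⟩ ⟨b, hb⟩ hab
      have ha' := hR.mem_sub_one_iff.1 ha
      have hb' := hR.mem_sub_one_iff.1 hb
      refine Subtype.ext (hR.eq_of_mem_span ha'.1 hb'.1 (funext fun j => ?_))
      refine Fin.cases ?_ (fun k => congrFun hab k) j
      exact ha'.2.trans hb'.2.symm
    · intro v
      obtain ⟨r, ⟨hr, hrow⟩, -⟩ := hR.1 v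
      refine ⟨⟨AGL.toMat r - 1, r, hr, rfl⟩, funext fun j => ?_⟩
      change (AGL.toMat r - 1) 0 j.succ = v j
      rw [Matrix.sub_apply, hrow]
      simp [(Fin.succ_ne_zero j).symm]
  let e := LinearEquiv.ofBijective ρ hρ
  have : FiniteDimensional F hR.subalgebra := e.symm.finiteDimensional
  refine ⟨{ carrier := hR.subalgebra
            finrank_eq := by rw [e.finrank_eq, Module.finrank_fin_fun]
            nilpotent := exists_nilPow_eq_bot ?_ }, ?_⟩
  -- The quasi-inverse of `r - 1` is `r⁻¹ - 1`.
  · rintro ⟨_, r, hr, rfl⟩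
    refine ⟨⟨AGL.toMat r⁻¹ - 1, r⁻¹, inv_mem hr, rfl⟩, Subtype.ext ?_⟩
    change (AGL.toMat r - 1) + (AGL.toMat r⁻¹ - 1) + (AGL.toMat r - 1) * (AGL.toMat r⁻¹ - 1) = 0
    have : AGL.toMat r * AGL.toMat r⁻¹ = 1 := by
      rw [← AGL.toMat_mul, mul_inv_cancel, AGL.toMat_one]
    rw [sub_mul, mul_sub, this]
    simp only [mul_one, one_mul]
    abel
  · refine ⟨NonUnitalSubalgebraClass.subtype hR.subalgebra, Subtype.val_injective, ?_⟩
    exact Subtype.range_val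

/-- The subgroup `1 + A` of the unitization of `A`, in the coordinates `e`. -/
theorem exists_realizes (A : CommNilpotentAlgebra n F) (e : A.carrier ≃ₗ[F] (Fin n → F)) :
    ∃ R : Subgroup (AGL n F), Realizes e R := by
  have h : IsSubgroupParam fun x => regMat e (e.symm x) :=
    { row := fun x => by rw [regMat_zero_row, e.apply_symm_apply]
      add := fun x y => by rw [map_add, regMat_add]
      mul := fun x y => ⟨e (e.symm x * e.symm y), by rw [← regMat_mul, e.symm_apply_apply]⟩ }
  refine ⟨paramSubgroup _ h, fun g => ⟨?_, ?_⟩⟩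
  · rintro ⟨x, hx⟩
    exact ⟨_, hx⟩
  · rintro ⟨a, ha⟩
    exact ⟨e a, by simpa using ha⟩

theorem exists_isAbelianRegular_isAlgebraOf (A : CommNilpotentAlgebra n F) :
    ∃ R : Subgroup (AGL n F), IsAbelianRegular R ∧ IsAlgebraOf A R := by
  let e : A.carrier ≃ₗ[F] (Fin n → F) :=
    (Module.finBasisOfFinrankEq F A.carrier A.finrank_eq).equivFun
  obtain ⟨R, hR⟩ := exists_realizes A e
  exact ⟨R, hR.isAbelianRegular, hR.isAlgebraOf⟩

theorem areConjSubgroups_iff {R S : Subgroup (AGL n F)} {A B : CommNilpotentAlgebra n F}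
    (hR : IsAbelianRegular R) (hS : IsAbelianRegular S) (hA : IsAlgebraOf A R)
    (hB : IsAlgebraOf B S) : AreConjSubgroups R S ↔ AlgIsomorphic A B := by
  refine ⟨hA.algIsomorphic hB, fun h => ?_⟩
  obtain ⟨e, he⟩ := hA.exists_realizes hR.1
  obtain ⟨e', he'⟩ := hB.exists_realizes hS.1
  exact he.areConj he' h

theorem AlgIsomorphic.isAlgebraOf {A B : CommNilpotentAlgebra n F} (h : AlgIsomorphic A B)
    (hB : IsAlgebraOf B R) : IsAlgebraOf A R := by
  obtain ⟨f, hf⟩ := h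
  obtain ⟨f', hf', hr⟩ := hB
  refine ⟨f'.comp f, hf'.comp hf.1, ?_⟩
  rw [← hr]
  exact hf.2.range_comp f'

end AlgebraOfSubgroup

/-! ### Subgroups given by a matrix parametrisation, and multiplication tables. -/

section Parametrized

universe u

variable {F : Type u} [Field F] {n : ℕ}
  {N : (Fin n → F) → Matrix (Fin (n + 1)) (Fin (n + 1)) F} {h : IsSubgroupParam N}

/-- Row `k + 1` of `N x` is the first row of `N (e_k) * N x`, which is the first row of some `N z`
and so begins with 0. -/
theorem IsSubgroupParam.col_zero (h : IsSubgroupParam N) (x : Fin n → F) (i : Fin (n + 1)) :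
    N x i 0 = 0 := by
  refine Fin.cases ?_ (fun k => ?_) i
  · rw [h.row]
    rfl
  · obtain ⟨z, hz⟩ := h.mul (Pi.single k 1) x
    have h1 := congrFun (congrFun hz 0) 0
    rw [Matrix.mul_apply, Fin.sum_univ_succ, h.row, h.row] at h1
    have h2 : N z 0 0 = 0 := by
      rw [h.row]
      rfl
    simpa [Pi.single_apply, h2] using h1

theorem IsSubgroupParam.isAbelianRegular (h : IsSubgroupParam N)
    (hunit : ∀ x, IsUnit (1 + N x)) (hcomm : ∀ x y, N x * N y = N y * N x) :
    IsAbelianRegular (paramSubgroup N h) := by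
  refine ⟨fun v => ?_, ?_⟩
  · obtain ⟨g, hg⟩ := AGL.exists_toMat_eq_one_add (hunit v) (h.col_zero v)
    refine ⟨g, ⟨⟨v, hg⟩, by rw [hg, one_add_zero_row (h.row v)]⟩, ?_⟩
    rintro s ⟨⟨x, hx⟩, hs⟩
    rw [hx, one_add_zero_row (h.row x)] at hs
    apply AGL.toMat_injective
    rw [hx, hg, Fin.cons_right_injective _ hs]
  · rintro a ⟨x, hx⟩ b ⟨y, hy⟩
    apply AGL.toMat_injective
    rw [AGL.toMat_mul, AGL.toMat_mul, hx, hy]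
    simp only [mul_add, add_mul, mul_one, one_mul, hcomm x y]
    abel

theorem isUnit_one_add_of_strictUpper {M : Matrix (Fin n) (Fin n) F}
    (hM : ∀ i j, j ≤ i → M i j = 0) : IsUnit (1 + M) := by
  rw [Matrix.isUnit_iff_isUnit_det, Matrix.det_of_isUpperTriangular]
  · simp [hM]
  · intro i j hij
    have : j < i := hij
    rw [Matrix.add_apply, hM i j this.le, Matrix.one_apply_ne this.ne', add_zero]

/-- The rows of `N x` below the first are the coordinates of `b i * x`. Thus recognising an algebra
reduces to checking a multiplication table; `Realizes.symm_mul_symm` reads the table back. -/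
theorem realizes_paramSubgroup (A : CommNilpotentAlgebra n F) (b : Module.Basis (Fin n) F A.carrier)
    (h : IsSubgroupParam N)
    (hb : ∀ x i, b i * ∑ j, x j • b j = ∑ j, N x i.succ j.succ • b j) :
    Realizes b.equivFun (paramSubgroup N h) := by
  have key : ∀ x, regMat b.equivFun (b.equivFun.symm x) = N x := by
    intro x
    funext i
    refine Fin.cases ?_ (fun k => ?_) i
    · rw [regMat_zero_row, h.row, LinearEquiv.apply_symm_apply]
    · rw [regMat_succ_row]
      have h1 : b.equivFun.symm (Pi.single k 1) = b k := by
        simp [Module.Basis.equivFun_symm_apply, Pi.single_apply]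
      rw [h1, Module.Basis.equivFun_symm_apply, hb, ← Module.Basis.equivFun_symm_apply b,
        LinearEquiv.apply_symm_apply]
      funext j
      refine Fin.cases ?_ (fun l => rfl) j
      rw [h.col_zero]
      rfl
  refine fun g => ⟨?_, ?_⟩
  · rintro ⟨x, hx⟩
    exact ⟨_, by rw [key, hx]⟩
  · rintro ⟨a, ha⟩
    exact ⟨b.equivFun a, by rw [ha, ← key, LinearEquiv.symm_apply_apply]⟩

theorem Realizes.symm_mul_symm {A : CommNilpotentAlgebra n F}
    {e : A.carrier ≃ₗ[F] (Fin n → F)} (he : Realizes e (paramSubgroup N h)) (x y : Fin n → F) :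
    e.symm x * e.symm y = e.symm fun j => ∑ i, x i * N y i.succ j.succ := by
  have key : ∀ a, regMat e a = N (e a) := by
    intro a
    obtain ⟨g, hg⟩ := exists_toMat_eq_regMat A e a
    obtain ⟨z, hz⟩ := (he g).2 ⟨a, hg⟩
    rw [hg, add_right_inj] at hz
    have h0 := congrFun hz 0
    rw [regMat_zero_row, h.row] at h0
    rw [hz, Fin.cons_right_injective _ h0]
  apply e.injective
  have h1 := cons_vecMul_regMat e (e.symm y) (e.symm x)
  rw [key, e.apply_symm_apply, e.apply_symm_apply] at h1
  funext j
  have h2 := congrFun h1 j.succ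
  rw [Matrix.vecMul, dotProduct, Fin.sum_univ_succ] at h2
  simp only [Fin.cons_zero, zero_mul, zero_add, Fin.cons_succ] at h2
  rw [← h2, e.apply_symm_apply]

end Parametrized

/-! ### The listed subgroups are abelian and regular. -/

section Regularity

variable {F : Type*} [Field F]

theorem subgroupS5_isAbelianRegular : IsAbelianRegular (subgroupS5 F) := by
  refine IsSubgroupParam.isAbelianRegular _ (fun x => isUnit_one_add_of_strictUpper ?_)
    fun x y => ?_
  · intro i j hij
    fin_cases i <;> fin_cases j <;> first | rfl | simp at hij
  · ext i j
    fin_cases i <;> fin_cases j <;> simp [Matrix.mul_apply, Fin.sum_univ_succ] <;> ring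

theorem subgroupS41_isAbelianRegular : IsAbelianRegular (subgroupS41 F) := by
  refine IsSubgroupParam.isAbelianRegular _ (fun x => isUnit_one_add_of_strictUpper ?_)
    fun x y => ?_
  · intro i j hij
    fin_cases i <;> fin_cases j <;> first | rfl | simp at hij
  · ext i j
    fin_cases i <;> fin_cases j <;> simp [Matrix.mul_apply, Fin.sum_univ_succ] <;> ring

theorem subgroupS32sharp_isAbelianRegular : IsAbelianRegular (subgroupS32sharp F) := by
  refine IsSubgroupParam.isAbelianRegular _ (fun x => isUnit_one_add_of_strictUpper ?_)
    fun x y => ?_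
  · intro i j hij
    fin_cases i <;> fin_cases j <;> first | rfl | simp at hij
  · ext i j
    fin_cases i <;> fin_cases j <;> simp [Matrix.mul_apply, Fin.sum_univ_succ] <;> ring

theorem subgroupU1_isAbelianRegular (α β : F) : IsAbelianRegular (subgroupU1 α β) := by
  refine IsSubgroupParam.isAbelianRegular _ (fun x => isUnit_one_add_of_strictUpper ?_)
    fun x y => ?_
  · intro i j hij
    fin_cases i <;> fin_cases j <;> first | rfl | simp at hij
  · ext i j
    fin_cases i <;> fin_cases j <;> simp [Matrix.mul_apply, Fin.sum_univ_succ] <;> ring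

theorem subgroupR_isAbelianRegular {D : Matrix (Fin 3) (Fin 3) F} (hD : D.IsSymm) :
    IsAbelianRegular (subgroupR D) := by
  refine IsSubgroupParam.isAbelianRegular _ (fun x => isUnit_one_add_of_strictUpper ?_)
    fun x y => ?_
  · intro i j hij
    fin_cases i <;> fin_cases j <;> first | rfl | simp at hij
  · have h1 := hD.apply 0 1
    have h2 := hD.apply 0 2
    have h3 := hD.apply 1 2
    ext i j
    fin_cases i <;> fin_cases j <;>
      simp [Matrix.mul_apply, Fin.sum_univ_succ, h1, h2, h3] <;> ring

end Regularity

/-! ### Isomorphism invariants of the algebras. -/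

section Invariants

variable (F A : Type*) [Field F] [NonUnitalCommRing A] [Module F A]

/-- `a` annihilates the algebra. -/
def Annihilates {A : Type*} [NonUnitalCommRing A] (a : A) : Prop := ∀ b, a * b = 0

/-- All products are multiples of one element. -/
def ProductsInLine : Prop := ∃ u : A, ∀ a b : A, ∃ c : F, a * b = c • u

/-- There are zero divisors outside the annihilator. -/
def HasProperZeroDivisors : Prop :=
  ∃ v w : A, ¬ Annihilates v ∧ ¬ Annihilates w ∧ v * w = 0

/-- There are elements of square zero outside the annihilator. -/
def HasProperSquareZero : Prop := ∃ v : A, ¬ Annihilates v ∧ v * v = 0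

open Classical in
/-- A numerical invariant which separates the types of four-dimensional commutative nilpotent
algebras with an at least two-dimensional square. -/
noncomputable def algebraType : ℕ :=
  if ∃ x : A, x * x * x * x ≠ 0 then 0
  else if ∃ x : A, x * x * x ≠ 0 then
    if ∀ a : A, Annihilates a → ∃ b c, a = b * c then 2 else 1
  else if ProductsInLine F A then 6
  else if HasProperSquareZero A then 3
  else if HasProperZeroDivisors A then 4
  else 5

end Invariants

/-! ### Values of the invariants on the representatives; recovering `D`. -/

section Uniqueness

universe u

variable {F : Type u} [Field F] {A : CommNilpotentAlgebra 4 F}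
  {e : A.carrier ≃ₗ[F] (Fin 4 → F)}

theorem Realizes.mul_S5 (he : Realizes e (subgroupS5 F)) (x y : Fin 4 → F) :
    e.symm x * e.symm y = e.symm ![0, x 0 * y 0, x 0 * y 1 + x 1 * y 0,
      x 0 * y 2 + x 1 * y 1 + x 2 * y 0] := by
  rw [Realizes.symm_mul_symm he]
  congr 1
  funext j
  fin_cases j <;> simp [Fin.sum_univ_succ] <;> ring

theorem Realizes.mul_S41 (he : Realizes e (subgroupS41 F)) (x y : Fin 4 → F) :
    e.symm x * e.symm y = e.symm ![0, x 0 * y 0, x 0 * y 1 + x 1 * y 0, 0] := by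
  rw [Realizes.symm_mul_symm he]
  congr 1
  funext j
  fin_cases j <;> simp [Fin.sum_univ_succ]

theorem Realizes.mul_S32sharp (he : Realizes e (subgroupS32sharp F)) (x y : Fin 4 → F) :
    e.symm x * e.symm y =
      e.symm ![0, x 0 * y 0, 0, x 0 * y 1 + x 1 * y 0 + x 2 * y 2] := by
  rw [Realizes.symm_mul_symm he]
  congr 1
  funext j
  fin_cases j <;> simp [Fin.sum_univ_succ] <;> ring

theorem Realizes.mul_U1 {α β : F} (he : Realizes e (subgroupU1 α β)) (x y : Fin 4 → F) :
    e.symm x * e.symm y = e.symm ![0, 0, x 0 * y 0 + β * (x 1 * y 1),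
      x 0 * y 1 + x 1 * y 0 + α * (x 1 * y 1)] := by
  rw [Realizes.symm_mul_symm he]
  congr 1
  funext j
  fin_cases j <;> simp [Fin.sum_univ_succ] <;> ring

theorem Realizes.mul_R {D : Matrix (Fin 3) (Fin 3) F} (he : Realizes e (subgroupR D))
    (x y : Fin 4 → F) :
    e.symm x * e.symm y = e.symm ![0, 0, 0, ∑ i, ∑ j, x i.castSucc * D i j * y j.castSucc] := by
  rw [Realizes.symm_mul_symm he]
  congr 1
  funext j
  fin_cases j <;> simp [Fin.sum_univ_succ] <;> ring

theorem LinearEquiv.symm_eq_zero_iff_apply (e : A.carrier ≃ₗ[F] (Fin 4 → F)) (x : Fin 4 → F) :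
    e.symm x = 0 ↔ ∀ i, x i = 0 := by
  rw [e.symm.map_eq_zero_iff, funext_iff]
  rfl

theorem Realizes.algebraType_S5 (he : Realizes e (subgroupS5 F)) :
    algebraType F A.carrier = 0 := by
  refine if_pos ⟨e.symm ![1, 0, 0, 0], ?_⟩
  simp [he.mul_S5]

theorem Realizes.algebraType_S41 (he : Realizes e (subgroupS41 F)) :
    algebraType F A.carrier = 1 := by
  rw [algebraType, if_neg, if_pos, if_neg]
  -- The last basis vector annihilates everything, but no product has a last coordinate.
  · intro h
    obtain ⟨b, c, hbc⟩ := h (e.symm ![0, 0, 0, 1]) fun b => by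
      obtain ⟨y, rfl⟩ := e.symm.surjective b
      rw [he.mul_S41, LinearEquiv.symm_eq_zero_iff_apply]
      simp [Fin.forall_fin_succ]
    obtain ⟨x, rfl⟩ := e.symm.surjective b
    obtain ⟨y, rfl⟩ := e.symm.surjective c
    rw [he.mul_S41] at hbc
    simpa using congrFun (e.symm.injective hbc) 3
  · exact ⟨e.symm ![1, 0, 0, 0], by simp [he.mul_S41]⟩
  · rintro ⟨a, ha⟩
    obtain ⟨x, rfl⟩ := e.symm.surjective a
    apply ha
    rw [he.mul_S41, he.mul_S41, he.mul_S41, LinearEquiv.symm_eq_zero_iff_apply]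
    simp [Fin.forall_fin_succ]

theorem Realizes.algebraType_S32sharp (he : Realizes e (subgroupS32sharp F)) :
    algebraType F A.carrier = 2 := by
  rw [algebraType, if_neg, if_pos, if_pos]
  · intro a ha
    obtain ⟨x, rfl⟩ := e.symm.surjective a
    have h1 := ha (e.symm ![1, 0, 0, 0])
    have h2 := ha (e.symm ![0, 0, 1, 0])
    rw [he.mul_S32sharp, LinearEquiv.symm_eq_zero_iff_apply] at h1 h2
    simp [Fin.forall_fin_succ] at h1 h2
    -- The annihilator is the last axis, and the last basis vector is the product of the first two.
    refine ⟨e.symm ![x 3, 0, 0, 0], e.symm ![0, 1, 0, 0], ?_⟩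
    rw [he.mul_S32sharp]
    congr 1
    funext j
    fin_cases j <;> simp [h1, h2]
  · exact ⟨e.symm ![1, 0, 0, 0], by simp [he.mul_S32sharp]⟩
  · rintro ⟨a, ha⟩
    obtain ⟨x, rfl⟩ := e.symm.surjective a
    apply ha
    rw [he.mul_S32sharp, he.mul_S32sharp, he.mul_S32sharp, LinearEquiv.symm_eq_zero_iff_apply]
    simp [Fin.forall_fin_succ]

theorem Realizes.algebraType_R {D : Matrix (Fin 3) (Fin 3) F} (he : Realizes e (subgroupR D)) :
    algebraType F A.carrier = 6 := by
  have h3 : ∀ a : A.carrier, a * a * a = 0 := by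
    intro a
    obtain ⟨x, rfl⟩ := e.symm.surjective a
    rw [he.mul_R, he.mul_R, LinearEquiv.symm_eq_zero_iff_apply]
    simp [Fin.forall_fin_succ, Fin.sum_univ_succ]
  rw [algebraType, if_neg, if_neg, if_pos]
  · refine ⟨e.symm ![0, 0, 0, 1], fun a b => ?_⟩
    obtain ⟨x, rfl⟩ := e.symm.surjective a
    obtain ⟨y, rfl⟩ := e.symm.surjective b
    refine ⟨∑ i, ∑ j, x i.castSucc * D i j * y j.castSucc, ?_⟩
    rw [he.mul_R, ← map_smul]
    simp
  · simp [h3]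
  · simp [h3]

theorem Realizes.annihilates_U1_iff {α β : F} (he : Realizes e (subgroupU1 α β))
    (x : Fin 4 → F) : Annihilates (e.symm x) ↔ x 0 = 0 ∧ x 1 = 0 := by
  constructor
  · intro h
    have h1 := h (e.symm ![1, 0, 0, 0])
    rw [he.mul_U1, LinearEquiv.symm_eq_zero_iff_apply] at h1
    simpa [Fin.forall_fin_succ] using h1
  · rintro ⟨h0, h1⟩ b
    obtain ⟨y, rfl⟩ := e.symm.surjective b
    rw [he.mul_U1, LinearEquiv.symm_eq_zero_iff_apply]
    simp [Fin.forall_fin_succ, h0, h1]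

theorem Realizes.algebraType_U1 {α β : F} (he : Realizes e (subgroupU1 α β)) :
    algebraType F A.carrier = open Classical in
      if HasProperSquareZero A.carrier then 3
      else if HasProperZeroDivisors A.carrier then 4
      else 5 := by
  have h3 : ∀ a : A.carrier, a * a * a = 0 := by
    intro a
    obtain ⟨x, rfl⟩ := e.symm.surjective a
    rw [he.mul_U1, he.mul_U1, LinearEquiv.symm_eq_zero_iff_apply]
    simp [Fin.forall_fin_succ]
  rw [algebraType, if_neg, if_neg, if_neg]
  -- The square of the first basis vector and its product with the second are independent, so no
  -- line contains all products.
  · rintro ⟨u, hu⟩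
    obtain ⟨z, rfl⟩ := e.symm.surjective u
    obtain ⟨c, hc⟩ := hu (e.symm ![1, 0, 0, 0]) (e.symm ![1, 0, 0, 0])
    obtain ⟨d, hd⟩ := hu (e.symm ![1, 0, 0, 0]) (e.symm ![0, 1, 0, 0])
    rw [he.mul_U1, ← map_smul] at hc hd
    have hc2 := congrFun (e.symm.injective hc) 2
    have hc3 := congrFun (e.symm.injective hc) 3
    have hd2 := congrFun (e.symm.injective hd) 2
    have hd3 := congrFun (e.symm.injective hd) 3
    simp at hc2 hc3 hd2 hd3
    rcases hc3 with h | h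
    · simp [h] at hc2
    · simp [h] at hd3
  · simp [h3]
  · simp [h3]

theorem Realizes.algebraType_U1_zero (he : Realizes e (subgroupU1 (0 : F) 0)) :
    algebraType F A.carrier = 3 := by
  rw [he.algebraType_U1, if_pos]
  refine ⟨e.symm ![0, 1, 0, 0], ?_, ?_⟩
  · rw [he.annihilates_U1_iff]
    simp
  · rw [he.mul_U1, LinearEquiv.symm_eq_zero_iff_apply]
    simp [Fin.forall_fin_succ]

/-- With `x, y` the first two basis vectors, `y² - α x y - β x²` factors as `(y - s x)(y - (α - s)
x)`. These factors are the zero divisors, and distinctness of the roots excludes elements of square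
zero. -/
theorem Realizes.algebraType_U1_of_split {α β s : F} (he : Realizes e (subgroupU1 α β))
    (hs : s * s = β + α * s) (hα : α ≠ 2 * s) : algebraType F A.carrier = 4 := by
  rw [he.algebraType_U1, if_neg, if_pos]
  · refine ⟨e.symm ![-s, 1, 0, 0], e.symm ![s - α, 1, 0, 0], ?_, ?_, ?_⟩
    · rw [he.annihilates_U1_iff]
      simp
    · rw [he.annihilates_U1_iff]
      simp
    · rw [he.mul_U1, LinearEquiv.symm_eq_zero_iff_apply]
      simp [Fin.forall_fin_succ]
      exact ⟨by linear_combination -hs, by ring⟩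
  · rintro ⟨v, hv, hvv⟩
    obtain ⟨x, rfl⟩ := e.symm.surjective v
    rw [he.annihilates_U1_iff] at hv
    rw [he.mul_U1, LinearEquiv.symm_eq_zero_iff_apply] at hvv
    simp [Fin.forall_fin_succ] at hvv
    obtain ⟨h1, h2⟩ := hvv
    -- Eliminating `x 0` leaves the discriminant `α² + 4β`, which equals `(α - 2s)²`. Nothing is
    -- divided by 2, so the argument covers every characteristic.
    have h3 : x 1 ^ 3 * (α - 2 * s) ^ 2 = 0 := by
      linear_combination 4 * x 1 ^ 3 * hs + 4 * x 1 * h1 + (α * x 1 - 2 * x 0) * h2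
    have h4 : x 1 = 0 := by
      rcases mul_eq_zero.1 h3 with h | h
      · exact pow_eq_zero_iff three_ne_zero |>.1 h
      · exact absurd (sub_eq_zero.1 (pow_eq_zero_iff two_ne_zero |>.1 h)) hα
    rw [h4] at h1
    exact hv ⟨by simpa using h1, h4⟩

theorem Realizes.algebraType_U1_of_irreducible {α β : F} (he : Realizes e (subgroupU1 α β))
    (hs : ∀ s, s * s ≠ β + α * s) : algebraType F A.carrier = 5 := by
  have key : ¬ HasProperZeroDivisors A.carrier := by
    rintro ⟨v, w, hv, hw, hvw⟩
    obtain ⟨x, rfl⟩ := e.symm.surjective v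
    obtain ⟨y, rfl⟩ := e.symm.surjective w
    rw [he.annihilates_U1_iff] at hv hw
    rw [he.mul_U1, LinearEquiv.symm_eq_zero_iff_apply] at hvw
    simp [Fin.forall_fin_succ] at hvw
    obtain ⟨h1, h2⟩ := hvw
    by_cases hx : x 1 = 0
    · have hx0 : x 0 ≠ 0 := fun h => hv ⟨h, hx⟩
      simp [hx, hx0] at h1 h2
      exact hw ⟨h1, h2⟩
    by_cases hy : y 1 = 0
    · have hy0 : y 0 ≠ 0 := fun h => hw ⟨h, hy⟩
      simp [hy, hy0] at h1 h2
      exact hv ⟨h1, h2⟩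
    -- Eliminating `y 0` from the two coordinates of the product turns a zero divisor into a root of
    -- the quadratic.
    · refine hs (-(x 0 / x 1)) ?_
      field_simp
      have : y 1 * (x 0 ^ 2 - (β * x 1 ^ 2 - α * x 0 * x 1)) = 0 := by
        linear_combination x 0 * h2 - x 1 * h1
      have := (mul_eq_zero.1 this).resolve_left hy
      linear_combination this
  rw [he.algebraType_U1, if_neg, if_neg key]
  rintro ⟨v, hv, hvv⟩
  exact key ⟨v, v, hv, hv, hvv⟩

/-- Isomorphic algebras of type `R_D` belong to projectively congruent matrices. -/
theorem Realizes.projCongruent {D D' : Matrix (Fin 3) (Fin 3) F}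
    {e' : A.carrier ≃ₗ[F] (Fin 4 → F)} (he : Realizes e (subgroupR D))
    (he' : Realizes e' (subgroupR D')) : ProjCongruent D D' := by
  let T : (Fin 4 → F) ≃ₗ[F] (Fin 4 → F) := e'.symm.trans e
  have hT : ∀ x y : Fin 4 → F,
      T ![0, 0, 0, ∑ i, ∑ j, x i.castSucc * D' i j * y j.castSucc] =
        ![0, 0, 0, ∑ i, ∑ j, T x i.castSucc * D i j * T y j.castSucc] := by
    intro x y
    apply e.symm.injective
    rw [← he.mul_R]
    simp only [T, LinearEquiv.trans_apply, LinearEquiv.symm_apply_apply]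
    rw [he'.mul_R]
  -- When all products vanish, `T` need not preserve the last axis, so this case is separate.
  -- Otherwise a nonzero entry of `D'` makes a multiple of the last basis vector a product, and `T`
  -- maps the last axis to itself.
  by_cases hD' : D' = 0
  · have hD : D = 0 := by
      ext i j
      have h := hT (T.symm (Pi.single i.castSucc 1)) (T.symm (Pi.single j.castSucc 1))
      rw [T.apply_symm_apply, T.apply_symm_apply] at h
      have h1 : (![0, 0, 0, 0] : Fin 4 → F) = 0 := by
        funext k
        fin_cases k <;> rfl
      simp only [hD', Matrix.zero_apply, mul_zero, zero_mul, Finset.sum_const_zero, h1,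
        map_zero] at h
      have h2 := congrFun h 3
      simpa [Pi.single_apply] using h2.symm
    refine ⟨1, 1, one_ne_zero, ?_⟩
    rw [hD, hD']
    simp
  obtain ⟨i₀, j₀, hij⟩ : ∃ i j, D' i j ≠ 0 := by
    by_contra! h
    exact hD' (Matrix.ext h)
  set c := T ![0, 0, 0, 1] 3 with hc
  have hlast : T ![0, 0, 0, 1] = ![0, 0, 0, c] := by
    have h := hT (Pi.single i₀.castSucc 1) (Pi.single j₀.castSucc 1)
    have h1 : ∑ i, ∑ j, (Pi.single i₀.castSucc 1 : Fin 4 → F) i.castSucc * D' i j *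
        (Pi.single j₀.castSucc 1 : Fin 4 → F) j.castSucc = D' i₀ j₀ := by
      simp [Pi.single_apply]
    have h2 : (![0, 0, 0, D' i₀ j₀] : Fin 4 → F) = D' i₀ j₀ • ![0, 0, 0, 1] := by simp
    rw [h1, h2, map_smul] at h
    funext k
    have h3 := congrFun h k
    rw [Pi.smul_apply, smul_eq_mul] at h3
    fin_cases k
    · simpa [hij] using h3
    · simpa [hij] using h3
    · simpa [hij] using h3
    · rfl
  have hT' : ∀ x y : Fin 4 → F, (∑ i, ∑ j, x i.castSucc * D' i j * y j.castSucc) * c =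
      ∑ i, ∑ j, T x i.castSucc * D i j * T y j.castSucc := by
    intro x y
    have h := congrFun (hT x y) 3
    have h2 : ∀ s : F, (![0, 0, 0, s] : Fin 4 → F) = s • ![0, 0, 0, 1] := fun s => by simp
    rw [h2, map_smul, Pi.smul_apply, ← hc] at h
    simpa using h
  have hc0 : c ≠ 0 := by
    intro h0
    have h1 : (![0, 0, 0, 1] : Fin 4 → F) = 0 := by
      apply T.injective
      rw [hlast, h0, map_zero]
      funext k
      fin_cases k <;> rfl
    simpa using congrFun h1 3
  let P : Matrix (Fin 3) (Fin 3) F :=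
    Matrix.of fun i j => T (Pi.single i.castSucc 1) j.castSucc
  have hP : P * D * Pᵀ = c • D' := by
    ext i j
    have h := hT' (Pi.single i.castSucc 1) (Pi.single j.castSucc 1)
    have h1 : ∑ i', ∑ j', (Pi.single i.castSucc 1 : Fin 4 → F) i'.castSucc * D' i' j' *
        (Pi.single j.castSucc 1 : Fin 4 → F) j'.castSucc = D' i j := by
      simp [Pi.single_apply]
    rw [h1] at h
    rw [Matrix.smul_apply, smul_eq_mul, mul_comm, h, Matrix.mul_apply]
    simp only [Matrix.mul_apply, Matrix.transpose_apply, Finset.sum_mul]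
    rw [Finset.sum_comm]
    rfl
  -- The corresponding block of `T⁻¹`. Since `T` preserves the last axis, the two blocks are inverse
  -- to each other.
  let Q : Matrix (Fin 3) (Fin 3) F :=
    Matrix.of fun i j => T.symm (Pi.single i.castSucc 1) j.castSucc
  have hQP : Q * P = 1 := by
    ext i j
    have hx : T.symm (Pi.single i.castSucc 1) =
        ∑ k : Fin 3, Q i k • (Pi.single k.castSucc 1 : Fin 4 → F) +
          T.symm (Pi.single i.castSucc 1) 3 • ![0, 0, 0, 1] := by
      funext k
      fin_cases k <;> simp [Q, Fin.sum_univ_succ]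
    have h := congrArg (fun v => T v j.castSucc) hx
    simp only [T.apply_symm_apply, map_add, map_sum, map_smul, hlast] at h
    have h0 : (![0, 0, 0, c] : Fin 4 → F) j.castSucc = 0 := by fin_cases j <;> rfl
    simp only [Pi.add_apply, Finset.sum_apply, Pi.smul_apply, h0, smul_eq_mul] at h
    rw [Matrix.mul_apply]
    change ∑ k, Q i k * T (Pi.single k.castSucc 1) j.castSucc = _
    rw [mul_zero, add_zero] at h
    rw [← h, Matrix.one_apply, Pi.single_apply]
    simp [eq_comm]
  exact ⟨⟨P, Q, mul_eq_one_comm.1 hQP, hQP⟩, c, hc0, hP⟩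

end Uniqueness

/-! ### Squares and the Artin–Schreier map in finite fields. -/

section FiniteFields

variable {F : Type*} [Field F] [Finite F]

theorem two_ne_zero_of_odd_card (h : Odd (Nat.card F)) : (2 : F) ≠ 0 := by
  have := Fintype.ofFinite F
  rw [Nat.card_eq_fintype_card] at h
  refine Ring.two_ne_zero fun h2 => ?_
  rw [FiniteField.even_card_iff_char_two] at h2
  rw [Nat.odd_iff] at h
  omega

theorem two_eq_zero_of_even_card (h : Even (Nat.card F)) : (2 : F) = 0 := by
  have := Fintype.ofFinite F
  rw [Nat.card_eq_fintype_card, Nat.even_iff, ← FiniteField.even_card_iff_char_two] at h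
  have := ringChar.Nat.cast_ringChar (R := F)
  rw [h] at this
  exact_mod_cast this

theorem exists_sq_eq_of_two_eq_zero (h2 : (2 : F) = 0) (a : F) : ∃ s, a = s * s := by
  have := Fintype.ofFinite F
  have hF : ringChar F = 2 := by
    by_contra h
    exact Ring.two_ne_zero h h2
  exact FiniteField.isSquare_of_char_two hF a

/-- The quadratic character is multiplicative, so the product of two nonsquares is a square. -/
theorem exists_eq_mul_sq_of_not_isSquare (h2 : (2 : F) ≠ 0) {ξ : F} (hξ : ¬ IsSquare ξ) {a : F}
    (ha : ¬ IsSquare a) : ∃ s, s ≠ 0 ∧ a = ξ * (s * s) := by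
  classical
  have := Fintype.ofFinite F
  have hF : ringChar F ≠ 2 := fun h => by
    have := ringChar.Nat.cast_ringChar (R := F)
    rw [h] at this
    exact h2 (by exact_mod_cast this)
  have hξ0 : ξ ≠ 0 := fun h => hξ (h ▸ IsSquare.zero)
  have ha0 : a ≠ 0 := fun h => ha (h ▸ IsSquare.zero)
  have h1 : quadraticChar F (a * ξ) = 1 := by
    rw [map_mul, quadraticChar_neg_one_iff_not_isSquare.2 hξ,
      quadraticChar_neg_one_iff_not_isSquare.2 ha]
    rfl
  obtain ⟨r, hr⟩ := (quadraticChar_one_iff_isSquare (mul_ne_zero ha0 hξ0)).1 h1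
  have hr0 : r ≠ 0 := by
    rintro rfl
    rw [mul_zero] at hr
    exact mul_ne_zero ha0 hξ0 hr
  refine ⟨r / ξ, div_ne_zero hr0 hξ0, ?_⟩
  field_simp
  linear_combination hr

theorem exists_not_isSquare (h2 : (2 : F) ≠ 0) : ∃ ξ : F, ¬ IsSquare ξ := by
  refine FiniteField.exists_nonsquare fun h => ?_
  have := ringChar.Nat.cast_ringChar (R := F)
  rw [h] at this
  exact h2 (by exact_mod_cast this)

/-- Nondegenerate binary forms represent 1; this splits off unit entries in
`projCongruent_rank_three`. -/
theorem exists_mul_sq_add_mul_sq_eq_one (h2 : (2 : F) ≠ 0) {a b : F} (ha : a ≠ 0) (hb : b ≠ 0) :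
    ∃ x y, a * x ^ 2 + b * y ^ 2 = 1 := by
  have := Fintype.ofFinite F
  have hF : Fintype.card F % 2 = 1 := by
    refine FiniteField.odd_card_of_char_ne_two fun h => ?_
    have := ringChar.Nat.cast_ringChar (R := F)
    rw [h] at this
    exact h2 (by exact_mod_cast this)
  have hg : (C b * X ^ 2 - C 1 : F[X]).degree = 2 := by
    rw [degree_sub_C, degree_C_mul_X_pow 2 hb]
    · rfl
    · rw [degree_C_mul_X_pow 2 hb]
      norm_num
  obtain ⟨x, y, h⟩ := FiniteField.exists_root_sum_quadratic
    (degree_C_mul_X_pow 2 ha) hg hF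
  refine ⟨x, y, ?_⟩
  simp only [eval_mul, eval_C, eval_pow, eval_X, eval_sub] at h
  linear_combination h

omit [Finite F] in
theorem irreducible_X_sq_sub_C_iff {ξ : F} :
    Irreducible (X ^ 2 - C ξ : F[X]) ↔ ¬ IsSquare ξ := by
  rw [X_pow_sub_C_irreducible_iff_of_prime Nat.prime_two]
  simp only [IsSquare, not_exists, pow_two]
  exact forall_congr' fun b => ⟨Ne.symm, Ne.symm⟩

omit [Finite F] in
theorem irreducible_X_sq_add_X_add_C_iff {ξ : F} :
    Irreducible (X ^ 2 + X + C ξ : F[X]) ↔ ∀ t, t * t + t + ξ ≠ 0 := by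
  have hmonic : (X ^ 2 + X + C ξ : F[X]).Monic := by monicity!
  have hdeg : (X ^ 2 + X + C ξ : F[X]).natDegree = 2 := by compute_degree!
  rw [hmonic.irreducible_iff_roots_eq_zero_of_degree_le_three hdeg.ge (by omega),
    Multiset.eq_zero_iff_forall_notMem]
  refine forall_congr' fun t => ?_
  rw [mem_roots hmonic.ne_zero, IsRoot.def]
  simp [pow_two]

/-- The Artin-Schreier map in characteristic two. -/
def artinSchreier (h2 : (2 : F) = 0) : F →+ F where
  toFun t := t * t + t
  map_zero' := by simp
  map_add' x y := by linear_combination x * y * h2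

/-- The kernel of `t² + t` is `{0, 1}`, and the index of the image equals the order of the kernel
because the field is finite. -/
theorem artinSchreier_index (h2 : (2 : F) = 0) : (artinSchreier h2).range.index = 2 := by
  have hker : Nat.card (artinSchreier h2).ker = 2 := by
    have : ((artinSchreier h2).ker : Set F) = {0, 1} := by
      ext t
      rw [SetLike.mem_coe, AddMonoidHom.mem_ker]
      change t * t + t = 0 ↔ t = 0 ∨ t = 1
      constructor
      · intro h
        have : t * (t - 1) = 0 := by linear_combination h - t * h2
        exact (mul_eq_zero.1 this).imp_right sub_eq_zero.1
      · rintro (rfl | rfl)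
        · simp
        · linear_combination h2
    change Nat.card ((artinSchreier h2).ker : Set F) = 2
    rw [this, Nat.card_coe_set_eq, Set.ncard_pair zero_ne_one]
  have h1 := AddSubgroup.card_mul_index (artinSchreier h2).ker
  rw [AddSubgroup.index_ker, hker] at h1
  have h3 := AddSubgroup.index_mul_card (artinSchreier h2).range
  rw [← h1] at h3
  exact Nat.eq_of_mul_eq_mul_right Nat.card_pos h3

theorem exists_artinSchreier_ne (h2 : (2 : F) = 0) : ∃ ξ : F, ∀ t, t * t + t + ξ ≠ 0 := by
  have h : (artinSchreier h2).range ≠ ⊤ := fun h => by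
    have := artinSchreier_index h2
    rw [h, AddSubgroup.index_top] at this
    omega
  obtain ⟨ξ, hξ⟩ := not_forall.1 (mt (AddSubgroup.eq_top_iff' _).2 h)
  refine ⟨ξ, fun t ht => hξ ⟨t, ?_⟩⟩
  change t * t + t = ξ
  linear_combination ht - ξ * h2

theorem artinSchreier_cases (h2 : (2 : F) = 0) {ξ : F} (hξ : ∀ t, t * t + t + ξ ≠ 0) (b : F) :
    (∃ t, b = t * t + t) ∨ ∃ t, b = ξ + (t * t + t) := by
  by_cases hb : b ∈ (artinSchreier h2).range
  · obtain ⟨t, rfl⟩ := hb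
    exact Or.inl ⟨t, rfl⟩
  · have hξ' : ξ ∉ (artinSchreier h2).range := by
      rintro ⟨t, ht⟩
      change t * t + t = ξ at ht
      exact hξ t (by linear_combination ht + ξ * h2)
    have : b + ξ ∈ (artinSchreier h2).range := by
      rw [AddSubgroup.add_mem_iff_of_index_two (artinSchreier_index h2)]
      exact iff_of_false hb hξ'
    obtain ⟨t, ht⟩ := this
    change t * t + t = b + ξ at ht
    exact Or.inr ⟨t, by linear_combination -ht - ξ * h2⟩

end FiniteFields

/-! ### Reduction of symmetric 3 × 3 matrices to normal form. -/

section SymmetricMatrices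

variable {F : Type*} [Field F]

theorem ProjCongruent.refl {n : ℕ} (A : Matrix (Fin n) (Fin n) F) : ProjCongruent A A :=
  ⟨1, 1, one_ne_zero, by simp⟩

theorem ProjCongruent.symm {n : ℕ} {A B : Matrix (Fin n) (Fin n) F} (h : ProjCongruent A B) :
    ProjCongruent B A := by
  obtain ⟨P, c, hc, h⟩ := h
  refine ⟨P⁻¹, c⁻¹, inv_ne_zero hc, ?_⟩
  have h1 : (P⁻¹).val * P.val = 1 := P.inv_mul
  have h2 : B = c⁻¹ • (P.val * A * P.valᵀ) := by
    rw [h, smul_smul, inv_mul_cancel₀ hc, one_smul]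
  have h3 : P.valᵀ * (P⁻¹).valᵀ = 1 := by
    rw [← Matrix.transpose_mul, h1, Matrix.transpose_one]
  rw [h2, mul_smul_comm, smul_mul_assoc]
  congr 1
  calc _ = ((P⁻¹).val * P.val) * A * (P.valᵀ * (P⁻¹).valᵀ) := by simp only [mul_assoc]
    _ = A := by rw [h1, h3, one_mul, mul_one]

theorem ProjCongruent.trans {n : ℕ} {A B C : Matrix (Fin n) (Fin n) F} (h : ProjCongruent A B)
    (h' : ProjCongruent B C) : ProjCongruent A C := by
  obtain ⟨P, c, hc, h⟩ := h
  obtain ⟨Q, d, hd, h'⟩ := h'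
  refine ⟨Q * P, c * d, mul_ne_zero hc hd, ?_⟩
  rw [Units.val_mul, Matrix.transpose_mul]
  calc _ = Q.val * (P.val * A * P.valᵀ) * Q.valᵀ := by simp only [mul_assoc]
    _ = _ := by rw [h, mul_smul_comm, smul_mul_assoc, h', smul_smul]

theorem ProjCongruent.of_det_ne_zero {n : ℕ} {A B : Matrix (Fin n) (Fin n) F}
    (P : Matrix (Fin n) (Fin n) F) (hP : P.det ≠ 0) {c : F} (hc : c ≠ 0)
    (h : P * A * Pᵀ = c • B) : ProjCongruent A B :=
  ⟨Matrix.GeneralLinearGroup.mkOfDetNeZero P hP, c, hc, h⟩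

theorem ProjCongruent.rank_eq {n : ℕ} {A B : Matrix (Fin n) (Fin n) F} (h : ProjCongruent A B) :
    A.rank = B.rank := by
  obtain ⟨P, c, hc, h⟩ := h
  have hP : IsUnit P.val.det := (Matrix.isUnit_iff_isUnit_det _).1 P.isUnit
  have h1 : (c • B).rank = B.rank := by
    have h2 : c • B = (c • (1 : Matrix (Fin n) (Fin n) F)) * B := by
      rw [Matrix.smul_mul, Matrix.one_mul]
    rw [h2]
    refine Matrix.rank_mul_eq_right_of_isUnit_det _ _ ?_
    rw [Matrix.det_smul, Matrix.det_one, mul_one]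
    exact (pow_ne_zero _ hc).isUnit
  rw [← h1, ← h, Matrix.rank_mul_eq_left_of_isUnit_det _ _ (by rwa [Matrix.det_transpose]),
    Matrix.rank_mul_eq_right_of_isUnit_det _ _ hP]

/-- Congruence by an explicit matrix of size three. -/
theorem ProjCongruent.of_entries {A B : Matrix (Fin 3) (Fin 3) F} (P : Matrix (Fin 3) (Fin 3) F)
    (c : F) (hc : c ≠ 0)
    (hP : P 0 0 * (P 1 1 * P 2 2 - P 1 2 * P 2 1) - P 0 1 * (P 1 0 * P 2 2 - P 1 2 * P 2 0)
      + P 0 2 * (P 1 0 * P 2 1 - P 1 1 * P 2 0) ≠ 0)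
    (h : ∀ i j, ∑ k, (∑ l, P i l * A l k) * P j k = c * B i j) : ProjCongruent A B := by
  refine .of_det_ne_zero P ?_ hc ?_
  · rw [Matrix.det_fin_three]
    convert hP using 1
    ring
  · ext i j
    rw [Matrix.mul_apply]
    simpa [Matrix.mul_apply] using h i j

/-- Symmetric Gaussian elimination: the remaining block is the Schur complement of `a`. -/
theorem projCongruent_of_pivot {a b c d e f : F} (ha : a ≠ 0) :
    ProjCongruent !![a, b, c; b, d, e; c, e, f]
      !![a, 0, 0; 0, d - b * b / a, e - b * c / a; 0, e - b * c / a, f - c * c / a] := by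
  refine .of_entries !![1, 0, 0; -(b / a), 1, 0; -(c / a), 0, 1] 1 one_ne_zero (by simp) ?_
  intro i j
  fin_cases i <;> fin_cases j <;> simp [Fin.sum_univ_succ] <;> field_simp <;> ring

theorem projCongruent_swap_first (a b c d e f : F) :
    ProjCongruent !![a, b, c; b, d, e; c, e, f] !![d, b, e; b, a, c; e, c, f] := by
  refine .of_entries !![0, 1, 0; 1, 0, 0; 0, 0, 1] 1 one_ne_zero (by simp) ?_
  intro i j
  fin_cases i <;> fin_cases j <;> simp [Fin.sum_univ_succ]

theorem projCongruent_swap_last (a b c d e f : F) :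
    ProjCongruent !![a, b, c; b, d, e; c, e, f] !![a, c, b; c, f, e; b, e, d] := by
  refine .of_entries !![1, 0, 0; 0, 0, 1; 0, 1, 0] 1 one_ne_zero (by simp) ?_
  intro i j
  fin_cases i <;> fin_cases j <;> simp [Fin.sum_univ_succ]

theorem exists_projCongruent_block {a b c d e f : F} (h : a ≠ 0 ∨ d ≠ 0 ∨ f ≠ 0) :
    ∃ a' d' e' f', a' ≠ 0 ∧ ProjCongruent !![a, b, c; b, d, e; c, e, f]
      !![a', 0, 0; 0, d', e'; 0, e', f'] := by
  rcases h with h | h | h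
  · exact ⟨_, _, _, _, h, projCongruent_of_pivot h⟩
  · exact ⟨_, _, _, _, h, (projCongruent_swap_first _ _ _ _ _ _).trans (projCongruent_of_pivot h)⟩
  · exact ⟨_, _, _, _, h, (projCongruent_swap_last _ _ _ _ _ _).trans
      ((projCongruent_swap_first _ _ _ _ _ _).trans (projCongruent_of_pivot h))⟩

theorem projCongruent_block_pivot {a d e f : F} (hd : d ≠ 0) :
    ProjCongruent !![a, 0, 0; 0, d, e; 0, e, f] !![a, 0, 0; 0, d, 0; 0, 0, f - e * e / d] := by
  refine .of_entries !![1, 0, 0; 0, 1, 0; 0, -(e / d), 1] 1 one_ne_zero (by simp) ?_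
  intro i j
  fin_cases i <;> fin_cases j <;> simp [Fin.sum_univ_succ] <;> field_simp <;> ring

/-- The hypothesis excludes only the block with zero diagonal and `e ≠ 0`. The implication in the
conclusion puts nonzero entries first, so that the rank can be read from the left. -/
theorem exists_projCongruent_diag_of_block {a d e f : F} (h : d ≠ 0 ∨ f ≠ 0 ∨ e = 0) :
    ∃ d' f', (f' ≠ 0 → d' ≠ 0) ∧ ProjCongruent !![a, 0, 0; 0, d, e; 0, e, f]
      !![a, 0, 0; 0, d', 0; 0, 0, f'] := by
  by_cases hd : d = 0
  · by_cases hf : f = 0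
    · have he : e = 0 := by tauto
      subst hd hf he
      exact ⟨0, 0, fun h => h, .refl _⟩
    · exact ⟨_, _, fun _ => hf, (projCongruent_swap_last _ _ _ _ _ _).trans
        (projCongruent_block_pivot hf)⟩
  · exact ⟨_, _, fun _ => hd, projCongruent_block_pivot hd⟩

theorem exists_projCongruent_diag_of_two_ne_zero (h2 : (2 : F) ≠ 0) {a b c d e f : F}
    (h : ¬ (a = 0 ∧ b = 0 ∧ c = 0 ∧ d = 0 ∧ e = 0 ∧ f = 0)) :
    ∃ a' d' f', a' ≠ 0 ∧ (f' ≠ 0 → d' ≠ 0) ∧ ProjCongruent !![a, b, c; b, d, e; c, e, f]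
      !![a', 0, 0; 0, d', 0; 0, 0, f'] := by
  have hblock : ∃ a' d' e' f', a' ≠ 0 ∧ ProjCongruent !![a, b, c; b, d, e; c, e, f]
      !![a', 0, 0; 0, d', e'; 0, e', f'] := by
    by_cases hdiag : a ≠ 0 ∨ d ≠ 0 ∨ f ≠ 0
    · exact exists_projCongruent_block hdiag
    push Not at hdiag
    obtain ⟨rfl, rfl, rfl⟩ := hdiag
    have key : ∀ b c e : F, b ≠ 0 → ∃ a' d' e' f', a' ≠ 0 ∧
        ProjCongruent !![0, b, c; b, 0, e; c, e, 0] !![a', 0, 0; 0, d', e'; 0, e', f'] := by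
      intro b c e hb
      -- Adding the second basis vector to the first creates the diagonal entry `2 b`, nonzero in
      -- odd characteristic.
      have h1 : ProjCongruent !![0, b, c; b, 0, e; c, e, 0]
          !![2 * b, b, c + e; b, 0, e; c + e, e, 0] := by
        refine .of_entries !![1, 1, 0; 0, 1, 0; 0, 0, 1] 1 one_ne_zero (by simp) ?_
        intro i j
        fin_cases i <;> fin_cases j <;> simp [Fin.sum_univ_succ] <;> ring
      obtain ⟨a', d', e', f', ha, h3⟩ :=
        exists_projCongruent_block (b := b) (c := c + e) (e := e) (d := 0) (f := 0)
          (Or.inl (mul_ne_zero h2 hb))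
      exact ⟨a', d', e', f', ha, h1.trans h3⟩
    by_cases hb : b = 0
    · by_cases hc : c = 0
      · have he : e ≠ 0 := by tauto
        subst hb hc
        obtain ⟨a', d', e', f', ha, h3⟩ := key e 0 0 he
        exact ⟨a', d', e', f', ha, (projCongruent_swap_first _ _ _ _ _ _).trans
          ((projCongruent_swap_last _ _ _ _ _ _).trans h3)⟩
      · obtain ⟨a', d', e', f', ha, h3⟩ := key c b e hc
        exact ⟨a', d', e', f', ha, (projCongruent_swap_last _ _ _ _ _ _).trans h3⟩
    · exact key b c e hb
  obtain ⟨a', d', e', f', ha, h1⟩ := hblock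
  suffices hs : ∃ d'' f'', (f'' ≠ 0 → d'' ≠ 0) ∧ ProjCongruent
      !![a', 0, 0; 0, d', e'; 0, e', f'] !![a', 0, 0; 0, d'', 0; 0, 0, f''] by
    obtain ⟨d'', f'', h3, h4⟩ := hs
    exact ⟨a', d'', f'', ha, h3, h1.trans h4⟩
  by_cases hd : d' ≠ 0 ∨ f' ≠ 0 ∨ e' = 0
  · exact exists_projCongruent_diag_of_block hd
  push Not at hd
  obtain ⟨rfl, rfl, he⟩ := hd
  have h3 : ProjCongruent !![a', 0, 0; 0, 0, e'; 0, e', 0]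
      !![a', 0, 0; 0, 2 * e', e'; 0, e', 0] := by
    refine .of_entries !![1, 0, 0; 0, 1, 1; 0, 0, 1] 1 one_ne_zero (by simp) ?_
    intro i j
    fin_cases i <;> fin_cases j <;> simp [Fin.sum_univ_succ] <;> ring
  obtain ⟨d'', f'', h4, h5⟩ := exists_projCongruent_diag_of_block (a := a') (d := 2 * e')
    (e := e') (f := 0) (Or.inl (mul_ne_zero h2 he))
  exact ⟨d'', f'', h4, h3.trans h5⟩

theorem projCongruent_diag_scale {a d f r s t : F} (c : F) (hc : c ≠ 0) (hr : r ≠ 0) (hs : s ≠ 0)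
    (ht : t ≠ 0) :
    ProjCongruent !![a, 0, 0; 0, d, 0; 0, 0, f]
      !![c * (r * r) * a, 0, 0; 0, c * (s * s) * d, 0; 0, 0, c * (t * t) * f] := by
  refine .of_entries !![r, 0, 0; 0, s, 0; 0, 0, t] c⁻¹ (inv_ne_zero hc) ?_ ?_
  · simp [hr, hs, ht]
  · intro i j
    fin_cases i <;> fin_cases j <;> simp [Fin.sum_univ_succ] <;> field_simp

theorem projCongruent_rank_one {a : F} (ha : a ≠ 0) :
    ProjCongruent !![a, 0, 0; 0, 0, 0; 0, 0, 0] !![1, 0, 0; 0, 0, 0; 0, 0, 0] := by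
  have h := projCongruent_diag_scale (a := a) (d := 0) (f := 0) a⁻¹ (inv_ne_zero ha)
    one_ne_zero one_ne_zero one_ne_zero
  simpa [ha] using h

theorem projCongruent_rank_two {a d ξ s : F} (ha : a ≠ 0) (hs : s ≠ 0)
    (h : d = a * (ξ * (s * s))) :
    ProjCongruent !![a, 0, 0; 0, d, 0; 0, 0, 0] !![1, 0, 0; 0, ξ, 0; 0, 0, 0] := by
  have h1 := projCongruent_diag_scale (a := a) (d := d) (f := 0) a⁻¹ (inv_ne_zero ha)
    one_ne_zero (inv_ne_zero hs) one_ne_zero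
  have h2 : a⁻¹ * (s⁻¹ * s⁻¹) * d = ξ := by
    rw [h]
    field_simp
  rw [h2] at h1
  simpa [ha] using h1

theorem projCongruent_rank_three [Finite F] (h2 : (2 : F) ≠ 0) {a d f : F} (ha : a ≠ 0)
    (hd : d ≠ 0) (hf : f ≠ 0) :
    ProjCongruent !![a, 0, 0; 0, d, 0; 0, 0, f] !![1, 0, 0; 0, 1, 0; 0, 0, 1] := by
  have key : ∀ a d f : F, a ≠ 0 → d ≠ 0 → f ≠ 0 → IsSquare (a * d * f) →
      ProjCongruent !![a, 0, 0; 0, d, 0; 0, 0, f] !![1, 0, 0; 0, 1, 0; 0, 0, 1] := by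
    rintro a d f ha hd hf ⟨s, hs⟩
    have hs0 : s ≠ 0 := by
      rintro rfl
      rw [mul_zero] at hs
      exact mul_ne_zero (mul_ne_zero ha hd) hf hs
    obtain ⟨x, y, hxy⟩ := exists_mul_sq_add_mul_sq_eq_one h2 ha hd
    -- A vector `(x, y)` of value 1 is completed by the orthogonal vector `(-d y, a x)`, whose value
    -- is `a d`; the change of basis has determinant 1.
    have h1 : ProjCongruent !![a, 0, 0; 0, d, 0; 0, 0, f] !![1, 0, 0; 0, a * d, 0; 0, 0, f] := by
      refine .of_entries !![x, y, 0; -(d * y), a * x, 0; 0, 0, 1] 1 one_ne_zero ?_ ?_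
      · simp
        refine ne_of_eq_of_ne ?_ one_ne_zero
        linear_combination hxy
      · intro i j
        fin_cases i <;> fin_cases j <;> simp [Fin.sum_univ_succ]
        · linear_combination hxy
        · ring
        · ring
        · linear_combination a * d * hxy
    obtain ⟨u, v, huv⟩ := exists_mul_sq_add_mul_sq_eq_one h2 (mul_ne_zero ha hd) hf
    have h3 : ProjCongruent !![1, 0, 0; 0, a * d, 0; 0, 0, f]
        !![1, 0, 0; 0, 1, 0; 0, 0, a * d * f] := by
      refine .of_entries !![1, 0, 0; 0, u, v; 0, -(f * v), a * d * u] 1 one_ne_zero ?_ ?_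
      · simp
        refine ne_of_eq_of_ne ?_ one_ne_zero
        linear_combination huv
      · intro i j
        fin_cases i <;> fin_cases j <;> simp [Fin.sum_univ_succ]
        · linear_combination huv
        · ring
        · ring
        · linear_combination a * d * f * huv
    have h4 := projCongruent_diag_scale (a := 1) (d := 1) (f := a * d * f) 1 one_ne_zero
      one_ne_zero one_ne_zero (inv_ne_zero hs0)
    have h5 : 1 * (s⁻¹ * s⁻¹) * (a * d * f) = 1 := by
      rw [hs]
      field_simp
    rw [h5, mul_one, mul_one, mul_one] at h4
    exact h1.trans (h3.trans h4)
  have h0 : a * d * f ≠ 0 := mul_ne_zero (mul_ne_zero ha hd) hf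
  -- Scaling a form of odd rank changes its discriminant class. With scalar `a d f` the determinant
  -- becomes its fourth power, a square.
  refine (projCongruent_diag_scale (a * d * f) h0 one_ne_zero one_ne_zero one_ne_zero).trans
    (key _ _ _ ?_ ?_ ?_ ⟨(a * d * f) ^ 2, by ring⟩)
  · simpa [ha, hd] using hf
  · simpa [ha, hd] using hf
  · simpa [ha, hd] using hf

omit [Field F] in
theorem Matrix.IsSymm.eq_entries {A : Matrix (Fin 3) (Fin 3) F} (hA : A.IsSymm) :
    A = !![A 0 0, A 0 1, A 0 2; A 0 1, A 1 1, A 1 2; A 0 2, A 1 2, A 2 2] := by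
  ext i j
  fin_cases i <;> fin_cases j <;> first | rfl | exact hA.apply _ _

theorem piSOdd_complete [Finite F] (h2 : (2 : F) ≠ 0) {ξ : F} (hξ : ¬ IsSquare ξ)
    {A : Matrix (Fin 3) (Fin 3) F} (hA : A.IsSymm) : ∃ i, ProjCongruent A (piSOdd ξ i) := by
  by_cases h : A 0 0 = 0 ∧ A 0 1 = 0 ∧ A 0 2 = 0 ∧ A 1 1 = 0 ∧ A 1 2 = 0 ∧ A 2 2 = 0
  · obtain ⟨h1, h2, h3, h4, h5, h6⟩ := h
    refine ⟨0, ?_⟩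
    rw [hA.eq_entries, h1, h2, h3, h4, h5, h6]
    exact .refl _
  obtain ⟨a, d, f, ha, hfd, h1⟩ := exists_projCongruent_diag_of_two_ne_zero h2 h
  rw [← hA.eq_entries] at h1
  by_cases hf : f = 0
  · subst hf
    by_cases hd : d = 0
    · subst hd
      exact ⟨1, h1.trans (projCongruent_rank_one ha)⟩
    by_cases hsq : IsSquare (d / a)
    · obtain ⟨s, hs⟩ := hsq
      have hs0 : s ≠ 0 := by
        rintro rfl
        rw [mul_zero] at hs
        exact div_ne_zero hd ha hs
      refine ⟨2, h1.trans (projCongruent_rank_two ha hs0 ?_)⟩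
      rw [← hs]
      field_simp
    · obtain ⟨s, hs0, hs⟩ := exists_eq_mul_sq_of_not_isSquare h2 hξ hsq
      refine ⟨3, h1.trans (projCongruent_rank_two ha hs0 ?_)⟩
      rw [← hs]
      field_simp
  · exact ⟨4, h1.trans (projCongruent_rank_three h2 ha (hfd hf) hf)⟩

theorem projCongruent_alternating (h2 : (2 : F) = 0) {b c e : F} (he : e ≠ 0) :
    ProjCongruent !![0, b, c; b, 0, e; c, e, 0] !![0, 0, 0; 0, 0, 1; 0, 1, 0] := by
  -- The first row spans the radical: in characteristic two the matrix is alternating, and of odd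
  -- size, hence degenerate.
  refine .of_entries !![1, -(c / e), -(b / e); 0, 1, 0; 0, 0, 1] e he (by simp) ?_
  intro i j
  fin_cases i <;> fin_cases j <;> simp [Fin.sum_univ_succ] <;> field_simp
  · linear_combination -b * c * h2
  all_goals ring

theorem projCongruent_one_of_char_two (h2 : (2 : F) = 0) {a e : F} (ha : a ≠ 0) (he : e ≠ 0) :
    ProjCongruent !![a, 0, 0; 0, 0, e; 0, e, 0] !![1, 0, 0; 0, 1, 0; 0, 0, 1] := by
  -- An alternating block beside a nonzero diagonal entry is no new class. Each row has value `a`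
  -- because cross terms double, and two distinct rows pair to `a + a = 0`.
  refine .of_entries !![1, 1, 0; 1, 0, a / e; 1, 1, a / e] a ha ?_ ?_
  · simp [ha, he]
  · intro i j
    fin_cases i <;> fin_cases j <;> simp [Fin.sum_univ_succ] <;> field_simp <;>
      first | linear_combination h2 | linear_combination a * h2

theorem piSEven_complete [Finite F] (h2 : (2 : F) = 0)
    {A : Matrix (Fin 3) (Fin 3) F} (hA : A.IsSymm) : ∃ i, ProjCongruent A (piSEven F i) := by
  obtain ⟨a, b, c, d, e, f, rfl⟩ : ∃ a b c d e f, A = !![a, b, c; b, d, e; c, e, f] :=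
    ⟨_, _, _, _, _, _, hA.eq_entries⟩
  by_cases hdiag : a ≠ 0 ∨ d ≠ 0 ∨ f ≠ 0
  · obtain ⟨a', d', e', f', ha, h1⟩ := exists_projCongruent_block (b := b) (c := c) (e := e) hdiag
    by_cases hd : d' ≠ 0 ∨ f' ≠ 0 ∨ e' = 0
    · obtain ⟨d, f, hfd, h3⟩ := exists_projCongruent_diag_of_block (a := a') hd
      have h4 := h1.trans h3
      by_cases hf : f = 0
      · subst hf
        by_cases hd : d = 0
        · subst hd
          exact ⟨1, h4.trans (projCongruent_rank_one ha)⟩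
        obtain ⟨s, hs⟩ := exists_sq_eq_of_two_eq_zero h2 (d / a')
        have hs0 : s ≠ 0 := by
          rintro rfl
          rw [mul_zero] at hs
          exact div_ne_zero hd ha hs
        refine ⟨2, h4.trans (projCongruent_rank_two ha hs0 ?_)⟩
        rw [← hs]
        field_simp
      · obtain ⟨r, hr⟩ := exists_sq_eq_of_two_eq_zero h2 a'
        obtain ⟨s, hs⟩ := exists_sq_eq_of_two_eq_zero h2 d
        obtain ⟨t, ht⟩ := exists_sq_eq_of_two_eq_zero h2 f
        have hr0 : r ≠ 0 := by rintro rfl; exact ha (by simpa using hr)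
        have hs0 : s ≠ 0 := by rintro rfl; exact hfd hf (by simpa using hs)
        have ht0 : t ≠ 0 := by rintro rfl; exact hf (by simpa using ht)
        have h5 := projCongruent_diag_scale (a := a') (d := d) (f := f) 1 one_ne_zero
          (inv_ne_zero hr0) (inv_ne_zero hs0) (inv_ne_zero ht0)
        have h6 : ∀ r a : F, r ≠ 0 → a = r * r → 1 * (r⁻¹ * r⁻¹) * a = 1 := by
          rintro r _ hr rfl
          field_simp
        rw [h6 r a' hr0 hr, h6 s d hs0 hs, h6 t f ht0 ht] at h5
        exact ⟨4, h4.trans h5⟩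
    · push Not at hd
      obtain ⟨rfl, rfl, he⟩ := hd
      exact ⟨4, h1.trans (projCongruent_one_of_char_two h2 ha he)⟩
  · push Not at hdiag
    obtain ⟨rfl, rfl, rfl⟩ := hdiag
    by_cases he : e = 0
    · by_cases hc : c = 0
      · by_cases hb : b = 0
        · subst he hc hb
          exact ⟨0, .refl _⟩
        · exact ⟨3, (projCongruent_swap_last _ _ _ _ _ _).trans
            ((projCongruent_swap_first _ _ _ _ _ _).trans (projCongruent_alternating h2 hb))⟩
      · exact ⟨3, (projCongruent_swap_first _ _ _ _ _ _).trans (projCongruent_alternating h2 hc)⟩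
    · exact ⟨3, projCongruent_alternating h2 he⟩

end SymmetricMatrices

/-! ### Inequivalence of the normal forms. -/

section SymmetricTransversals

variable {F : Type*} [Field F]

theorem rank_diag_three [DecidableEq F] (a d f : F) :
    (!![a, 0, 0; 0, d, 0; 0, 0, f] : Matrix (Fin 3) (Fin 3) F).rank =
      (if a = 0 then 0 else 1) + (if d = 0 then 0 else 1) +
        (if f = 0 then 0 else 1) := by
  have h : (!![a, 0, 0; 0, d, 0; 0, 0, f] : Matrix (Fin 3) (Fin 3) F) =
      Matrix.diagonal ![a, d, f] := by
    ext i j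
    fin_cases i <;> fin_cases j <;> rfl
  rw [h, Matrix.rank_diagonal, Fintype.card_subtype, Finset.card_filter]
  by_cases ha : a = 0 <;> by_cases hd : d = 0 <;> by_cases hf : f = 0 <;>
    simp [Fin.sum_univ_succ, ha, hd, hf]

theorem not_projCongruent_of_not_isSquare {ξ : F} (hξ : ¬ IsSquare ξ) :
    ¬ ProjCongruent !![1, 0, 0; 0, 1, 0; 0, 0, 0] !![1, 0, 0; 0, ξ, 0; 0, 0, 0] := by
  rintro ⟨P, c, hc, h⟩
  have h00 := congrFun (congrFun h 0) 0
  have h01 := congrFun (congrFun h 0) 1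
  have h11 := congrFun (congrFun h 1) 1
  simp [Matrix.mul_apply, Fin.sum_univ_succ] at h00 h01 h11
  -- Comparing Gram determinants of the leading blocks gives `(det)² = c² ξ`, with `det` the leading
  -- minor of `P`.
  refine hξ ⟨(P.val 0 0 * P.val 1 1 - P.val 0 1 * P.val 1 0) / c, ?_⟩
  field_simp
  set a := P.val 0 0
  set b := P.val 0 1
  set d := P.val 1 0
  set e := P.val 1 1
  linear_combination (-(d * d + e * e)) * h00 - c * h11 + (a * d + b * e) * h01

/-- In characteristic two alternating forms take only the value 0, a property preserved by
congruence. It separates `E₂₃ + E₃₂` from `E₁₁ + E₂₂`, which has the same rank. -/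
theorem ProjCongruent.diag_eq_zero (h2 : (2 : F) = 0) {B : Matrix (Fin 3) (Fin 3) F}
    (h : ProjCongruent !![0, 0, 0; 0, 0, 1; 0, 1, 0] B) (i : Fin 3) : B i i = 0 := by
  obtain ⟨P, c, hc, h⟩ := h
  have h1 := congrFun (congrFun h i) i
  simp [Matrix.mul_apply, Fin.sum_univ_succ] at h1
  have h3 : c * B i i = 0 := by
    linear_combination -h1 + P.val i 1 * P.val i 2 * h2
  exact (mul_eq_zero.1 h3).resolve_left hc

theorem piSOdd_isSymm (ξ : F) (i : Fin 5) : (piSOdd ξ i).IsSymm := by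
  ext j k
  fin_cases i <;> fin_cases j <;> fin_cases k <;> rfl

theorem piSEven_isSymm (i : Fin 5) : (piSEven F i).IsSymm := by
  ext j k
  fin_cases i <;> fin_cases j <;> fin_cases k <;> rfl

theorem piSOdd_rank {ξ : F} (hξ : ξ ≠ 0) (i : Fin 5) : (piSOdd ξ i).rank = ![0, 1, 2, 2, 3] i := by
  classical
  fin_cases i <;> exact (rank_diag_three _ _ _).trans (by simp [hξ])

theorem piSOdd_injective {ξ : F} (hξ : ¬ IsSquare ξ) {i j : Fin 5}
    (h : ProjCongruent (piSOdd ξ i) (piSOdd ξ j)) : i = j := by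
  have hξ0 : ξ ≠ 0 := fun h => hξ (h ▸ IsSquare.zero)
  have hr := h.rank_eq
  rw [piSOdd_rank hξ0, piSOdd_rank hξ0] at hr
  have key : ∀ i j : Fin 5,
      (![0, 1, 2, 2, 3] : Fin 5 → ℕ) i = (![0, 1, 2, 2, 3] : Fin 5 → ℕ) j →
        i = j ∨ (i = 2 ∧ j = 3) ∨ (i = 3 ∧ j = 2) := by
    decide
  rcases key i j hr with h1 | ⟨rfl, rfl⟩ | ⟨rfl, rfl⟩
  · exact h1
  · exact absurd h (not_projCongruent_of_not_isSquare hξ)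
  · exact absurd h.symm (not_projCongruent_of_not_isSquare hξ)

theorem piSEven_rank {i : Fin 5} (hi : i ≠ 3) : (piSEven F i).rank = ![0, 1, 2, 2, 3] i := by
  classical
  fin_cases i
  · exact (rank_diag_three _ _ _).trans (by simp)
  · exact (rank_diag_three _ _ _).trans (by simp)
  · exact (rank_diag_three _ _ _).trans (by simp)
  · exact absurd rfl hi
  · exact (rank_diag_three _ _ _).trans (by simp)

theorem not_projCongruent_piSEven_three (h2 : (2 : F) = 0) {i : Fin 5} (hi : i ≠ 3) :
    ¬ ProjCongruent (piSEven F 3) (piSEven F i) := by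
  intro h
  have h0 := ProjCongruent.diag_eq_zero h2 h 0
  fin_cases i
  · obtain ⟨P, c, hc, h⟩ := h.symm
    have h1 := congrFun (congrFun h 1) 2
    have h3 : (piSEven F 0) = 0 := by
      ext j k
      fin_cases j <;> fin_cases k <;> rfl
    change (P.val * piSEven F 0 * P.valᵀ) 1 2 = _ at h1
    rw [h3] at h1
    simp [piSEven] at h1
    exact hc h1.symm
  · exact one_ne_zero h0
  · exact one_ne_zero h0
  · exact hi rfl
  · exact one_ne_zero h0

theorem piSEven_injective (h2 : (2 : F) = 0) {i j : Fin 5}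
    (h : ProjCongruent (piSEven F i) (piSEven F j)) : i = j := by
  by_cases hi : i = 3
  · subst hi
    by_contra hj
    exact not_projCongruent_piSEven_three h2 (Ne.symm hj) h
  by_cases hj : j = 3
  · subst hj
    exact absurd h.symm (not_projCongruent_piSEven_three h2 hi)
  have hr := h.rank_eq
  rw [piSEven_rank hi, piSEven_rank hj] at hr
  have key : ∀ i j : Fin 5, i ≠ 3 → j ≠ 3 →
      (![0, 1, 2, 2, 3] : Fin 5 → ℕ) i = (![0, 1, 2, 2, 3] : Fin 5 → ℕ) j → i = j := by
    decide
  exact key i j hi hj hr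

theorem isSymmProjTransversal_of {ι : Type*} {n : ℕ} {D : ι → Matrix (Fin n) (Fin n) F}
    (hsymm : ∀ i, (D i).IsSymm)
    (hcomplete : ∀ A : Matrix (Fin n) (Fin n) F, A.IsSymm → ∃ i, ProjCongruent A (D i))
    (hinj : ∀ i j, ProjCongruent (D i) (D j) → i = j) : IsSymmProjTransversal D := by
  refine ⟨hsymm, fun A hA => ?_⟩
  obtain ⟨i, hi⟩ := hcomplete A hA
  exact ⟨i, hi, fun j hj => hinj j i (hj.symm.trans hi)⟩

end SymmetricTransversals

/-! ### The descending chain of powers of a nilpotent algebra. -/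

section PowersOfNilpotentAlgebras

variable {F A : Type*} [Field F] [NonUnitalCommRing A] [Module F A]

theorem mul_mem_nilPow_succ {k : ℕ} {a : A} (ha : a ∈ nilPow F A k) (b : A) :
    a * b ∈ nilPow F A (k + 1) :=
  Submodule.subset_span ⟨a, ha, b, rfl⟩

theorem nilPow_succ_le (k : ℕ) : nilPow F A (k + 1) ≤ nilPow F A k := by
  induction k with
  | zero => exact le_top
  | succ k ih =>
    refine Submodule.span_mono ?_
    rintro _ ⟨a, ha, b, rfl⟩
    exact ⟨a, ih ha, b, rfl⟩

theorem nilPow_eq_bot_of_succ_eq {k : ℕ} (hn : ∃ m, nilPow F A m = ⊥)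
    (h : nilPow F A (k + 1) = nilPow F A k) : nilPow F A k = ⊥ := by
  have hconst : ∀ j, nilPow F A (k + j) = nilPow F A k := by
    intro j
    induction j with
    | zero => rfl
    | succ j ih =>
      rw [← h]
      change Submodule.span F {x | ∃ a ∈ nilPow F A (k + j), ∃ b : A, x = a * b} = _
      rw [ih]
      rfl
  obtain ⟨m, hm⟩ := hn
  have h1 : nilPow F A (k + m) ≤ nilPow F A m :=
    antitone_nat_of_succ_le nilPow_succ_le (Nat.le_add_left m k)
  rw [hm, hconst] at h1
  exact le_bot_iff.1 h1

/-- A chain that repeats is constant from there on, hence zero by nilpotency; so dimensions drop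
strictly until 0, where truncated subtraction keeps the bound true. -/
theorem finrank_nilPow_succ_le [FiniteDimensional F A] (hn : ∃ m, nilPow F A m = ⊥) (k : ℕ) :
    Module.finrank F (nilPow F A (k + 1)) ≤ Module.finrank F (nilPow F A k) - 1 := by
  by_cases h : nilPow F A (k + 1) = nilPow F A k
  · rw [h, nilPow_eq_bot_of_succ_eq hn h, finrank_bot]
  · exact Nat.le_sub_one_of_lt
      (Submodule.finrank_lt_finrank_of_lt (lt_of_le_of_ne (nilPow_succ_le k) h))

variable [SMulCommClass F A A]

/-- Indices are shifted by one: this is the inclusion of `A^{i+1} A^{j+1}` in `A^{i+j+2}`. -/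
theorem mul_mem_nilPow_add {i j : ℕ} {a b : A} (ha : a ∈ nilPow F A i) (hb : b ∈ nilPow F A j) :
    a * b ∈ nilPow F A (i + j + 1) := by
  induction j generalizing b with
  | zero => exact mul_mem_nilPow_succ ha b
  | succ j ih =>
    refine Submodule.span_induction ?_ ?_ ?_ ?_ hb
    · rintro _ ⟨c, hc, d, rfl⟩
      rw [← mul_assoc]
      exact mul_mem_nilPow_succ (ih hc) d
    · rw [mul_zero]
      exact zero_mem _
    · intro x y _ _ hx hy
      rw [mul_add]
      exact add_mem hx hy
    · intro c x _ hx
      rw [mul_smul_comm]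
      exact Submodule.smul_mem _ c hx

variable [IsScalarTower F A A]

/-- Generators of `A^{k+1}` modulo `A^{k+2}` and of `A` modulo `A^2` multiply to generators of
`A^{k+2}` modulo `A^{k+3}`. -/
theorem nilPow_succ_le_sup {k : ℕ} {S T : Set A} (hS : S ⊆ nilPow F A k)
    (hk : nilPow F A k ≤ Submodule.span F S ⊔ nilPow F A (k + 1))
    (hT : ⊤ ≤ Submodule.span F T ⊔ nilPow F A 1) :
    nilPow F A (k + 1) ≤
      Submodule.span F (Set.image2 (fun a b => a * b) S T) ⊔ nilPow F A (k + 2) := by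
  refine Submodule.span_le.2 ?_
  rintro _ ⟨a, ha, b, rfl⟩
  obtain ⟨s, hs, u, hu, rfl⟩ := Submodule.mem_sup.1 (hk ha)
  obtain ⟨t, ht, v, hv, rfl⟩ := Submodule.mem_sup.1 (hT (Submodule.mem_top (x := b)))
  rw [add_mul, mul_add, add_assoc]
  refine Submodule.add_mem_sup ?_ (add_mem ?_ (mul_mem_nilPow_succ hu _))
  · have h := Submodule.apply_mem_map₂ (LinearMap.mul F A) hs ht
    rw [Submodule.map₂_span_span] at h
    exact h
  · exact mul_mem_nilPow_add (Submodule.span_le.2 hS hs) hv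

end PowersOfNilpotentAlgebras

/-! ### Dimension counts for complements. -/

section Complements

variable {F V : Type*} [Field F] [AddCommGroup V] [Module F V] [FiniteDimensional F V]

theorem exists_span_sup_eq_top {m : ℕ} (W : Submodule F V)
    (h : Module.finrank F W + m = Module.finrank F V) :
    ∃ v : Fin m → V, Submodule.span F (Set.range v) ⊔ W = ⊤ := by
  obtain ⟨W', hW⟩ := W.exists_isCompl
  have h1 := Submodule.finrank_add_eq_of_isCompl hW
  let b := Module.finBasisOfFinrankEq F W' (by omega : Module.finrank F W' = m)
  refine ⟨fun i => b i, ?_⟩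
  have h2 : Set.range (fun i => (b i : V)) = W'.subtype '' Set.range b := by
    rw [← Set.range_comp]
    rfl
  rw [h2, ← Submodule.map_span, b.span_eq, Submodule.map_top, Submodule.range_subtype, sup_comm]
  exact hW.sup_eq_top

theorem span_singleton_sup_eq {W V' : Submodule F V} (hW : W ≤ V')
    (h : Module.finrank F V' ≤ Module.finrank F W + 1) {x : V} (hx : x ∈ V') (hx' : x ∉ W) :
    Submodule.span F {x} ⊔ W = V' := by
  refine Submodule.eq_of_le_of_finrank_le
    (sup_le ((Submodule.span_singleton_le_iff_mem _ _).2 hx) hW) ?_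
  have h1 : W < Submodule.span F {x} ⊔ W :=
    lt_of_le_of_ne le_sup_right fun h1 =>
      hx' (h1 ▸ Submodule.mem_sup_left (Submodule.mem_span_singleton_self x))
  have := Submodule.finrank_lt_finrank_of_lt h1
  omega

end Complements

/-! ### Recognising each representative from generators and relations. -/

section Tables

theorem range_vec_four {V : Type*} (a b c d : V) : Set.range ![a, b, c, d] = {a, b, c, d} := by
  ext x
  simp [eq_comm]
  tauto

universe u

variable {F : Type u} [Field F]

/-- As many vectors as the dimension form a basis once they span, so independence never has to be
checked. -/
theorem exists_realizes_paramSubgroup {n : ℕ}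
    {N : (Fin n → F) → Matrix (Fin (n + 1)) (Fin (n + 1)) F} (h : IsSubgroupParam N)
    (A : CommNilpotentAlgebra n F) (v : Fin n → A.carrier)
    (hv : ⊤ ≤ Submodule.span F (Set.range v))
    (hb : ∀ x i, v i * ∑ j, x j • v j = ∑ j, N x i.succ j.succ • v j) :
    ∃ e : A.carrier ≃ₗ[F] (Fin n → F), Realizes e (paramSubgroup N h) := by
  let b := basisOfTopLeSpanOfCardEqFinrank v hv (by rw [Fintype.card_fin, A.finrank_eq])
  have hbv : ⇑b = v := coe_basisOfTopLeSpanOfCardEqFinrank _ _ _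
  exact ⟨_, realizes_paramSubgroup A b h fun x i => by rw [hbv, hb]⟩

variable {A : CommNilpotentAlgebra 4 F}

theorem exists_realizes_S5 (x : A.carrier)
    (hspan : ⊤ ≤ Submodule.span F {x, x * x, x * x * x, x * x * x * x})
    (h5 : x * x * x * x * x = 0) : ∃ e : A.carrier ≃ₗ[F] (Fin 4 → F), Realizes e (subgroupS5 F) := by
  have h12 : x * (x * x) = x * x * x := (mul_assoc _ _ _).symm
  have h13 : x * (x * x * x) = x * x * x * x := mul_comm _ _
  have h14 : x * (x * x * x * x) = 0 := by rw [mul_comm, h5]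
  have h22 : x * x * (x * x) = x * x * x * x := (mul_assoc _ _ _).symm
  have h23 : x * x * (x * x * x) = 0 := by rw [mul_assoc, h13, h14]
  have h24 : x * x * (x * x * x * x) = 0 := by rw [mul_assoc, h14, mul_zero]
  have h33 : x * x * x * (x * x * x) = 0 := by rw [mul_assoc (x * x), h13, h24]
  have h34 : x * x * x * (x * x * x * x) = 0 := by rw [mul_assoc, h14, mul_zero]
  have h42 : x * x * x * x * (x * x) = 0 := by rw [← mul_assoc, h5, zero_mul]
  have h43 : x * x * x * x * (x * x * x) = 0 := by rw [← mul_assoc, h42, zero_mul]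
  have h44 : x * x * x * x * (x * x * x * x) = 0 := by rw [mul_assoc (x * x * x), h14, mul_zero]
  have h32 : x * x * x * (x * x) = 0 := by rw [← mul_assoc, h5]
  refine exists_realizes_paramSubgroup _ A ![x, x * x, x * x * x, x * x * x * x] ?_ ?_
  · rwa [range_vec_four]
  · intro c i
    fin_cases i <;> simp [Fin.sum_univ_succ, mul_add, mul_smul_comm, *]

theorem exists_realizes_S41 (x y : A.carrier)
    (hspan : ⊤ ≤ Submodule.span F {x, x * x, x * x * x, y})
    (h4 : x * x * x * x = 0) (hxy : x * y = 0) (hyy : y * y = 0) :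
    ∃ e : A.carrier ≃ₗ[F] (Fin 4 → F), Realizes e (subgroupS41 F) := by
  have hyx : y * x = 0 := by rw [mul_comm, hxy]
  have h12 : x * (x * x) = x * x * x := (mul_assoc _ _ _).symm
  have h13 : x * (x * x * x) = 0 := by rw [mul_comm, h4]
  have h22 : x * x * (x * x) = 0 := by rw [← mul_assoc, h4]
  have h23 : x * x * (x * x * x) = 0 := by rw [mul_assoc, h13, mul_zero]
  have h2y : x * x * y = 0 := by rw [mul_assoc, hxy, mul_zero]
  have h3y : x * x * x * y = 0 := by rw [mul_assoc, hxy, mul_zero]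
  have h32 : x * x * x * (x * x) = 0 := by rw [← mul_assoc, h4, zero_mul]
  have h33 : x * x * x * (x * x * x) = 0 := by rw [mul_assoc, h13, mul_zero]
  have hy2 : y * (x * x) = 0 := by rw [mul_comm, h2y]
  have hy3 : y * (x * x * x) = 0 := by rw [mul_comm, h3y]
  refine exists_realizes_paramSubgroup _ A ![x, x * x, x * x * x, y] ?_ ?_
  · rwa [range_vec_four]
  · intro c i
    fin_cases i <;> simp [Fin.sum_univ_succ, mul_add, mul_smul_comm, *]

theorem exists_realizes_S32sharp (x y : A.carrier)
    (hspan : ⊤ ≤ Submodule.span F {x, x * x, y, x * x * x})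
    (h4 : x * x * x * x = 0) (hxy : x * y = 0) (hyy : y * y = x * x * x) :
    ∃ e : A.carrier ≃ₗ[F] (Fin 4 → F), Realizes e (subgroupS32sharp F) := by
  have hyx : y * x = 0 := by rw [mul_comm, hxy]
  have h12 : x * (x * x) = x * x * x := (mul_assoc _ _ _).symm
  have h13 : x * (x * x * x) = 0 := by rw [mul_comm, h4]
  have h22 : x * x * (x * x) = 0 := by rw [← mul_assoc, h4]
  have h23 : x * x * (x * x * x) = 0 := by rw [mul_assoc, h13, mul_zero]
  have h2y : x * x * y = 0 := by rw [mul_assoc, hxy, mul_zero]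
  have h3y : x * x * x * y = 0 := by rw [mul_assoc, hxy, mul_zero]
  have h32 : x * x * x * (x * x) = 0 := by rw [← mul_assoc, h4, zero_mul]
  have h33 : x * x * x * (x * x * x) = 0 := by rw [mul_assoc, h13, mul_zero]
  have hy2 : y * (x * x) = 0 := by rw [mul_comm, h2y]
  have hy3 : y * (x * x * x) = 0 := by rw [mul_comm, h3y]
  refine exists_realizes_paramSubgroup _ A ![x, x * x, y, x * x * x] ?_ ?_
  · rwa [range_vec_four]
  · intro c i
    fin_cases i <;> simp [Fin.sum_univ_succ, mul_add, mul_smul_comm, *]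

theorem exists_realizes_U1 {α β : F} (x y : A.carrier)
    (hspan : ⊤ ≤ Submodule.span F {x, y, x * x, x * y})
    (h3 : ∀ a b c : A.carrier, a * b * c = 0) (hyy : y * y = β • (x * x) + α • (x * y)) :
    ∃ e : A.carrier ≃ₗ[F] (Fin 4 → F), Realizes e (subgroupU1 α β) := by
  have hyx : y * x = x * y := mul_comm _ _
  have h3' : ∀ a b c : A.carrier, a * (b * c) = 0 := fun a b c => by rw [← mul_assoc, h3]
  refine exists_realizes_paramSubgroup _ A ![x, y, x * x, x * y] ?_ ?_
  · rwa [range_vec_four]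
  · intro c i
    fin_cases i <;> simp [Fin.sum_univ_succ, mul_add, mul_smul_comm, h3, h3', hyx, hyy]
    module

theorem exists_realizes_R {D : Matrix (Fin 3) (Fin 3) F} (v : Fin 3 → A.carrier)
    (w : A.carrier) (hspan : ⊤ ≤ Submodule.span F (Set.range v) ⊔ Submodule.span F {w})
    (hw : ∀ a, w * a = 0) (hv : ∀ i j, v i * v j = D i j • w) :
    ∃ e : A.carrier ≃ₗ[F] (Fin 4 → F), Realizes e (subgroupR D) := by
  have hw' : ∀ a, a * w = 0 := fun a => by rw [mul_comm, hw]
  refine exists_realizes_paramSubgroup _ A ![v 0, v 1, v 2, w] ?_ ?_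
  · rw [← Submodule.span_union] at hspan
    convert hspan using 2
    ext a
    simp [Fin.exists_fin_succ, eq_comm]
    tauto
  · intro c i
    fin_cases i <;> simp [Fin.sum_univ_succ, mul_add, mul_smul_comm, hw, hw', hv] <;> module

end Tables

/-! ### Every four-dimensional algebra is of a listed type. -/

section Completeness

universe u

variable {F : Type u} [Field F] {A : CommNilpotentAlgebra 4 F}

/-- Here `A / A²` is a line; a generator `x` of it generates `A`, since each power of `x` spans the
next layer of the chain. -/
theorem exists_realizes_of_finrank_three (h : Module.finrank F (nilPow F A.carrier 1) = 3) :
    ∃ e : A.carrier ≃ₗ[F] (Fin 4 → F), Realizes e (subgroupS5 F) := by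
  have hf := finrank_nilPow_succ_le (F := F) A.nilpotent
  have h4 : nilPow F A.carrier 4 = ⊥ := by
    rw [← Submodule.finrank_eq_zero (R := F)]
    have h1 := hf 1
    have h2 := hf 2
    have h3 := hf 3
    simp only [Nat.reduceAdd] at h1 h2 h3
    omega
  obtain ⟨v, hv⟩ := exists_span_sup_eq_top (m := 1) (nilPow F A.carrier 1) (by rw [h, A.finrank_eq])
  have hx : Set.range v = {v 0} := by
    ext a
    simp [eq_comm]
  rw [hx] at hv
  set x := v 0
  have hx0 : x ∈ nilPow F A.carrier 0 := Submodule.mem_top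
  have hx1 : x * x ∈ nilPow F A.carrier 1 := mul_mem_nilPow_succ hx0 x
  have hx2 : x * x * x ∈ nilPow F A.carrier 2 := mul_mem_nilPow_succ hx1 x
  have h1 := nilPow_succ_le_sup (k := 0) (Set.singleton_subset_iff.2 hx0) hv.ge hv.ge
  rw [Set.image2_singleton] at h1
  have h2 := nilPow_succ_le_sup (k := 1) (Set.singleton_subset_iff.2 hx1) h1 hv.ge
  rw [Set.image2_singleton] at h2
  have h3 := nilPow_succ_le_sup (k := 2) (Set.singleton_subset_iff.2 hx2) h2 hv.ge
  rw [Set.image2_singleton, h4, sup_bot_eq] at h3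
  refine exists_realizes_S5 x ?_ ?_
  · rw [← hv, Submodule.span_insert, Submodule.span_insert, Submodule.span_insert]
    exact sup_le_sup_left (h1.trans (sup_le_sup_left (h2.trans (sup_le_sup_left h3 _)) _)) _
  · have : x * x * x * x * x ∈ nilPow F A.carrier 4 :=
      mul_mem_nilPow_succ (mul_mem_nilPow_succ hx2 x) x
    rwa [h4, Submodule.mem_bot] at this

/-- The algebra is generated by two elements with one quadratic relation, whose coefficient at the
square of the second generator does not vanish. -/
def HasQuadraticRelation (A : CommNilpotentAlgebra 4 F) (α β : F) : Prop :=
  ∃ x y : A.carrier, y * y = β • (x * x) + α • (x * y) ∧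
    ⊤ ≤ Submodule.span F {x, y, x * x, x * y}

/-- The substitution `y = s y' + t x` in the relation. -/
theorem HasQuadraticRelation.change {α β α' β' : F} (h : HasQuadraticRelation A α β) (s t : F)
    (hs : s ≠ 0) (hα : α - 2 * t = s * α') (hβ : β + α * t - t * t = s * s * β') :
    HasQuadraticRelation A α' β' := by
  obtain ⟨x, y, hyy, hspan⟩ := h
  obtain ⟨y', hy⟩ : ∃ y', y = s • y' + t • x :=
    ⟨s⁻¹ • (y - t • x), by rw [smul_smul, mul_inv_cancel₀ hs, one_smul, sub_add_cancel]⟩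
  refine ⟨x, y', ?_, ?_⟩
  · have hyx : y' * x = x * y' := mul_comm _ _
    rw [hy] at hyy
    simp only [add_mul, mul_add, smul_mul_assoc, mul_smul_comm, hyx, smul_smul, smul_add] at hyy
    have h1 : (s * s) • (y' * y') = (s * s) • (β' • (x * x) + α' • (x * y')) := by
      rw [smul_add, smul_smul, smul_smul, ← hβ, mul_assoc, ← hα]
      refine sub_eq_zero.1 (Eq.trans ?_ (sub_eq_zero.2 hyy))
      module
    exact smul_right_injective _ (mul_ne_zero hs hs) h1
  · refine hspan.trans (Submodule.span_le.2 ?_)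
    have m1 : x ∈ Submodule.span F {x, y', x * x, x * y'} := Submodule.subset_span (by simp)
    have m2 : y' ∈ Submodule.span F {x, y', x * x, x * y'} := Submodule.subset_span (by simp)
    have m3 : x * x ∈ Submodule.span F {x, y', x * x, x * y'} := Submodule.subset_span (by simp)
    have m4 : x * y' ∈ Submodule.span F {x, y', x * x, x * y'} := Submodule.subset_span (by simp)
    rintro _ (rfl | rfl | rfl | rfl)
    · exact m1
    · rw [hy]
      exact add_mem (Submodule.smul_mem _ _ m2) (Submodule.smul_mem _ _ m1)
    · exact m3
    · rw [hy, mul_add, mul_smul_comm, mul_smul_comm]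
      exact add_mem (Submodule.smul_mem _ _ m4) (Submodule.smul_mem _ _ m3)

theorem HasQuadraticRelation.cases_odd [Finite F] (h2 : (2 : F) ≠ 0) {ξ : F} (hξ : ¬ IsSquare ξ)
    {α β : F} (h : HasQuadraticRelation A α β) :
    HasQuadraticRelation A 0 0 ∨ HasQuadraticRelation A 0 1 ∨ HasQuadraticRelation A 0 ξ := by
  have h1 : HasQuadraticRelation A 0 (β + α * (α / 2) - α / 2 * (α / 2)) :=
    h.change 1 (α / 2) one_ne_zero (by field_simp; ring) (by ring)
  set γ := β + α * (α / 2) - α / 2 * (α / 2)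
  by_cases h0 : γ = 0
  · exact Or.inl (h0 ▸ h1)
  by_cases hsq : IsSquare γ
  · obtain ⟨s, hs⟩ := hsq
    have hs0 : s ≠ 0 := by
      rintro rfl
      exact h0 (by rw [hs, mul_zero])
    exact Or.inr (Or.inl (h1.change s 0 hs0 (by ring) (by rw [hs]; ring)))
  · obtain ⟨s, hs0, hs⟩ := exists_eq_mul_sq_of_not_isSquare h2 hξ hsq
    exact Or.inr (Or.inr (h1.change s 0 hs0 (by ring) (by rw [hs]; ring)))

theorem HasQuadraticRelation.cases_even [Finite F] (h2 : (2 : F) = 0) {ξ : F}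
    (hξ : ∀ t, t * t + t + ξ ≠ 0) {α β : F} (h : HasQuadraticRelation A α β) :
    HasQuadraticRelation A 0 0 ∨ HasQuadraticRelation A 1 0 ∨ HasQuadraticRelation A 1 ξ := by
  by_cases hα : α = 0
  · subst hα
    obtain ⟨t, ht⟩ := exists_sq_eq_of_two_eq_zero h2 β
    -- With `α = 0` in characteristic two, `y² - t² x²` is the square of `y - t x`: a double root.
    exact Or.inl (h.change 1 t one_ne_zero (by rw [h2]; ring) (by rw [ht]; ring))
  · have h1 : HasQuadraticRelation A 1 (β / (α * α)) :=
      h.change α 0 hα (by ring) (by field_simp; ring)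
    rcases artinSchreier_cases h2 hξ (β / (α * α)) with ⟨t, ht⟩ | ⟨t, ht⟩
    · exact Or.inr (Or.inl (h1.change 1 t one_ne_zero (by rw [h2]; ring)
        (by rw [ht]; linear_combination t * h2)))
    · exact Or.inr (Or.inr (h1.change 1 t one_ne_zero (by rw [h2]; ring)
        (by rw [ht]; linear_combination t * h2)))

theorem exists_hasQuadraticRelation (h : Module.finrank F (nilPow F A.carrier 1) = 2)
    (h2 : nilPow F A.carrier 2 = ⊥) : ∃ α β, HasQuadraticRelation A α β := by
  obtain ⟨v, hv⟩ := exists_span_sup_eq_top (m := 2) (nilPow F A.carrier 1) (by rw [h, A.finrank_eq])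
  have hx : Set.range v = {v 0, v 1} := by
    ext a
    simp [Fin.exists_fin_two, eq_comm]
  rw [hx] at hv
  generalize v 0 = x at hv
  generalize v 1 = y at hv
  have h1 := nilPow_succ_le_sup (k := 0) (fun _ _ => Submodule.mem_top) hv.ge hv.ge
  rw [h2, sup_bot_eq] at h1
  have hspan : ∀ S : Submodule F A.carrier, x ∈ S → y ∈ S → x * x ∈ S → x * y ∈ S → y * y ∈ S →
      ⊤ ≤ S := by
    intro S m1 m2 m3 m4 m5
    rw [← hv]
    refine sup_le (Submodule.span_le.2 ?_) (h1.trans (Submodule.span_le.2 ?_))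
    · rintro _ (rfl | rfl)
      exacts [m1, m2]
    · rintro _ ⟨a, ha, b, hb, rfl⟩
      change a * b ∈ S
      simp only [Set.mem_insert_iff, Set.mem_singleton_iff] at ha hb
      rcases ha with ha | ha <;> rcases hb with hb | hb <;> rw [ha, hb]
      exacts [m3, m4, by rwa [mul_comm], m5]
  have hmem : ∀ a b : A.carrier, a * b ∈ nilPow F A.carrier 1 := fun a b =>
    mul_mem_nilPow_succ (k := 0) Submodule.mem_top b
  -- Three products lie in a space of dimension two. If the coefficient of `y²` in the resulting
  -- relation vanishes, either `x` and `y` are exchanged or the relation is `x y = 0`.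
  have hdep : ¬ LinearIndependent F (![⟨x * x, hmem x x⟩, ⟨x * y, hmem x y⟩, ⟨y * y, hmem y y⟩] :
      Fin 3 → nilPow F A.carrier 1) := fun hli => by
    have := hli.fintype_card_le_finrank
    rw [h, Fintype.card_fin] at this
    omega
  obtain ⟨g, hg, i, hi⟩ := Fintype.not_linearIndependent_iff.1 hdep
  have hrel : g 0 • (x * x) + g 1 • (x * y) + g 2 • (y * y) = 0 := by
    have := congrArg Subtype.val hg
    simpa [Fin.sum_univ_succ, add_assoc] using this
  have solve : ∀ (x y : A.carrier) (a b c : F), c ≠ 0 →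
      a • (x * x) + b • (x * y) + c • (y * y) = 0 →
      y * y = (-(a / c)) • (x * x) + (-(b / c)) • (x * y) := by
    intro x y a b c hc hrel
    refine smul_right_injective _ hc ?_
    change c • (y * y) = c • _
    rw [smul_add, smul_smul, smul_smul]
    have e1 : c * -(a / c) = -a := by field_simp
    have e2 : c * -(b / c) = -b := by field_simp
    rw [e1, e2]
    refine sub_eq_zero.1 (Eq.trans ?_ hrel)
    module
  by_cases hg2 : g 2 = 0
  · by_cases hg0 : g 0 = 0
    · have hg1 : g 1 ≠ 0 := by
        fin_cases i
        · exact absurd hg0 hi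
        · exact hi
        · exact absurd hg2 hi
      have hxy : x * y = 0 := by
        simpa [hg0, hg2, hg1] using hrel
      -- From `x y = 0` one gets `y² = (x + y) y`, a relation whose leading coefficient does not
      -- vanish.
      refine ⟨1, 0, x + y, y, by simp [add_mul, hxy], ?_⟩
      have m1 : x + y ∈ Submodule.span F {x + y, y, (x + y) * (x + y), (x + y) * y} :=
        Submodule.subset_span (by simp)
      have m2 : y ∈ Submodule.span F {x + y, y, (x + y) * (x + y), (x + y) * y} :=
        Submodule.subset_span (by simp)
      have m3 : (x + y) * (x + y) ∈ Submodule.span F {x + y, y, (x + y) * (x + y), (x + y) * y} :=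
        Submodule.subset_span (by simp)
      have m4 : (x + y) * y ∈ Submodule.span F {x + y, y, (x + y) * (x + y), (x + y) * y} :=
        Submodule.subset_span (by simp)
      have e4 : y * y = (x + y) * y := by rw [add_mul, hxy, zero_add]
      have e3 : x * x = (x + y) * (x + y) - (x + y) * y := by
        rw [mul_add, add_sub_cancel_right, add_mul, mul_comm y x, hxy, add_zero]
      refine hspan _ ?_ m2 ?_ ?_ ?_
      · have := sub_mem m1 m2
        rwa [add_sub_cancel_right] at this
      · rw [e3]
        exact sub_mem m3 m4
      · rw [hxy]
        exact zero_mem _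
      · rw [e4]
        exact m4
    · have e : x * x = (-(g 2 / g 0)) • (y * y) + (-(g 1 / g 0)) • (y * x) :=
        solve y x _ _ _ hg0 (by rw [mul_comm y x, ← hrel]; abel)
      refine ⟨_, _, y, x, e, ?_⟩
      have m3 : y * y ∈ Submodule.span F {y, x, y * y, y * x} := Submodule.subset_span (by simp)
      have m4 : y * x ∈ Submodule.span F {y, x, y * y, y * x} := Submodule.subset_span (by simp)
      refine hspan _ (Submodule.subset_span (by simp)) (Submodule.subset_span (by simp)) ?_
        (by rwa [mul_comm x y]) m3
      rw [e]
      exact add_mem (Submodule.smul_mem _ _ m3) (Submodule.smul_mem _ _ m4)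
  · have e := solve x y _ _ _ hg2 hrel
    refine ⟨_, _, x, y, e, ?_⟩
    have m3 : x * x ∈ Submodule.span F {x, y, x * x, x * y} := Submodule.subset_span (by simp)
    have m4 : x * y ∈ Submodule.span F {x, y, x * x, x * y} := Submodule.subset_span (by simp)
    refine hspan _ (Submodule.subset_span (by simp)) (Submodule.subset_span (by simp)) m3 m4 ?_
    rw [e]
    exact add_mem (Submodule.smul_mem _ _ m3) (Submodule.smul_mem _ _ m4)

theorem HasQuadraticRelation.exists_realizes {α β : F} (h : HasQuadraticRelation A α β)
    (h2 : nilPow F A.carrier 2 = ⊥) :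
    ∃ e : A.carrier ≃ₗ[F] (Fin 4 → F), Realizes e (subgroupU1 α β) := by
  obtain ⟨x, y, hyy, hspan⟩ := h
  refine exists_realizes_U1 x y hspan (fun a b c => ?_) hyy
  have : a * b * c ∈ nilPow F A.carrier 2 :=
    mul_mem_nilPow_succ (mul_mem_nilPow_succ (k := 0) Submodule.mem_top b) c
  rwa [h2, Submodule.mem_bot] at this

/-- An algebra with two-dimensional square and non-zero cube is generated by two elements `x, y`
such that `x y` and `y ^ 2` are multiples of `x ^ 3`. -/
theorem exists_generators_of_cube_ne_bot (h : Module.finrank F (nilPow F A.carrier 1) = 2)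
    (h2 : nilPow F A.carrier 2 ≠ ⊥) :
    ∃ (x y : A.carrier) (a b : F), x * y = a • (x * x * x) ∧ y * y = b • (x * x * x) ∧
      (⊤ : Submodule F A.carrier) ≤ Submodule.span F {x, x * x, x * x * x, y} := by
  have hf := finrank_nilPow_succ_le (F := F) A.nilpotent
  have hf1 := hf 1
  have hf2 := hf 2
  simp only [Nat.reduceAdd] at hf1 hf2
  have hr2 : Module.finrank F (nilPow F A.carrier 2) = 1 := by
    have : Module.finrank F (nilPow F A.carrier 2) ≠ 0 := fun h0 =>
      h2 ((Submodule.finrank_eq_zero (R := F)).1 h0)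
    omega
  have h3 : nilPow F A.carrier 3 = ⊥ := by
    rw [← Submodule.finrank_eq_zero (R := F)]
    omega
  have hz : ∀ w ∈ nilPow F A.carrier 2, ∀ b, w * b = 0 := by
    intro w hw b
    have := mul_mem_nilPow_succ hw b
    rwa [h3, Submodule.mem_bot] at this
  have hmem : ∀ a b : A.carrier, a * b ∈ nilPow F A.carrier 1 := fun a b =>
    mul_mem_nilPow_succ (k := 0) Submodule.mem_top b
  obtain ⟨u, hu, hu'⟩ : ∃ u ∈ nilPow F A.carrier 1, u ∉ nilPow F A.carrier 2 := by
    refine SetLike.exists_of_lt (lt_of_le_of_ne (nilPow_succ_le 1) fun h0 => ?_)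
    change nilPow F A.carrier 2 = _ at h0
    rw [h0] at hr2
    omega
  have hspu : Submodule.span F {u} ⊔ nilPow F A.carrier 2 = nilPow F A.carrier 1 :=
    span_singleton_sup_eq (nilPow_succ_le 1) (h.trans_le (by rw [hr2])) hu hu'
  have hdec : ∀ a ∈ nilPow F A.carrier 1, ∃ s : F, ∃ w ∈ nilPow F A.carrier 2, a = s • u + w := by
    intro a ha
    rw [← hspu] at ha
    obtain ⟨_, hs, w, hw, rfl⟩ := Submodule.mem_sup.1 ha
    obtain ⟨s, rfl⟩ := Submodule.mem_span_singleton.1 hs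
    exact ⟨s, w, hw, rfl⟩
  -- `A²` is spanned by `u` and `A³`, and `A³` annihilates `A`; if `u` did so too, `A³` would be
  -- zero.
  obtain ⟨x, hx⟩ : ∃ x, u * x ≠ 0 := by
    by_contra! h0
    refine h2 ((Submodule.eq_bot_iff _).2 ?_)
    intro a ha
    have hle : nilPow F A.carrier 2 ≤ ⊥ := by
      refine Submodule.span_le.2 ?_
      rintro _ ⟨a, ha, b, rfl⟩
      obtain ⟨s, w, hw, rfl⟩ := hdec a ha
      change _ = _
      rw [add_mul, smul_mul_assoc, h0, hz w hw, smul_zero, add_zero]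
    exact hle ha
  let L := LinearMap.mul F A.carrier u
  have hL : ∀ a, L a = u * a := fun _ => rfl
  have hker : nilPow F A.carrier 1 ≤ LinearMap.ker L := by
    intro a ha
    rw [LinearMap.mem_ker, hL]
    have := mul_mem_nilPow_add hu ha
    rwa [h3, Submodule.mem_bot] at this
  -- Multiplication by `u` maps into the line `A³`, so its kernel has dimension at least 3 and
  -- strictly contains `A²`.
  obtain ⟨y, hy, hy'⟩ : ∃ y, u * y = 0 ∧ y ∉ nilPow F A.carrier 1 := by
    have h1 := L.finrank_range_add_finrank_ker
    have h4 : LinearMap.range L ≤ nilPow F A.carrier 2 := by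
      rintro _ ⟨a, rfl⟩
      exact mul_mem_nilPow_succ hu a
    have h5 := Submodule.finrank_mono h4
    rw [A.finrank_eq] at h1
    obtain ⟨y, hy, hy'⟩ := SetLike.exists_of_lt (lt_of_le_of_ne hker fun h0 => by
      rw [← h0] at h1
      omega)
    exact ⟨y, hy, hy'⟩
  set W := Submodule.span F {y} ⊔ nilPow F A.carrier 1 with hW
  have hWker : W ≤ LinearMap.ker L :=
    sup_le ((Submodule.span_singleton_le_iff_mem _ _).2 hy) hker
  have hWr : 3 ≤ Module.finrank F W := by
    have h1 : nilPow F A.carrier 1 < W :=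
      lt_of_le_of_ne le_sup_right fun h1 =>
        hy' (h1 ▸ Submodule.mem_sup_left (Submodule.mem_span_singleton_self y))
    have := Submodule.finrank_lt_finrank_of_lt h1
    omega
  have htop : Submodule.span F {x} ⊔ W = ⊤ :=
    span_singleton_sup_eq le_top (by rw [finrank_top, A.finrank_eq]; omega) Submodule.mem_top
      fun h1 => hx (hWker h1)
  have hux : u * x ∈ nilPow F A.carrier 2 := mul_mem_nilPow_succ hu x
  have hspz : ∀ w ∈ nilPow F A.carrier 2, ∃ c : F, w = c • (u * x) := by
    intro w hw
    have h1 := span_singleton_sup_eq (W := (⊥ : Submodule F A.carrier)) bot_le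
      (by rw [finrank_bot, hr2]) hux (by simpa using hx)
    rw [sup_bot_eq] at h1
    rw [← h1] at hw
    obtain ⟨c, rfl⟩ := Submodule.mem_span_singleton.1 hw
    exact ⟨c, rfl⟩
  obtain ⟨l, w, hw, hxy⟩ := hdec _ (hmem x y)
  obtain ⟨m, w', hw', hxx⟩ := hdec _ (hmem x x)
  obtain ⟨k, w'', hw'', hyy⟩ := hdec _ (hmem y y)
  -- Compute `x y x` in two ways: as `l (u x)`, and as `x² y`, which vanishes because `u y = 0`. The
  -- same device applied to `y y x` gives `k = 0`.
  have hl : l = 0 := by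
    have h1 : x * y * x = l • (u * x) := by
      rw [hxy, add_mul, hz w hw, add_zero, smul_mul_assoc]
    have h4 : x * y * x = 0 := by
      rw [mul_right_comm, hxx, add_mul, hz w' hw', smul_mul_assoc, hy, smul_zero, add_zero]
    rw [h4] at h1
    exact (smul_eq_zero.1 h1.symm).resolve_right hx
  rw [hl, zero_smul, zero_add] at hxy
  have hk : k = 0 := by
    have h1 : y * y * x = k • (u * x) := by
      rw [hyy, add_mul, hz w'' hw'', add_zero, smul_mul_assoc]
    have h4 : y * y * x = 0 := by
      rw [mul_assoc, mul_comm y x, hxy, mul_comm, hz w hw]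
    rw [h4] at h1
    exact (smul_eq_zero.1 h1.symm).resolve_right hx
  rw [hk, zero_smul, zero_add] at hyy
  -- If `m = 0`, all products of the generators lie in `A³`; then `A² = A³`, contrary to the choice
  -- of `u`.
  have hm : m ≠ 0 := by
    rintro rfl
    rw [zero_smul, zero_add] at hxx
    have hgen : ⊤ ≤ Submodule.span F {x, y} ⊔ nilPow F A.carrier 1 := by
      rw [← htop, hW, Submodule.span_insert, sup_assoc]
    have h1 := nilPow_succ_le_sup (k := 0) (fun _ _ => Submodule.mem_top) hgen hgen
    refine hu' (h1.trans (sup_le (Submodule.span_le.2 ?_) le_rfl) hu)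
    rintro _ ⟨a, ha, b, hb, rfl⟩
    change a * b ∈ nilPow F A.carrier 2
    simp only [Set.mem_insert_iff, Set.mem_singleton_iff] at ha hb
    rcases ha with ha | ha <;> rcases hb with hb | hb <;> rw [ha, hb]
    · rwa [hxx]
    · rwa [hxy]
    · rwa [mul_comm, hxy]
    · rwa [hyy]
  have hxxx : x * x * x = m • (u * x) := by
    rw [hxx, add_mul, hz w' hw', add_zero, smul_mul_assoc]
  have hux' : u * x = m⁻¹ • (x * x * x) := by
    rw [hxxx, smul_smul, inv_mul_cancel₀ hm, one_smul]
  obtain ⟨a, ha⟩ := hspz w hw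
  obtain ⟨b, hb⟩ := hspz w'' hw''
  obtain ⟨c, hc⟩ := hspz w' hw'
  refine ⟨x, y, a * m⁻¹, b * m⁻¹, ?_, ?_, ?_⟩
  · rw [hxy, ha, hux', smul_smul]
  · rw [hyy, hb, hux', smul_smul]
  · have m1 : x ∈ Submodule.span F {x, x * x, x * x * x, y} := Submodule.subset_span (by simp)
    have m2 : x * x ∈ Submodule.span F {x, x * x, x * x * x, y} := Submodule.subset_span (by simp)
    have m3 : x * x * x ∈ Submodule.span F {x, x * x, x * x * x, y} :=
      Submodule.subset_span (by simp)
    have m4 : y ∈ Submodule.span F {x, x * x, x * x * x, y} := Submodule.subset_span (by simp)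
    have m5 : u * x ∈ Submodule.span F {x, x * x, x * x * x, y} := by
      rw [hux']
      exact Submodule.smul_mem _ _ m3
    have m6 : u ∈ Submodule.span F {x, x * x, x * x * x, y} := by
      have : u = m⁻¹ • (x * x - w') := by
        rw [hxx, add_sub_cancel_right, smul_smul, inv_mul_cancel₀ hm, one_smul]
      rw [this, hc]
      exact Submodule.smul_mem _ _ (sub_mem m2 (Submodule.smul_mem _ _ m5))
    rw [← htop, hW, ← hspu]
    refine sup_le ?_ (sup_le ?_ (sup_le ?_ fun w hw => ?_))
    · exact (Submodule.span_singleton_le_iff_mem _ _).2 m1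
    · exact (Submodule.span_singleton_le_iff_mem _ _).2 m4
    · exact (Submodule.span_singleton_le_iff_mem _ _).2 m6
    · obtain ⟨c, rfl⟩ := hspz w hw
      exact Submodule.smul_mem _ _ m5

theorem exists_realizes_of_cube_ne_bot (h : Module.finrank F (nilPow F A.carrier 1) = 2)
    (h2 : nilPow F A.carrier 2 ≠ ⊥) :
    (∃ e : A.carrier ≃ₗ[F] (Fin 4 → F), Realizes e (subgroupS41 F)) ∨
      ∃ e : A.carrier ≃ₗ[F] (Fin 4 → F), Realizes e (subgroupS32sharp F) := by
  obtain ⟨x, y, a, b, hxy, hyy, hspan⟩ := exists_generators_of_cube_ne_bot h h2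
  have h3 : nilPow F A.carrier 3 = ⊥ := by
    rw [← Submodule.finrank_eq_zero (R := F)]
    have hf1 := finrank_nilPow_succ_le (F := F) A.nilpotent 1
    have hf2 := finrank_nilPow_succ_le (F := F) A.nilpotent 2
    simp only [Nat.reduceAdd] at hf1 hf2
    omega
  have hz : ∀ b c d e : A.carrier, b * c * d * e = 0 := by
    intro b c d e
    have : b * c * d * e ∈ nilPow F A.carrier 3 :=
      mul_mem_nilPow_succ (mul_mem_nilPow_succ (mul_mem_nilPow_succ (k := 0)
        Submodule.mem_top c) d) e
    rwa [h3, Submodule.mem_bot] at this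
  -- Subtracting `a x²` from `y` kills `x y` and leaves `y²` unchanged, since fourth powers vanish.
  obtain ⟨y', hy'⟩ : ∃ y', y = y' + a • (x * x) := ⟨y - a • (x * x), by rw [sub_add_cancel]⟩
  have hxy' : x * y' = 0 := by
    rw [hy', mul_add, mul_smul_comm, ← mul_assoc] at hxy
    simpa using hxy
  have hyy' : y' * y' = b • (x * x * x) := by
    have h1 : y' * (x * x) = 0 := by rw [mul_comm, mul_assoc, hxy', mul_zero]
    have h4 : x * x * y' = 0 := by rw [mul_comm, h1]
    have h5 : x * x * (x * x) = 0 := by rw [← mul_assoc, hz]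
    rw [hy'] at hyy
    simpa [mul_add, add_mul, smul_mul_assoc, mul_smul_comm, h1, h4, h5] using hyy
  have hspan' : ∀ S : Submodule F A.carrier, x ∈ S → x * x ∈ S → x * x * x ∈ S → y' ∈ S →
      ⊤ ≤ S := by
    intro S m1 m2 m3 m4
    refine hspan.trans (Submodule.span_le.2 ?_)
    rintro _ (rfl | rfl | rfl | rfl)
    · exact m1
    · exact m2
    · exact m3
    · rw [hy']
      exact add_mem m4 (Submodule.smul_mem _ _ m2)
  by_cases hb : b = 0
  · left
    rw [hb, zero_smul] at hyy'
    refine exists_realizes_S41 x y' (hspan' _ ?_ ?_ ?_ ?_) (hz _ _ _ _) hxy' hyy' <;>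
      exact Submodule.subset_span (by simp)
  · right
    -- Scaling both generators by `b` gives `(b y')² = b² · b x³ = (b x)³`.
    have e2 : (b • x) * (b • x) = (b * b) • (x * x) := by
      rw [smul_mul_assoc, mul_smul_comm, smul_smul]
    have e3 : (b • x) * (b • x) * (b • x) = (b * b * b) • (x * x * x) := by
      rw [e2, smul_mul_assoc, mul_smul_comm, smul_smul]
    refine exists_realizes_S32sharp (b • x) (b • y') ?_ (hz _ _ _ _) ?_ ?_
    · have key : ∀ (c : F) (v : A.carrier) (S : Submodule F A.carrier), c ≠ 0 → c • v ∈ S → v ∈ S :=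
        fun c v S hc hv => (Submodule.smul_mem_iff S hc).1 hv
      refine hspan' _ (key b _ _ hb ?_) (key (b * b) _ _ (mul_ne_zero hb hb) ?_)
        (key (b * b * b) _ _ (mul_ne_zero (mul_ne_zero hb hb) hb) ?_) (key b _ _ hb ?_)
      · exact Submodule.subset_span (by simp)
      · rw [← e2]
        exact Submodule.subset_span (by simp)
      · rw [← e3]
        exact Submodule.subset_span (by simp)
      · exact Submodule.subset_span (by simp)
    · rw [smul_mul_assoc, mul_smul_comm, hxy', smul_zero, smul_zero]
    · rw [e3, smul_mul_assoc, mul_smul_comm, hyy', smul_smul, smul_smul, mul_assoc]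

/-- The products in the algebra are given by the symmetric bilinear form `D`. -/
def HasFormTable (A : CommNilpotentAlgebra 4 F) (D : Matrix (Fin 3) (Fin 3) F) : Prop :=
  ∃ (v : Fin 3 → A.carrier) (w : A.carrier),
    ⊤ ≤ Submodule.span F (Set.range v) ⊔ Submodule.span F {w} ∧ w ≠ 0 ∧ (∀ a, w * a = 0) ∧
      ∀ i j, v i * v j = D i j • w

theorem HasFormTable.isSymm {D : Matrix (Fin 3) (Fin 3) F} (h : HasFormTable A D) : D.IsSymm := by
  obtain ⟨v, w, -, hw, -, hv⟩ := h
  ext i j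
  refine smul_left_injective F hw ?_
  change D j i • w = D i j • w
  rw [← hv, ← hv, mul_comm]

theorem HasFormTable.exists_realizes {D : Matrix (Fin 3) (Fin 3) F} (h : HasFormTable A D) :
    ∃ e : A.carrier ≃ₗ[F] (Fin 4 → F), Realizes e (subgroupR D) := by
  obtain ⟨v, w, hspan, -, hw, hv⟩ := h
  exact exists_realizes_R v w hspan hw hv

/-- The matrix `P` changes the generators and the scalar `c` rescales `w`, which is why congruence
is taken projectively. -/
theorem HasFormTable.of_projCongruent {D D' : Matrix (Fin 3) (Fin 3) F} (h : HasFormTable A D)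
    (hD : ProjCongruent D D') : HasFormTable A D' := by
  obtain ⟨v, w, hspan, hw0, hw, hv⟩ := h
  obtain ⟨P, c, hc, hP⟩ := hD
  refine ⟨fun i => ∑ k, P.val i k • v k, c • w, ?_, smul_ne_zero hc hw0, fun a => ?_,
    fun i j => ?_⟩
  · rw [Submodule.span_singleton_smul_eq hc.isUnit]
    refine hspan.trans (sup_le_sup_right (Submodule.span_le.2 ?_) _)
    rintro _ ⟨i, rfl⟩
    have h1 : (P⁻¹).val * P.val = 1 := P.inv_mul
    have h2 : v i = ∑ j, (P⁻¹).val i j • ∑ k, P.val j k • v k := by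
      simp only [Finset.smul_sum, smul_smul]
      rw [Finset.sum_comm]
      simp only [← Finset.sum_smul, ← Matrix.mul_apply, h1]
      simp [Matrix.one_apply]
    rw [h2]
    exact Submodule.sum_mem _ fun j _ => Submodule.smul_mem _ _ (Submodule.subset_span ⟨j, rfl⟩)
  · rw [smul_mul_assoc, hw, smul_zero]
  · have h1 := congrFun (congrFun hP i) j
    rw [Matrix.smul_apply, smul_eq_mul, Matrix.mul_apply] at h1
    rw [smul_smul, mul_comm (D' i j) c, ← h1]
    simp only [Finset.sum_mul, Finset.mul_sum, smul_mul_assoc, mul_smul_comm, hv, smul_smul,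
      Matrix.mul_apply, Matrix.transpose_apply, Finset.sum_smul, Finset.smul_sum]
    refine Finset.sum_congr rfl fun k _ => Finset.sum_congr rfl fun l _ => ?_
    congr 1
    ring

theorem exists_hasFormTable (h : Module.finrank F (nilPow F A.carrier 1) ≤ 1) :
    ∃ D, HasFormTable A D := by
  have hmem : ∀ a b : A.carrier, a * b ∈ nilPow F A.carrier 1 := fun a b =>
    mul_mem_nilPow_succ (k := 0) Submodule.mem_top b
  have h2 : nilPow F A.carrier 2 = ⊥ := by
    rw [← Submodule.finrank_eq_zero (R := F)]
    have hf1 := finrank_nilPow_succ_le (F := F) A.nilpotent 1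
    simp only [Nat.reduceAdd] at hf1
    omega
  obtain ⟨w, hw0, hw, hle⟩ : ∃ w : A.carrier, w ≠ 0 ∧ (∀ a, w * a = 0) ∧
      nilPow F A.carrier 1 ≤ Submodule.span F {w} := by
    -- If `A² = 0`, any nonzero `w` serves and `D = 0`; otherwise `w` spans the line `A²`.
    by_cases h1 : nilPow F A.carrier 1 = ⊥
    · have : Nontrivial A.carrier := Module.nontrivial_of_finrank_pos (R := F) (by
        rw [A.finrank_eq]
        norm_num)
      obtain ⟨w, hw⟩ := exists_ne (0 : A.carrier)
      refine ⟨w, hw, fun a => ?_, by rw [h1]; exact bot_le⟩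
      have := hmem w a
      rwa [h1, Submodule.mem_bot] at this
    · obtain ⟨w, hw, hw0⟩ := Submodule.exists_mem_ne_zero_of_ne_bot h1
      refine ⟨w, hw0, fun a => ?_, ?_⟩
      · have := mul_mem_nilPow_succ hw a
        rwa [h2, Submodule.mem_bot] at this
      · have := span_singleton_sup_eq (W := (⊥ : Submodule F A.carrier)) bot_le
          (by rwa [finrank_bot]) hw (by simpa using hw0)
        rw [sup_bot_eq] at this
        exact this.ge
  obtain ⟨v, hv⟩ := exists_span_sup_eq_top (m := 3) (Submodule.span F {w})
    (by rw [finrank_span_singleton hw0, A.finrank_eq])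
  have hD : ∀ i j, ∃ c : F, v i * v j = c • w := fun i j => by
    obtain ⟨c, hc⟩ := Submodule.mem_span_singleton.1 (hle (hmem (v i) (v j)))
    exact ⟨c, hc.symm⟩
  choose D hD using hD
  exact ⟨Matrix.of D, v, w, hv.ge, hw0, hw, hD⟩

/-- The types of four-dimensional commutative nilpotent algebras. -/
theorem algebra_cases (A : CommNilpotentAlgebra 4 F) :
    (∃ e : A.carrier ≃ₗ[F] (Fin 4 → F), Realizes e (subgroupS5 F)) ∨
    (∃ e : A.carrier ≃ₗ[F] (Fin 4 → F), Realizes e (subgroupS41 F)) ∨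
    (∃ e : A.carrier ≃ₗ[F] (Fin 4 → F), Realizes e (subgroupS32sharp F)) ∨
    (nilPow F A.carrier 2 = ⊥ ∧ ∃ α β, HasQuadraticRelation A α β) ∨
    ∃ D, HasFormTable A D := by
  have h1 := finrank_nilPow_succ_le (F := F) A.nilpotent 0
  have h0 : Module.finrank F (nilPow F A.carrier 0) = 4 := finrank_top F A.carrier ▸ A.finrank_eq
  rw [h0] at h1
  simp only [Nat.reduceAdd] at h1
  by_cases h3 : Module.finrank F (nilPow F A.carrier 1) = 3
  · exact Or.inl (exists_realizes_of_finrank_three h3)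
  by_cases h4 : Module.finrank F (nilPow F A.carrier 1) = 2
  · by_cases h2 : nilPow F A.carrier 2 = ⊥
    · exact Or.inr (Or.inr (Or.inr (Or.inl ⟨h2, exists_hasQuadraticRelation h4 h2⟩)))
    · rcases exists_realizes_of_cube_ne_bot h4 h2 with h | h
      · exact Or.inr (Or.inl h)
      · exact Or.inr (Or.inr (Or.inl h))
  · exact Or.inr (Or.inr (Or.inr (Or.inr (exists_hasFormTable (by omega)))))

end Completeness

/-! ### Assembling the lists of eleven representatives. -/

section Transversals

universe u

variable {F : Type u} [Field F]

theorem HasFormTable.exists_realizes_of_transversal {A : CommNilpotentAlgebra 4 F} {ι : Type*}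
    {D : ι → Matrix (Fin 3) (Fin 3) F} (hD : IsSymmProjTransversal D)
    (h : ∃ D', HasFormTable A D') :
    ∃ (k : ι) (e : A.carrier ≃ₗ[F] (Fin 4 → F)), Realizes e (subgroupR (D k)) := by
  obtain ⟨D', hD'⟩ := h
  obtain ⟨k, hk, -⟩ := hD.2 D' hD'.isSymm
  exact ⟨k, (hD'.of_projCongruent hk).exists_realizes⟩

/-- A family of subgroups is a transversal if every algebra has exactly one of them as its
regular representation. -/
theorem isAbelianRegularTransversal_of {n : ℕ} {ι : Type*} {R : ι → Subgroup (AGL n F)}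
    (hreg : ∀ i, IsAbelianRegular (R i))
    (hcomplete : ∀ A : CommNilpotentAlgebra n F,
      ∃ (i : ι) (e : A.carrier ≃ₗ[F] (Fin n → F)), Realizes e (R i))
    (hinj : ∀ (A : CommNilpotentAlgebra n F) (i j : ι) (e e' : A.carrier ≃ₗ[F] (Fin n → F)),
      Realizes e (R i) → Realizes e' (R j) → i = j) : IsAbelianRegularTransversal R := by
  refine ⟨hreg, fun S hS => ?_⟩
  obtain ⟨A, hA⟩ := hS.exists_isAlgebraOf
  have hrefl : AlgIsomorphic A A := ⟨NonUnitalAlgHom.id F A.carrier, Function.bijective_id⟩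
  obtain ⟨i, e, he⟩ := hcomplete A
  refine ⟨i, (areConjSubgroups_iff hS (hreg i) hA he.isAlgebraOf).2 hrefl, fun j hj => ?_⟩
  -- A second conjugate `R j` has an algebra isomorphic to `A`, so `A` is realised by both and
  -- `hinj` applies.
  obtain ⟨B, hB⟩ := (hreg j).exists_isAlgebraOf
  have hAB := (areConjSubgroups_iff hS (hreg j) hA hB).1 hj
  obtain ⟨e', he'⟩ := (hAB.isAlgebraOf hB).exists_realizes (hreg j).1
  exact hinj A j i e' e he' he

/-- The combinatorial form of the classification: six subgroups distinguished by
`algebraType`, followed by the subgroups `R_D`. -/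
theorem isAbelianRegularTransversal_append {T : Fin 6 → Subgroup (AGL 4 F)}
    {D : Fin 5 → Matrix (Fin 3) (Fin 3) F} (hD : IsSymmProjTransversal D)
    (hreg : ∀ i, IsAbelianRegular (T i))
    (htype : ∀ (A : CommNilpotentAlgebra 4 F) (i : Fin 6) (e : A.carrier ≃ₗ[F] (Fin 4 → F)),
      Realizes e (T i) → algebraType F A.carrier = ![0, 1, 2, 3, 4, 5] i)
    (hcomplete : ∀ A : CommNilpotentAlgebra 4 F,
      (∃ (i : Fin 6) (e : A.carrier ≃ₗ[F] (Fin 4 → F)), Realizes e (T i)) ∨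
        ∃ D', HasFormTable A D') :
    IsAbelianRegularTransversal (Fin.append (m := 6) (n := 5) T (fun k => subgroupR (D k))) := by
  have hlt : ∀ i : Fin 6, (![0, 1, 2, 3, 4, 5] : Fin 6 → ℕ) i < 6 := by decide
  have hinj6 : ∀ i j : Fin 6,
      (![0, 1, 2, 3, 4, 5] : Fin 6 → ℕ) i = (![0, 1, 2, 3, 4, 5] : Fin 6 → ℕ) j → i = j := by
    decide
  refine isAbelianRegularTransversal_of (fun i => ?_) (fun A => ?_) ?_
  · refine Fin.addCases (fun i => ?_) (fun k => ?_) i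
    · rw [Fin.append_left]
      exact hreg i
    · rw [Fin.append_right]
      exact subgroupR_isAbelianRegular (hD.1 k)
  · rcases hcomplete A with ⟨i, e, he⟩ | h
    · exact ⟨Fin.castAdd 5 i, e, by rwa [Fin.append_left]⟩
    · obtain ⟨k, e, he⟩ := HasFormTable.exists_realizes_of_transversal hD h
      exact ⟨Fin.natAdd 6 k, e, by rwa [Fin.append_right]⟩
  · intro A i j e e'
    refine Fin.addCases (fun i => ?_) (fun k => ?_) i <;>
      refine Fin.addCases (fun j => ?_) (fun l => ?_) j
    · rw [Fin.append_left, Fin.append_left]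
      intro h h'
      rw [hinj6 i j ((htype A i e h).symm.trans (htype A j e' h'))]
    · rw [Fin.append_left, Fin.append_right]
      intro h h'
      have h1 := (htype A i e h).symm.trans h'.algebraType_R
      have h2 := hlt i
      omega
    · rw [Fin.append_left, Fin.append_right]
      intro h h'
      have h1 := (htype A j e' h').symm.trans h.algebraType_R
      have h2 := hlt j
      omega
    · rw [Fin.append_right, Fin.append_right]
      intro h h'
      have h1 := (hD.2 (D k) (hD.1 k)).unique (.refl _) (h.projCongruent h')
      rw [h1]

theorem repsOdd_isAbelianRegularTransversal [Finite F] (h2 : (2 : F) ≠ 0) {ξ : F}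
    (hξ : ¬ IsSquare ξ) (hD : IsSymmProjTransversal (piSOdd ξ)) :
    IsAbelianRegularTransversal (repsOdd ξ) := by
  refine isAbelianRegularTransversal_append hD (fun i => ?_) (fun A i e he => ?_) fun A => ?_
  · fin_cases i
    exacts [subgroupS5_isAbelianRegular, subgroupS41_isAbelianRegular,
      subgroupS32sharp_isAbelianRegular, subgroupU1_isAbelianRegular _ _,
      subgroupU1_isAbelianRegular _ _, subgroupU1_isAbelianRegular _ _]
  · fin_cases i
    · exact Realizes.algebraType_S5 he
    · exact Realizes.algebraType_S41 he
    · exact Realizes.algebraType_S32sharp he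
    · exact Realizes.algebraType_U1_zero he
    -- The roots of `s² = 1` are `1` and `-1`, distinct because `2 ≠ 0`.
    · exact Realizes.algebraType_U1_of_split (s := 1) he (by ring) (by simpa using h2.symm)
    · exact Realizes.algebraType_U1_of_irreducible he
        fun s hs => hξ ⟨s, by rw [hs, zero_mul, add_zero]⟩
  · rcases algebra_cases A with h | h | h | ⟨hcube, α, β, h⟩ | h
    · exact Or.inl ⟨0, h⟩
    · exact Or.inl ⟨1, h⟩
    · exact Or.inl ⟨2, h⟩
    · rcases h.cases_odd h2 hξ with h | h | h
      · exact Or.inl ⟨3, h.exists_realizes hcube⟩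
      · exact Or.inl ⟨4, h.exists_realizes hcube⟩
      · exact Or.inl ⟨5, h.exists_realizes hcube⟩
    · exact Or.inr h

theorem repsEven_isAbelianRegularTransversal [Finite F] (h2 : (2 : F) = 0) {ξ : F}
    (hξ : ∀ t, t * t + t + ξ ≠ 0) (hD : IsSymmProjTransversal (piSEven F)) :
    IsAbelianRegularTransversal (repsEven ξ) := by
  refine isAbelianRegularTransversal_append hD (fun i => ?_) (fun A i e he => ?_) fun A => ?_
  · fin_cases i
    exacts [subgroupS5_isAbelianRegular, subgroupS41_isAbelianRegular,
      subgroupS32sharp_isAbelianRegular, subgroupU1_isAbelianRegular _ _,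
      subgroupU1_isAbelianRegular _ _, subgroupU1_isAbelianRegular _ _]
  · fin_cases i
    · exact Realizes.algebraType_S5 he
    · exact Realizes.algebraType_S41 he
    · exact Realizes.algebraType_S32sharp he
    · exact Realizes.algebraType_U1_zero he
    -- The roots of `s² = s` are `1` and `0`.
    · exact Realizes.algebraType_U1_of_split (s := 1) he (by ring) (by simp [h2])
    · exact Realizes.algebraType_U1_of_irreducible he
        fun s hs => hξ s (by linear_combination hs + (s + ξ) * h2)
  · rcases algebra_cases A with h | h | h | ⟨hcube, α, β, h⟩ | h
    · exact Or.inl ⟨0, h⟩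
    · exact Or.inl ⟨1, h⟩
    · exact Or.inl ⟨2, h⟩
    · rcases h.cases_even h2 hξ with h | h | h
      · exact Or.inl ⟨3, h.exists_realizes hcube⟩
      · exact Or.inl ⟨4, h.exists_realizes hcube⟩
      · exact Or.inl ⟨5, h.exists_realizes hcube⟩
    · exact Or.inr h

end Transversals

/-! ### Counting classes from a transversal. -/

section Counting

universe u

variable {F : Type u} [Field F] {n k : ℕ} {R : Fin k → Subgroup (AGL n F)}

theorem IsAbelianRegularTransversal.card_abelianRegularClasses
    (hR : IsAbelianRegularTransversal R) : Nat.card (AbelianRegularClasses n F) = k := by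
  let f : Fin k → AbelianRegularClasses n F := fun i =>
    Quotient.mk (abelianRegularSetoid n F) ⟨R i, hR.1 i⟩
  have hf : Function.Bijective f := by
    constructor
    · intro i j hij
      have h : AreConjSubgroups (R i) (R j) := Quotient.exact hij
      exact (hR.2 (R i) (hR.1 i)).unique ((abelianRegularSetoid n F).refl ⟨R i, hR.1 i⟩) h
    · intro q
      induction q using Quotient.inductionOn with
      | h S =>
        obtain ⟨i, hi, -⟩ := hR.2 S.1 S.2
        exact ⟨i, Quotient.sound (AreConjSubgroups.symm hi)⟩
  rw [← Nat.card_eq_of_bijective f hf, Nat.card_fin]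

theorem IsAbelianRegularTransversal.card_commNilpotentClasses
    (hR : IsAbelianRegularTransversal R) : Nat.card (CommNilpotentClasses n F) = k := by
  choose A hA using fun i => (hR.1 i).exists_isAlgebraOf
  let f : Fin k → CommNilpotentClasses n F := fun i => Quotient.mk (commNilpotentSetoid n F) (A i)
  have hf : Function.Bijective f := by
    constructor
    · intro i j hij
      have h : AlgIsomorphic (A i) (A j) := Quotient.exact hij
      exact (hR.2 (R i) (hR.1 i)).unique ((abelianRegularSetoid n F).refl ⟨R i, hR.1 i⟩)
        ((areConjSubgroups_iff (hR.1 i) (hR.1 j) (hA i) (hA j)).2 h)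
    · intro q
      induction q using Quotient.inductionOn with
      | h B =>
        obtain ⟨S, hS, hB⟩ := exists_isAbelianRegular_isAlgebraOf B
        obtain ⟨i, hi, -⟩ := hR.2 S hS
        exact ⟨i, Quotient.sound ((areConjSubgroups_iff (hR.1 i) hS (hA i) hB).1 hi.symm)⟩
  rw [← Nat.card_eq_of_bijective f hf, Nat.card_fin]

end Counting

theorem mainTheorem5 (F : Type*) [Field F] [Finite F] :
    -- the two counts
    Nat.card (AbelianRegularClasses 4 F) = 11 ∧
    Nat.card (CommNilpotentClasses 4 F) = 11 ∧
    -- `R ↦ R - I` induces a bijection between the two sets of classes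
    (∀ R : Subgroup (AGL 4 F), IsAbelianRegular R →
      ∃ A : CommNilpotentAlgebra 4 F, IsAlgebraOf A R) ∧
    (∀ A : CommNilpotentAlgebra 4 F,
      ∃ R : Subgroup (AGL 4 F), IsAbelianRegular R ∧ IsAlgebraOf A R) ∧
    (∀ (R S : Subgroup (AGL 4 F)) (A B : CommNilpotentAlgebra 4 F),
      IsAbelianRegular R → IsAbelianRegular S → IsAlgebraOf A R → IsAlgebraOf B S →
        (AreConjSubgroups R S ↔ AlgIsomorphic A B)) ∧
    -- representatives, `q` odd
    (Odd (Nat.card F) →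
      (∃ ξ : F, Irreducible (X ^ 2 - C ξ : F[X])) ∧
      ∀ ξ : F, Irreducible (X ^ 2 - C ξ : F[X]) →
        IsSymmProjTransversal (piSOdd ξ) ∧ IsAbelianRegularTransversal (repsOdd ξ)) ∧
    -- representatives, `q` even
    (Even (Nat.card F) →
      (∃ ξ : F, Irreducible (X ^ 2 + X + C ξ : F[X])) ∧
      ∀ ξ : F, Irreducible (X ^ 2 + X + C ξ : F[X]) →
        IsSymmProjTransversal (piSEven F) ∧ IsAbelianRegularTransversal (repsEven ξ)) := by
  have hodd : Odd (Nat.card F) →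
      (∃ ξ : F, Irreducible (X ^ 2 - C ξ : F[X])) ∧
      ∀ ξ : F, Irreducible (X ^ 2 - C ξ : F[X]) →
        IsSymmProjTransversal (piSOdd ξ) ∧ IsAbelianRegularTransversal (repsOdd ξ) := by
    intro hq
    have h2 := two_ne_zero_of_odd_card hq
    obtain ⟨ξ, hξ⟩ := exists_not_isSquare h2
    refine ⟨⟨ξ, irreducible_X_sq_sub_C_iff.2 hξ⟩, fun ξ hξ => ?_⟩
    rw [irreducible_X_sq_sub_C_iff] at hξ
    have hD : IsSymmProjTransversal (piSOdd ξ) :=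
      isSymmProjTransversal_of (piSOdd_isSymm ξ) (fun _ hA => piSOdd_complete h2 hξ hA)
        fun _ _ => piSOdd_injective hξ
    exact ⟨hD, repsOdd_isAbelianRegularTransversal h2 hξ hD⟩
  have heven : Even (Nat.card F) →
      (∃ ξ : F, Irreducible (X ^ 2 + X + C ξ : F[X])) ∧
      ∀ ξ : F, Irreducible (X ^ 2 + X + C ξ : F[X]) →
        IsSymmProjTransversal (piSEven F) ∧ IsAbelianRegularTransversal (repsEven ξ) := by
    intro hq
    have h2 := two_eq_zero_of_even_card hq
    obtain ⟨ξ, hξ⟩ := exists_artinSchreier_ne h2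
    refine ⟨⟨ξ, irreducible_X_sq_add_X_add_C_iff.2 hξ⟩, fun ξ hξ => ?_⟩
    rw [irreducible_X_sq_add_X_add_C_iff] at hξ
    have hD : IsSymmProjTransversal (piSEven F) :=
      isSymmProjTransversal_of piSEven_isSymm (fun _ hA => piSEven_complete h2 hA)
        fun _ _ => piSEven_injective h2
    exact ⟨hD, repsEven_isAbelianRegularTransversal h2 hξ hD⟩
  -- Either parity of the order provides a transversal indexed by `Fin 11`, and both counts follow
  -- from it.
  obtain ⟨R, hR⟩ : ∃ R : Fin 11 → Subgroup (AGL 4 F), IsAbelianRegularTransversal R := by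
    rcases Nat.even_or_odd (Nat.card F) with hq | hq
    · obtain ⟨⟨ξ, hξ⟩, h⟩ := heven hq
      exact ⟨_, (h ξ hξ).2⟩
    · obtain ⟨⟨ξ, hξ⟩, h⟩ := hodd hq
      exact ⟨_, (h ξ hξ).2⟩
  exact ⟨hR.card_abelianRegularClasses, hR.card_commNilpotentClasses,
    fun _ hR => hR.exists_isAlgebraOf, exists_isAbelianRegular_isAlgebraOf,
    fun _ _ _ _ hR hS hA hB => areConjSubgroups_iff hR hS hA hB, hodd, heven⟩
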